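/- **Setting.** Let $d\ge 1$, let $A$ be a symmetric nonnegative definite $d\times d$ matrix, and let $\mu\ge 0$ be a Borel measure on $\mathbb{R}^d$ with $\int(1\wedge|z|^2)\,d\mu(z)<\infty$. Put $$\mathcal{L}\varphi(x)=\operatorname{div}(AD\varphi)(x)+\int_{\mathbb{R}^d}\big[\varphi(x+z)-\varphi(x)-\mathbf 1_{|z|<1}D\varphi(x)\cdot z\big]\,d\mu(z),$$ $$\widehat{\mathcal{L}}(\xi)=\xi\cdot A\xi+\int_{\mathbb{R}^d}\big(1-e^{i\xi\cdot z}+i\xi\cdot z\,\mathbf 1_{|z|<1}\big)\,d\mu(z).$$ The heat kernel $p_t$ of $\mathcal{L}$ is the probability measure with $\int e^{-i\xi\cdot x}\,p_t(dx)=e^{-t\widehat{\mathcal{L}}(\xi)}$, and $P_t\varphi=p_t*\varphi$. Let $T>0$, $\alpha\in(1,2]$, $c_0>0$, and assume that for $t\in(0,T]$ the heat kernel has a density $p_t\in C_b^\infty(\mathbb{R}^d)$ with $\int|Dp_t(y)|\,dy\le c_0t^{-1/\alpha}$. Let $\beta\in[0,1]$ with $\alpha+\beta\notin\mathbb{N}$,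 and let $u_0:\mathbb{R}^d\to\mathbb{R}$ be bounded and Lipschitz. For $n\in\{0,1,2,\dots\}$, $C^n_b$ is the space of $C^n$ functions with $\|\varphi\|_{C_b^n}=\sum_{j\le n}\|D^j\varphi\|_\infty<\infty$; for $\gamma=n+\theta$ with $\theta\in(0,1)$, $C^\gamma_b$ is the space of $\varphi\in C^n_b$ with $\|\varphi\|_{C_b^\gamma}=\|\varphi\|_{C_b^n}+[D^n\varphi]_\theta<\infty$, where $[g]_\sigma=\sup_{x\ne y}|g(x)-g(y)|/|x-y|^\sigma$. **Assumptions on $H$.** $H:[0,T]\times\mathbb{R}^d\times\mathbb{R}^d\times\mathbb{R}\to\mathbb{R}$ is measurable in $(t,x)$ for each $(p,q)$, $\sup_{t,x}|H(t,x,0,0)|<\infty$, and for every $R>0$ there is $C_R$ such that for $t\in[0,T]$, $x,x'\in\mathbb{R}^d$, and $p,p',q,q'$ of norm less than $R$, $$|H(t,x',p',q')-H(t,x,p,q)|\le C_R\big(1\wedge|x-x'|^\beta+|p-p'|+|q-q'|\big),$$ where for $\beta=0$ the term $1\wedge|x-x'|^\beta$ is read as $0$ if $x=x'$. **Assumptions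 on $Q$.** $Q$ maps $C^1_b(\mathbb{R}^d)$ to measurable functions, and there is a constant $C$ such that $$\|Qu\|_\infty\le C\|u\|_{C_b^1}\ \ (u\in C_b^1),\qquad [Qu]_\sigma\le C\|u\|_{C_b^{1+\sigma}}\ \ (\sigma\in(0,\beta],\ u\in C_b^{1+\sigma}),$$ and $\|Qu-Qv\|_\infty\le C\|u-v\|_{C_b^1}$ for $u,v\in C^1_b$. (If $Q$ is linear, the last bound is the same as the first.) **Mild solutions.** A mild solution on $(0,T']$ of $$\partial_tu-\mathcal{L}u-H(t,x,Du,Qu)=0,\qquad u(0,\cdot)=u_0, \tag{1}$$ is a function $u\in C((0,T'];C^1_b(\mathbb{R}^d))$ such that for all $t\in(0,T']$, $x\in\mathbb{R}^d$ the following integrals exist and $$u(t,x)=P_tu_0(x)+\int_0^tP_{t-s}\big[H(s,\cdot,Du(s,\cdot),Qu(s,\cdot))\big](x)\,ds.$$ **Theorem.** (i) For every $H$ and $Q$ as above there is $T_0\in(0,T]$ such that for every $T'\in(0,T_0]$, equation (1) has a mild solution $u$ on $(0,T']$ with $u\in C_b((0,T'];C^1_b(\mathbb{R}^d))$ and $u(t)\in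 C_b^{\alpha+\beta}(\mathbb{R}^d)$ for all $t\in(0,T']$. (ii) (Modulated jumps.) Let $\mathbf j:\mathbb{R}^d\to\mathbb{R}^d$ be measurable with $|\mathbf j(z)-z|\le K|z|^2$ for $|z|\le1$ and some constant $K$, and put $Q_{\mathbf j}u(x)=\int_{\mathbb{R}^d}\big(u(x+\mathbf j(z))-u(x+z)\big)\,d\mu(z)$. This integral converges absolutely for $u\in C^1_b$; $Q_{\mathbf j}$ satisfies the assumptions on $Q$; and for $\varphi\in C^2_b$ the limit $$\mathcal{L}_{\mathbf j}\varphi(x)=\operatorname{div}(AD\varphi)(x)+\lim_{\varepsilon\to0^+}\int_{|z|\ge\varepsilon}\big[\varphi(x+\mathbf j(z))-\varphi(x)-\mathbf 1_{|z|<1}D\varphi(x)\cdot z\big]\,d\mu(z)$$ exists and equals $\mathcal{L}\varphi(x)+Q_{\mathbf j}\varphi(x)$. If $H=H(t,x,p)$ satisfies the assumptions on $H$ (as a function independent of $q$), then there is $T_0\in(0,T]$ such that for every $T'\in(0,T_0]$ the problem $\partial_tu-\mathcal{L}_{\mathbf j}u-H(t,x,Du)=0$, $u(0,\cdot)=u_0$,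 understood as (1) with Hamiltonian $H(t,x,Du)+Q_{\mathbf j}u$, has a mild solution $u$ on $(0,T']$ with $u\in C_b((0,T'];C^1_b(\mathbb{R}^d))$ and $u(t)\in C_b^{\alpha+\beta}(\mathbb{R}^d)$ for all $t\in(0,T']$. -/

import Mathlib

open Set Filter Topology MeasureTheory
open scoped NNReal ENNReal

noncomputable section

/-- `‖f‖_∞ = sup_x |f x|`, as an extended nonnegative number. -/
def supNorm {X F : Type*} [NormedAddCommGroup F] (f : X → F) : ℝ≥0∞ :=
  ⨆ x, ‖f x‖ₑ

/-- `‖f‖_{C_b^n} = ∑_{j ≤ n} ‖D^j f‖_∞`. -/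
def cbNorm {d : ℕ} (n : ℕ) (f : EuclideanSpace ℝ (Fin d) → ℝ) : ℝ≥0∞ :=
  ∑ j ∈ Finset.range (n + 1), supNorm (iteratedFDeriv ℝ j f)

/-- `f ∈ C_b^n(ℝ^d)`. -/
def MemCb {d : ℕ} (n : ℕ) (f : EuclideanSpace ℝ (Fin d) → ℝ) : Prop :=
  ContDiff ℝ n f ∧ cbNorm n f < ⊤

/-- `‖f‖_{C_b^γ}` for real `γ ≥ 0`: with `n = ⌊γ⌋` and `θ = γ - n` it is `‖f‖_{C_b^n}` if `θ = 0`
and `‖f‖_{C_b^n} + [D^n f]_θ` if `θ ∈ (0,1)`. -/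
def holderNorm {d : ℕ} (γ : ℝ) (f : EuclideanSpace ℝ (Fin d) → ℝ) : ℝ≥0∞ :=
  cbNorm ⌊γ⌋₊ f +
    if Int.fract γ = 0 then 0
    else eHolderNorm (Int.fract γ).toNNReal (iteratedFDeriv ℝ ⌊γ⌋₊ f)

/-- `f ∈ C_b^γ(ℝ^d)` for real `γ ≥ 0`. -/
def MemHolderSpace {d : ℕ} (γ : ℝ) (f : EuclideanSpace ℝ (Fin d) → ℝ) : Prop :=
  ContDiff ℝ ⌊γ⌋₊ f ∧ holderNorm γ f < ⊤

/-- `∫ (1 ∧ |z|²) dμ(z) < ∞`. -/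
def IsLevyMeasure {d : ℕ} (μ : Measure (EuclideanSpace ℝ (Fin d))) : Prop :=
  ∫⁻ z, ENNReal.ofReal (min 1 (‖z‖ ^ 2)) ∂μ < ⊤

/-- `φ(w) - φ(x) - 1_{|z|<1} Dφ(x)·z`, where `w` is the point the jump leads to (`w = x + z` for `𝓛`
itself). -/
def compensatedIncrement {d : ℕ} (φ : EuclideanSpace ℝ (Fin d) → ℝ)
    (x w z : EuclideanSpace ℝ (Fin d)) : ℝ :=
  φ w - φ x - (if ‖z‖ < 1 then fderiv ℝ φ x z else 0)

/-- `div (A Dφ)(x)` for a constant matrix `A`. -/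
def divADGrad {d : ℕ} (A : Matrix (Fin d) (Fin d) ℝ) (φ : EuclideanSpace ℝ (Fin d) → ℝ)
    (x : EuclideanSpace ℝ (Fin d)) : ℝ :=
  ∑ i, ∑ k, A i k * iteratedFDeriv ℝ 2 φ x
    ![EuclideanSpace.single i (1 : ℝ), EuclideanSpace.single k (1 : ℝ)]

/-- The Lévy operator `𝓛` with triplet `(A, 0, μ)`. -/
def levyOperator {d : ℕ} (A : Matrix (Fin d) (Fin d) ℝ) (μ : Measure (EuclideanSpace ℝ (Fin d)))
    (φ : EuclideanSpace ℝ (Fin d) → ℝ) (x : EuclideanSpace ℝ (Fin d)) : ℝ :=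
  divADGrad A φ x + ∫ z, compensatedIncrement φ x (x + z) z ∂μ

/-- The symbol `ξ·Aξ + ∫ (1 - e^{iξ·z} + i ξ·z 1_{|z|<1}) dμ(z)`; one has
`𝓛 e^{iξ·x} = - levySymbol ξ e^{iξ·x}`. -/
def levySymbol {d : ℕ} (A : Matrix (Fin d) (Fin d) ℝ) (μ : Measure (EuclideanSpace ℝ (Fin d)))
    (ξ : EuclideanSpace ℝ (Fin d)) : ℂ :=
  ((∑ i, ∑ k, A i k * ξ i * ξ k : ℝ) : ℂ) +
    ∫ z, (1 - Complex.exp (Complex.I * (inner ℝ ξ z : ℝ)) +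
      (if ‖z‖ < 1 then Complex.I * (inner ℝ ξ z : ℝ) else 0)) ∂μ

/-- `g` is a density of the heat kernel of `𝓛` at time `t`, i.e. of the probability measure whose
Fourier transform `ξ ↦ ∫ e^{-iξ·x} g(x) dx` is `e^{-t levySymbol ξ}` (at `ξ = 0` this gives mass one).
This determines `g` almost everywhere. -/
def IsHeatKernelAt {d : ℕ} (A : Matrix (Fin d) (Fin d) ℝ)
    (μ : Measure (EuclideanSpace ℝ (Fin d))) (t : ℝ) (g : EuclideanSpace ℝ (Fin d) → ℝ) : Prop :=
  (∀ x, 0 ≤ g x) ∧ Integrable g ∧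
    ∀ ξ, ∫ x, Complex.exp (-(Complex.I * (inner ℝ ξ x : ℝ))) * (g x : ℂ)
      = Complex.exp (-((t : ℂ) * levySymbol A μ ξ))

/-- Non-degeneracy of order `α` on `(0,T]`: the heat kernel has a density `p_t ∈ C_b^∞` with
`∫ |Dp_t| ≤ c₀ t^{-1/α}`. -/
def HeatKernelCondition {d : ℕ} (A : Matrix (Fin d) (Fin d) ℝ)
    (μ : Measure (EuclideanSpace ℝ (Fin d))) (α c₀ T : ℝ)
    (p : ℝ → EuclideanSpace ℝ (Fin d) → ℝ) : Prop :=
  ∀ t ∈ Ioc 0 T, IsHeatKernelAt A μ t (p t) ∧ (∀ n : ℕ, MemCb n (p t)) ∧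
    ∫⁻ y, ‖fderiv ℝ (p t) y‖ₑ ≤ ENNReal.ofReal (c₀ * t ^ (-(1 / α)))

/-- `P_t φ(x) = ∫ p_t(x-y) φ(y) dy`. -/
def heatSemigroup {d : ℕ} (p : ℝ → EuclideanSpace ℝ (Fin d) → ℝ) (t : ℝ)
    (φ : EuclideanSpace ℝ (Fin d) → ℝ) (x : EuclideanSpace ℝ (Fin d)) : ℝ :=
  ∫ y, p t (x - y) * φ y

/-- The conditions on the Hamiltonian `H(t,x,p,q)`. The `if` only matters for `β = 0`: then
`1 ∧ |x-x'|^β` is read as `0` at `x = x'`, so that `H` is always locally Lipschitz in `(p,q)`. -/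
structure HamiltonianCondition {d : ℕ} (T β : ℝ)
    (H : ℝ → EuclideanSpace ℝ (Fin d) → EuclideanSpace ℝ (Fin d) → ℝ → ℝ) : Prop where
  measurable : ∀ p q, Measurable
    (fun z : Icc (0 : ℝ) T × EuclideanSpace ℝ (Fin d) => H z.1 z.2 p q)
  bounded : ∃ C : ℝ, ∀ t ∈ Icc 0 T, ∀ x, |H t x 0 0| ≤ C
  regular : ∀ R : ℝ, 0 < R → ∃ C : ℝ, ∀ t ∈ Icc 0 T, ∀ x x' p p' : EuclideanSpace ℝ (Fin d),
    ∀ q q' : ℝ, ‖p‖ < R → ‖p'‖ < R → |q| < R → |q'| < R →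
      |H t x' p' q' - H t x p q| ≤
        C * ((if x = x' then 0 else min 1 (‖x - x'‖ ^ β)) + ‖p - p'‖ + |q - q'|)

/-- The conditions on the operator `Q`, which is only used on `C_b^1`. For linear `Q` the bound
`lipschitz` is the same as the bound `sup_bound`. -/
structure LowerOrderBounds {d : ℕ} (β : ℝ) (C : ℝ≥0)
    (Q : (EuclideanSpace ℝ (Fin d) → ℝ) → EuclideanSpace ℝ (Fin d) → ℝ) : Prop where
  measurable : ∀ u, MemCb 1 u → Measurable (Q u)
  sup_bound : ∀ u, MemCb 1 u → supNorm (Q u) ≤ C * cbNorm 1 u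
  lipschitz : ∀ u v, MemCb 1 u → MemCb 1 v → supNorm (Q u - Q v) ≤ C * cbNorm 1 (u - v)
  holder_bound : ∀ σ : ℝ, 0 < σ → σ ≤ β → ∀ u, MemHolderSpace (1 + σ) u →
    eHolderNorm σ.toNNReal (Q u) ≤ C * holderNorm (1 + σ) u

/-- `u ∈ C((0,T]; C_b^1(ℝ^d))`. -/
def IsContinuousInCb1 {d : ℕ} (T : ℝ) (u : ℝ → EuclideanSpace ℝ (Fin d) → ℝ) : Prop :=
  (∀ t ∈ Ioc 0 T, MemCb 1 (u t)) ∧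
    ∀ t ∈ Ioc 0 T, Tendsto (fun s => cbNorm 1 (u s - u t)) (𝓝[Ioc 0 T] t) (𝓝 0)

/-- `u ∈ C_b((0,T]; C_b^1(ℝ^d))`. -/
def IsBoundedContinuousInCb1 {d : ℕ} (T : ℝ) (u : ℝ → EuclideanSpace ℝ (Fin d) → ℝ) : Prop :=
  IsContinuousInCb1 T u ∧ ∃ M : ℝ≥0, ∀ t ∈ Ioc 0 T, cbNorm 1 (u t) ≤ M

/-- `u` is a mild solution on `(0,T]` of `∂_t u - 𝓛 u - H(t,x,Du,Qu) = 0`, `u(0) = u₀`, where `p` is the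
heat kernel of `𝓛`; the integrals in the Duhamel formula are required to exist. -/
def IsMildSolution {d : ℕ} (p : ℝ → EuclideanSpace ℝ (Fin d) → ℝ)
    (H : ℝ → EuclideanSpace ℝ (Fin d) → EuclideanSpace ℝ (Fin d) → ℝ → ℝ)
    (Q : (EuclideanSpace ℝ (Fin d) → ℝ) → EuclideanSpace ℝ (Fin d) → ℝ)
    (u₀ : EuclideanSpace ℝ (Fin d) → ℝ) (T : ℝ)
    (u : ℝ → EuclideanSpace ℝ (Fin d) → ℝ) : Prop :=
  IsContinuousInCb1 T u ∧ ∀ t ∈ Ioc 0 T, ∀ x,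
    (∀ s ∈ Ioo 0 t, Integrable fun y =>
      p (t - s) (x - y) * H s y (gradient (u s) y) (Q (u s) y)) ∧
    IntervalIntegrable (fun s => heatSemigroup p (t - s)
      (fun y => H s y (gradient (u s) y) (Q (u s) y)) x) volume 0 t ∧
    u t x = heatSemigroup p t u₀ x +
      ∫ s in (0 : ℝ)..t, heatSemigroup p (t - s)
        (fun y => H s y (gradient (u s) y) (Q (u s) y)) x

/-- The perturbation `u ↦ ∫ (u(x + j(z)) - u(x + z)) dμ(z)` that turns the jumps `z` of `𝓛` into
`j(z)`. -/
def jumpModulation {d : ℕ} (μ : Measure (EuclideanSpace ℝ (Fin d)))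
    (j : EuclideanSpace ℝ (Fin d) → EuclideanSpace ℝ (Fin d))
    (u : EuclideanSpace ℝ (Fin d) → ℝ) (x : EuclideanSpace ℝ (Fin d)) : ℝ :=
  ∫ z, (u (x + j z) - u (x + z)) ∂μ

/-- The operator with modulated jumps, cut off at `|z| ≥ ε`; the operator itself is the limit as
`ε → 0`. -/
def modulatedLevyOperatorCutoff {d : ℕ} (A : Matrix (Fin d) (Fin d) ℝ)
    (μ : Measure (EuclideanSpace ℝ (Fin d)))
    (j : EuclideanSpace ℝ (Fin d) → EuclideanSpace ℝ (Fin d)) (ε : ℝ)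
    (φ : EuclideanSpace ℝ (Fin d) → ℝ) (x : EuclideanSpace ℝ (Fin d)) : ℝ :=
  divADGrad A φ x + ∫ z in (Metric.ball 0 ε)ᶜ, compensatedIncrement φ x (x + j z) z ∂μ

end

/-! The engine is the bound `∫ |Dp_t| ≤ c t^(-1/α)` with `α > 1`: one derivative on the kernel costs
a singularity that is integrable in time. Hence the Duhamel map sends bounded sources to `C^1_b`,
with a gain `t^(1-1/α)` that makes it a contraction in `C^1_b` on short intervals. The Fourier
description of the kernel is used only to obtain the convolution semigroup (products of
characteristic functions) and weak continuity in time (Lévy's continuity theorem). The result is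
packaged as `HeatFamily` in `HeatKernelCondition.heatFamily`, and afterwards `𝓛` itself plays no
role.

A contraction in `C^1_b` alone gives too little regularity, because `x ↦ H(t,x,Du,Qu)` is Hölder
continuous only if `Du` is. The fixed point is therefore sought among paths whose gradients satisfy
in addition a `θ`-Hölder bound with constant `N t^(-θ/α)`, the rate at which the semigroup
regularizes Lipschitz data. This condition is closed under `C^1_b` convergence and preserved by the
map for short times, so distances need only be measured in `C^1_b` (`HeatFamily.exists_fixed_path`).

For the final regularity, `θ`-Hölder data satisfy `|DP_σ f| ≲ σ^(-(1-θ)/α)`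
(`HeatFamily.norm_fderiv_conv_le_of_holder`), and the semigroup property adds `1/α` to the exponent
for each further derivative (`HeatFamily.conv_higher_bounds`). To estimate an increment of the
highest derivative over a distance `r`, the time integral is cut at `τ = r^α`: below it the triangle
inequality is used, above it one more derivative (`norm_timeIntegral_le_of_min`). This gives Hölder
exponent `α + θ - 1` or `α + θ - 2`; integer values of `α + θ` are where one of the two time
integrals would be logarithmic. The source is Hölder only away from time `0`, so the part of the
integral with source times in `[0,t/2]` is treated with the sup bound, where the kernel is not
singular.

If `β < 1`, one takes `θ = β`. If `β = 1`, the bound for `[Qu]_1` needs `u ∈ C^2_b`, which the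
weighted Hölder bound does not give. One runs the argument with `θ = (3-α)/2 < 1`, for which `2 < α
+ θ < 3`; this yields `C^2_b` bounds, hence a Lipschitz source on `[t/2,t]`, and a second pass with
`θ = 1` concludes (`HeatFamily.memHolderSpace_of_admissible`).

Modulated jumps fit in because `|j(z) - z| ≤ K|z|²` near `0` lets the difference of the two jump
operators be controlled by one derivative of `u` and the integral of `1 ∧ |z|²`
(`lowerOrderBounds_jumpModulation`). -/

/-! ### Convolution with an integrable kernel and its derivatives -/

noncomputable section KernelCalculus

variable {d : ℕ} {F : Type} [NormedAddCommGroup F] [NormedSpace ℝ F]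

local notation:max "𝔼" d:max => EuclideanSpace ℝ (Fin d)

/-- The convolution `∫ k(y) f(x-y) dy` of a scalar kernel with a vector-valued function. -/
def kernelConv (k : 𝔼 d → ℝ) (f : 𝔼 d → F) (x : 𝔼 d) : F := ∫ y, k y • f (x - y)

lemma kernelConv_eq_integral_sub (k : 𝔼 d → ℝ) (f : 𝔼 d → F) (x : 𝔼 d) :
    kernelConv k f x = ∫ y, k (x - y) • f y := by
  rw [kernelConv, ← integral_sub_left_eq_self (fun y => k (x - y) • f y) volume x]
  simp

omit [NormedSpace ℝ F] in
lemma stronglyMeasurable_comp_const_sub {f : 𝔼 d → F} (hf : StronglyMeasurable f) (x : 𝔼 d) :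
    StronglyMeasurable fun y => f (x - y) :=
  hf.comp_measurable (measurable_const.sub measurable_id)

lemma integrable_kernel_smul {k : 𝔼 d → ℝ} (hk : Integrable k) {f : 𝔼 d → F}
    (hf : StronglyMeasurable f) {M : ℝ} (hM : ∀ x, ‖f x‖ ≤ M) (x : 𝔼 d) :
    Integrable fun y => k y • f (x - y) := by
  refine (hk.norm.mul_const M).mono'
    (hk.1.smul (stronglyMeasurable_comp_const_sub hf x).aestronglyMeasurable) ?_
  filter_upwards with y
  rw [norm_smul]
  gcongr
  exact hM _

lemma integrable_kernel_sub_smul {k : 𝔼 d → ℝ} (hk : Integrable k) {f : 𝔼 d → F}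
    (hf : StronglyMeasurable f) {M : ℝ} (hM : ∀ x, ‖f x‖ ≤ M) (x : 𝔼 d) :
    Integrable fun y => k (x - y) • f y := by
  refine ((hk.comp_sub_left x).norm.mul_const M).mono'
    ((hk.comp_sub_left x).1.smul hf.aestronglyMeasurable) ?_
  filter_upwards with y
  rw [norm_smul]
  gcongr
  exact hM _

lemma norm_kernelConv_le {k : 𝔼 d → ℝ} (hk : Integrable k) {f : 𝔼 d → F} {M : ℝ}
    (hM : ∀ x, ‖f x‖ ≤ M) (x : 𝔼 d) : ‖kernelConv k f x‖ ≤ M * ∫ y, |k y| := by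
  refine (norm_integral_le_of_norm_le (hk.norm.const_mul M) ?_).trans_eq ?_
  · filter_upwards with y
    rw [norm_smul, mul_comm]
    gcongr
    exact hM _
  · rw [integral_const_mul]
    rfl

lemma kernelConv_sub {k : 𝔼 d → ℝ} (hk : Integrable k) {f g : 𝔼 d → F}
    (hf : StronglyMeasurable f) (hg : StronglyMeasurable g) {M N : ℝ} (hM : ∀ x, ‖f x‖ ≤ M)
    (hN : ∀ x, ‖g x‖ ≤ N) (x : 𝔼 d) :
    kernelConv k (fun y => f y - g y) x = kernelConv k f x - kernelConv k g x := by
  simp only [kernelConv, smul_sub]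
  exact integral_sub (integrable_kernel_smul hk hf hM x) (integrable_kernel_smul hk hg hN x)

lemma kernelConv_sub_kernel {k l : 𝔼 d → ℝ} (hk : Integrable k) (hl : Integrable l) {f : 𝔼 d → F}
    (hf : StronglyMeasurable f) {M : ℝ} (hM : ∀ x, ‖f x‖ ≤ M) (x : 𝔼 d) :
    kernelConv (fun y => k y - l y) f x = kernelConv k f x - kernelConv l f x := by
  simp only [kernelConv, sub_smul]
  exact integral_sub (integrable_kernel_smul hk hf hM x) (integrable_kernel_smul hl hf hM x)

lemma continuous_kernelConv {k : 𝔼 d → ℝ} (hk : Integrable k) {f : 𝔼 d → F}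
    (hf : Continuous f) {M : ℝ} (hM : ∀ x, ‖f x‖ ≤ M) : Continuous (kernelConv k f) := by
  refine continuous_of_dominated (bound := fun y => ‖k y‖ * M) (fun x => ?_) (fun x => ?_)
    (hk.norm.mul_const M) ?_
  · exact hk.1.smul (hf.comp (by fun_prop : Continuous fun y => x - y)).aestronglyMeasurable
  · filter_upwards with y
    rw [norm_smul]
    gcongr
    exact hM _
  · filter_upwards with y
    fun_prop

/-- The convolution with the gradient of the kernel. -/
def kernelGrad (k : 𝔼 d → ℝ) (f : 𝔼 d → F) (x : 𝔼 d) : 𝔼 d →L[ℝ] F :=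
  ∫ y, (fderiv ℝ k y).smulRight (f (x - y))

lemma continuous_kernelGrad {k : 𝔼 d → ℝ} (hk : Integrable (fderiv ℝ k)) {f : 𝔼 d → F}
    (hf : Continuous f) {M : ℝ} (hM : ∀ x, ‖f x‖ ≤ M) : Continuous (kernelGrad k f) := by
  refine continuous_of_dominated (bound := fun y => ‖fderiv ℝ k y‖ * M) (fun x => ?_)
    (fun x => ?_) (hk.norm.mul_const M) ?_
  · exact (((ContinuousLinearMap.smulRightL ℝ 𝔼 d F).continuous₂).comp_aestronglyMeasurable
      (hk.1.prodMk (hf.comp (by fun_prop : Continuous fun y => x - y)).aestronglyMeasurable) :)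
  · filter_upwards with y
    rw [ContinuousLinearMap.norm_smulRight_apply]
    gcongr
    exact hM _
  · filter_upwards with y
    exact ((ContinuousLinearMap.smulRightL ℝ 𝔼 d F) (fderiv ℝ k y)).continuous.comp
      (hf.comp (by fun_prop))

lemma integrable_kernelGrad {k : 𝔼 d → ℝ} (hk : Integrable (fderiv ℝ k)) {f : 𝔼 d → F}
    (hf : StronglyMeasurable f) {M : ℝ} (hM : ∀ x, ‖f x‖ ≤ M) (x : 𝔼 d) :
    Integrable fun y => (fderiv ℝ k y).smulRight (f (x - y)) := by
  refine (hk.norm.mul_const M).mono' ?_ ?_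
  · exact (((ContinuousLinearMap.smulRightL ℝ 𝔼 d F).continuous₂).comp_aestronglyMeasurable
      (hk.1.prodMk (stronglyMeasurable_comp_const_sub hf x).aestronglyMeasurable) :)
  · filter_upwards with y
    rw [ContinuousLinearMap.norm_smulRight_apply]
    gcongr
    exact hM _

lemma norm_kernelGrad_le {k : 𝔼 d → ℝ} (hk : Integrable (fderiv ℝ k)) {f : 𝔼 d → F} {M : ℝ}
    (hM : ∀ x, ‖f x‖ ≤ M) (x : 𝔼 d) :
    ‖kernelGrad k f x‖ ≤ M * ∫ y, ‖fderiv ℝ k y‖ := by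
  refine (norm_integral_le_of_norm_le (hk.norm.const_mul M) ?_).trans_eq ?_
  · filter_upwards with y
    rw [ContinuousLinearMap.norm_smulRight_apply, mul_comm]
    gcongr
    exact hM _
  · rw [integral_const_mul]

/-- The gradient of the kernel is only integrable, so no common majorant of its translates is at
hand and differentiating under the integral is not available. The fundamental theorem of calculus
along the segment, followed by Fubini, needs only the `L¹` norm of the gradient and works for merely
measurable `f`. -/
lemma kernelConv_add_sub [CompleteSpace F] {k : 𝔼 d → ℝ} (hk1 : ContDiff ℝ 1 k) (hk : Integrable k)
    (hk' : Integrable (fderiv ℝ k)) {f : 𝔼 d → F} (hf : StronglyMeasurable f) {M : ℝ}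
    (hM : ∀ x, ‖f x‖ ≤ M) (x h : 𝔼 d) :
    kernelConv k f (x + h) - kernelConv k f x =
      ∫ θ in (0 : ℝ)..1, kernelGrad k f (x + θ • h) h := by
  have hM0 : 0 ≤ M := (norm_nonneg _).trans (hM 0)
  have hcont : Continuous (fderiv ℝ k) := hk1.continuous_fderiv one_ne_zero
  have key : ∀ y, (k (x + h - y) - k (x - y)) • f y =
      ∫ θ in (0 : ℝ)..1, (fderiv ℝ k (x + θ • h - y) h) • f y := by
    intro y
    rw [intervalIntegral.integral_smul_const]
    congr 1
    have hd : ∀ θ ∈ uIcc (0 : ℝ) 1, HasDerivAt (fun θ : ℝ => k (x + θ • h - y))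
        (fderiv ℝ k (x + θ • h - y) h) θ := by
      intro θ _
      have h1 : HasDerivAt (fun θ : ℝ => x + θ • h - y) h θ := by
        simpa using (((hasDerivAt_id θ).smul_const h).const_add x).sub_const y
      exact ((hk1.differentiable one_ne_zero _).hasFDerivAt).comp_hasDerivAt θ h1
    rw [intervalIntegral.integral_eq_sub_of_hasDerivAt hd]
    · simp
    · apply Continuous.intervalIntegrable
      have : Continuous fun θ : ℝ => x + θ • h - y := by fun_prop
      exact (hcont.comp this).clm_apply continuous_const
  -- By translation invariance the `L¹` majorant in `y` has an integral that does not depend on `θ`.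
  have hint : Integrable (Function.uncurry fun (θ : ℝ) (y : 𝔼 d) =>
      (fderiv ℝ k (x + θ • h - y) h) • f y) ((volume.restrict (Ioc (0 : ℝ) 1)).prod volume) := by
    have hcd : Continuous fun z : ℝ × 𝔼 d => fderiv ℝ k (x + z.1 • h - z.2) h :=
      (hcont.comp (by fun_prop)).clm_apply continuous_const
    have hmeas : AEStronglyMeasurable (Function.uncurry fun (θ : ℝ) (y : 𝔼 d) =>
        (fderiv ℝ k (x + θ • h - y) h) • f y) ((volume.restrict (Ioc (0 : ℝ) 1)).prod volume) :=
      hcd.aestronglyMeasurable.smul (hf.comp_measurable measurable_snd).aestronglyMeasurable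
    have hb : ∀ (θ : ℝ) (y : 𝔼 d), ‖(fderiv ℝ k (x + θ • h - y) h) • f y‖ ≤
        ‖fderiv ℝ k (x + θ • h - y)‖ * (‖h‖ * M) := by
      intro θ y
      rw [norm_smul, ← mul_assoc]
      gcongr
      · exact ContinuousLinearMap.le_opNorm _ _
      · exact hM _
    have hdom : ∀ θ : ℝ, Integrable fun y : 𝔼 d =>
        ‖fderiv ℝ k (x + θ • h - y)‖ * (‖h‖ * M) := fun θ =>
      ((hk'.comp_sub_left (x + θ • h)).norm).mul_const _
    refine (integrable_prod_iff hmeas).2 ⟨?_, ?_⟩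
    · filter_upwards with θ
      refine (hdom θ).mono' ?_ (by filter_upwards with y using hb θ y)
      exact ((hcd.comp (Continuous.prodMk_right θ)).aestronglyMeasurable.smul
        hf.aestronglyMeasurable :)
    · refine Integrable.mono' (g := fun _ => (∫ y, ‖fderiv ℝ k y‖) * (‖h‖ * M))
        (integrable_const _) hmeas.norm.integral_prod_right' ?_
      filter_upwards with θ
      rw [Real.norm_of_nonneg (integral_nonneg fun _ => norm_nonneg _)]
      calc _ ≤ ∫ y, ‖fderiv ℝ k (x + θ • h - y)‖ * (‖h‖ * M) :=
            integral_mono_of_nonneg (by filter_upwards with y using norm_nonneg _) (hdom θ)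
              (by filter_upwards with y using hb θ y)
        _ = _ := by
            rw [integral_mul_const,
              integral_sub_left_eq_self (fun y => ‖fderiv ℝ k y‖) volume (x + θ • h)]
  have hG : ∀ θ : ℝ, kernelGrad k f (x + θ • h) h =
      ∫ y, (fderiv ℝ k (x + θ • h - y) h) • f y := by
    intro θ
    rw [kernelGrad, ContinuousLinearMap.integral_apply (integrable_kernelGrad hk' hf hM _),
      ← integral_sub_left_eq_self (fun y => (fderiv ℝ k (x + θ • h - y) h) • f y) volume
        (x + θ • h)]
    simp
  rw [kernelConv_eq_integral_sub, kernelConv_eq_integral_sub,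
    ← integral_sub (integrable_kernel_sub_smul hk hf hM _) (integrable_kernel_sub_smul hk hf hM _)]
  simp_rw [← sub_smul, key, hG, intervalIntegral.integral_of_le zero_le_one]
  exact (integral_integral_swap hint).symm

lemma norm_kernelConv_sub_le [CompleteSpace F] {k : 𝔼 d → ℝ} (hk1 : ContDiff ℝ 1 k)
    (hk : Integrable k) (hk' : Integrable (fderiv ℝ k)) {f : 𝔼 d → F} (hf : StronglyMeasurable f)
    {M : ℝ} (hM : ∀ x, ‖f x‖ ≤ M) (x x' : 𝔼 d) :
    ‖kernelConv k f x - kernelConv k f x'‖ ≤ M * (∫ y, ‖fderiv ℝ k y‖) * ‖x - x'‖ := by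
  have h := kernelConv_add_sub hk1 hk hk' hf hM x' (x - x')
  rw [add_sub_cancel] at h
  rw [h]
  refine (intervalIntegral.norm_integral_le_of_norm_le_const (C := M * (∫ y, ‖fderiv ℝ k y‖) *
    ‖x - x'‖) fun θ _ => ?_).trans_eq (by simp)
  exact (ContinuousLinearMap.le_opNorm _ _).trans
    (by gcongr; exact norm_kernelGrad_le hk' hM _)

/-- For continuous `f` the candidate derivative is continuous, and the increment is its average over
a short segment. The measurable case is recovered later from the semigroup property. -/
lemma hasFDerivAt_kernelConv [CompleteSpace F] {k : 𝔼 d → ℝ} (hk1 : ContDiff ℝ 1 k)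
    (hk : Integrable k) (hk' : Integrable (fderiv ℝ k)) {f : 𝔼 d → F} (hf : Continuous f)
    {M : ℝ} (hM : ∀ x, ‖f x‖ ≤ M) (x : 𝔼 d) :
    HasFDerivAt (kernelConv k f) (kernelGrad k f x) x := by
  have hG := continuous_kernelGrad hk' hf hM
  rw [hasFDerivAt_iff_isLittleO_nhds_zero, Asymptotics.isLittleO_iff]
  intro ε hε
  obtain ⟨δ, hδ, hδ'⟩ := Metric.continuousAt_iff.1 (hG.continuousAt (x := x)) ε hε
  filter_upwards [Metric.ball_mem_nhds (0 : 𝔼 d) hδ] with h hh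
  have hi : ∀ g : ℝ → 𝔼 d →L[ℝ] F, Continuous g →
      IntervalIntegrable (fun θ => g θ h) volume 0 1 := fun g hg =>
    (hg.clm_apply continuous_const).intervalIntegrable _ _
  have e : kernelConv k f (x + h) - kernelConv k f x - kernelGrad k f x h =
      ∫ θ in (0 : ℝ)..1, (kernelGrad k f (x + θ • h) h - kernelGrad k f x h) := by
    rw [intervalIntegral.integral_sub (hi (fun θ => kernelGrad k f (x + θ • h))
      (hG.comp (by fun_prop))) (hi (fun _ => kernelGrad k f x) continuous_const),
      kernelConv_add_sub hk1 hk hk' hf.stronglyMeasurable hM]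
    simp
  rw [e]
  refine (intervalIntegral.norm_integral_le_of_norm_le_const (C := ε * ‖h‖)
    fun θ hθ => ?_).trans_eq (by simp)
  rw [← sub_apply]
  refine (ContinuousLinearMap.le_opNorm _ _).trans ?_
  gcongr
  rw [← dist_eq_norm]
  refine (hδ' ?_).le
  rw [uIoc_of_le zero_le_one] at hθ
  rw [mem_ball_zero_iff] at hh
  rw [dist_eq_norm, add_sub_cancel_left, norm_smul, Real.norm_of_nonneg hθ.1.le]
  nlinarith [norm_nonneg h, hθ.2]

/-- Derivatives fall on the function if it is `C^1`. -/
lemma hasFDerivAt_kernelConv_of_contDiff {k : 𝔼 d → ℝ} (hk : Integrable k)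
    {f : 𝔼 d → F} (hf : ContDiff ℝ 1 f) {M N : ℝ} (hM : ∀ x, ‖f x‖ ≤ M)
    (hN : ∀ x, ‖fderiv ℝ f x‖ ≤ N) (x : 𝔼 d) :
    HasFDerivAt (kernelConv k f) (kernelConv k (fderiv ℝ f) x) x := by
  have hc : Continuous (fderiv ℝ f) := hf.continuous_fderiv one_ne_zero
  refine hasFDerivAt_integral_of_dominated_of_fderiv_le (bound := fun y => ‖k y‖ * N)
    (F' := fun x y => k y • fderiv ℝ f (x - y)) (s := univ) univ_mem ?_ ?_ ?_ ?_
    (hk.norm.mul_const N) ?_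
  · filter_upwards with x
    exact (integrable_kernel_smul hk hf.continuous.stronglyMeasurable hM x).1
  · exact integrable_kernel_smul hk hf.continuous.stronglyMeasurable hM x
  · exact (integrable_kernel_smul hk hc.stronglyMeasurable hN x).1
  · filter_upwards with y x _
    rw [norm_smul]
    gcongr
    exact hN _
  · filter_upwards with y x _
    have h1 : HasFDerivAt (fun x => f (x - y)) (fderiv ℝ f (x - y)) x := by
      have := (hf.differentiable one_ne_zero (x - y)).hasFDerivAt.comp x
        ((hasFDerivAt_id x).sub_const y)
      rw [ContinuousLinearMap.comp_id] at this
      exact this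
    exact h1.const_smul (k y)

end KernelCalculus

/-! ### From the Fourier description to a convolution semigroup of densities -/

noncomputable section HeatFamily

variable {d : ℕ} {F : Type} [NormedAddCommGroup F] [NormedSpace ℝ F]

local notation:max "𝔼" d:max => EuclideanSpace ℝ (Fin d)

/-- A family of smooth probability densities forming a convolution semigroup on `(0,T]` that is
pointwise continuous in time and satisfies the gradient bound of order `α`. -/
structure HeatFamily (α c T : ℝ) (p : ℝ → 𝔼 d → ℝ) : Prop where
  nonneg : ∀ t ∈ Ioc 0 T, ∀ x, 0 ≤ p t x
  contDiff : ∀ t ∈ Ioc 0 T, ContDiff ℝ 1 (p t)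
  bounded : ∀ t ∈ Ioc 0 T, ∃ L : ℝ, ∀ x, ‖p t x‖ ≤ L
  integrable : ∀ t ∈ Ioc 0 T, Integrable (p t)
  integral_eq_one : ∀ t ∈ Ioc 0 T, ∫ x, p t x = 1
  integrable_fderiv : ∀ t ∈ Ioc 0 T, Integrable (fderiv ℝ (p t))
  integral_norm_fderiv_le : ∀ t ∈ Ioc 0 T, ∫ x, ‖fderiv ℝ (p t) x‖ ≤ c * t ^ (-(1 / α))
  semigroup : ∀ s t, 0 < s → 0 < t → s + t ≤ T → p (s + t) = kernelConv (p s) (p t)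
  continuousOn : ∀ x, ContinuousOn (fun t => p t x) (Ioc 0 T)

/-- The measure with density `k`. -/
def kernelMeasure (k : 𝔼 d → ℝ) : Measure 𝔼 d := volume.withDensity fun x => ENNReal.ofReal (k x)

lemma integral_kernelMeasure {k : 𝔼 d → ℝ} (hk : Measurable k) (hk0 : ∀ x, 0 ≤ k x) (f : 𝔼 d → F) :
    ∫ y, f y ∂(kernelMeasure k) = ∫ y, k y • f y := by
  rw [kernelMeasure, integral_withDensity_eq_integral_toReal_smul
    hk.ennreal_ofReal (by simp)]
  simp_rw [ENNReal.toReal_ofReal (hk0 _)]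

lemma isProbabilityMeasure_kernelMeasure {k : 𝔼 d → ℝ} (hk : Integrable k) (hk0 : ∀ x, 0 ≤ k x)
    (h1 : ∫ x, k x = 1) : IsProbabilityMeasure (kernelMeasure k) := by
  refine ⟨?_⟩
  rw [kernelMeasure, withDensity_apply _ MeasurableSet.univ, Measure.restrict_univ,
    ← ofReal_integral_eq_lintegral_ofReal hk (by filter_upwards with x using hk0 x), h1,
    ENNReal.ofReal_one]

lemma kernelMeasure_conv {k l : 𝔼 d → ℝ} (hk : Continuous k) (hki : Integrable k)
    (hk0 : ∀ x, 0 ≤ k x) (hl : Continuous l) (hl0 : ∀ x, 0 ≤ l x) {M : ℝ}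
    (hM : ∀ x, ‖l x‖ ≤ M) :
    kernelMeasure k ∗ kernelMeasure l = kernelMeasure (kernelConv k l) := by
  rw [kernelMeasure, kernelMeasure, conv_withDensity_eq_lconvolution
    hk.measurable.ennreal_ofReal hl.measurable.ennreal_ofReal, kernelMeasure]
  congr 1
  ext x
  rw [lconvolution_def, kernelConv, ofReal_integral_eq_lintegral_ofReal
    (integrable_kernel_smul hki hl.stronglyMeasurable hM x)
    (by filter_upwards with y using mul_nonneg (hk0 _) (hl0 _))]
  refine lintegral_congr fun y => ?_
  rw [smul_eq_mul, ENNReal.ofReal_mul (hk0 _), neg_add_eq_sub]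

/-- Equal measures determine densities almost everywhere; continuity removes the exceptional set. -/
lemma eq_of_kernelMeasure_eq {k l : 𝔼 d → ℝ} (hk : Continuous k) (hki : Integrable k)
    (hk0 : ∀ x, 0 ≤ k x) (hl : Continuous l) (hl0 : ∀ x, 0 ≤ l x)
    (h : kernelMeasure k = kernelMeasure l) : k = l := by
  have hfin : ∫⁻ x, ENNReal.ofReal (k x) ≠ ⊤ := hki.lintegral_lt_top.ne
  have h2 := (withDensity_eq_iff hk.measurable.ennreal_ofReal.aemeasurable
    hl.measurable.ennreal_ofReal.aemeasurable hfin).1 h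
  refine (Continuous.ae_eq_iff_eq volume hk hl).1 ?_
  filter_upwards [h2] with x hx
  exact (ENNReal.ofReal_eq_ofReal_iff (hk0 x) (hl0 x)).1 hx

/-- Associativity is read off from integration against a convolution of two probability measures;
boundedness of `f` gives the integrability required. -/
lemma kernelConv_kernelConv {k l : 𝔼 d → ℝ} (hk : Continuous k) (hki : Integrable k)
    (hk0 : ∀ x, 0 ≤ k x) (hl : Continuous l) (hli : Integrable l) (hl0 : ∀ x, 0 ≤ l x) {L : ℝ}
    (hL : ∀ x, ‖l x‖ ≤ L) (hk1 : ∫ x, k x = 1) (hl1 : ∫ x, l x = 1) {f : 𝔼 d → F}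
    (hf : StronglyMeasurable f) {M : ℝ} (hM : ∀ x, ‖f x‖ ≤ M) (x : 𝔼 d) :
    kernelConv k (kernelConv l f) x = kernelConv (kernelConv k l) f x := by
  have := isProbabilityMeasure_kernelMeasure hki hk0 hk1
  have := isProbabilityMeasure_kernelMeasure hli hl0 hl1
  have hc := continuous_kernelConv hki hl hL
  have hc0 : ∀ x, 0 ≤ kernelConv k l x := fun x =>
    integral_nonneg fun y => mul_nonneg (hk0 _) (hl0 _)
  have hm : StronglyMeasurable fun w => f (x - w) := stronglyMeasurable_comp_const_sub hf x
  conv_rhs => rw [kernelConv, ← integral_kernelMeasure hc.measurable hc0 fun w => f (x - w),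
    ← kernelMeasure_conv hk hki hk0 hl hl0 hL]
  rw [integral_conv, kernelConv, ← integral_kernelMeasure hk.measurable hk0]
  · refine integral_congr_ae ?_
    filter_upwards with y
    rw [kernelConv, ← integral_kernelMeasure hl.measurable hl0]
    simp_rw [sub_sub]
  · exact (integrable_const M).mono' hm.aestronglyMeasurable (by filter_upwards with w using hM _)

lemma levySymbol_zero (A : Matrix (Fin d) (Fin d) ℝ) (μ : Measure 𝔼 d) : levySymbol A μ 0 = 0 := by
  simp [levySymbol]

lemma IsHeatKernelAt.integral_eq_one {A : Matrix (Fin d) (Fin d) ℝ} {μ : Measure 𝔼 d} {t : ℝ}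
    {g : 𝔼 d → ℝ} (h : IsHeatKernelAt A μ t g) : ∫ x, g x = 1 := by
  have h0 := h.2.2 0
  simp only [inner_zero_left, Complex.ofReal_zero, mul_zero, neg_zero, Complex.exp_zero, one_mul,
    levySymbol_zero, integral_complex_ofReal] at h0
  exact_mod_cast h0

/-- `charFun` integrates `e^{i⟨x,ξ⟩}`, the opposite sign to the convention in `IsHeatKernelAt`,
whence the symbol at `-ξ`. -/
lemma IsHeatKernelAt.charFun_eq {A : Matrix (Fin d) (Fin d) ℝ} {μ : Measure 𝔼 d} {t : ℝ}
    {g : 𝔼 d → ℝ} (h : IsHeatKernelAt A μ t g) (hg : Measurable g) (ξ : 𝔼 d) :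
    charFun (kernelMeasure g) ξ = Complex.exp (-((t : ℂ) * levySymbol A μ (-ξ))) := by
  rw [charFun_apply, integral_kernelMeasure hg h.1, ← h.2.2]
  refine integral_congr_ae ?_
  filter_upwards with x
  rw [inner_neg_left, real_inner_comm, Complex.real_smul, mul_comm]
  congr 2
  push_cast
  ring

lemma exists_bound_of_memCb {n : ℕ} {f : 𝔼 d → ℝ} (hf : MemCb n f) {j : ℕ} (hj : j ≤ n) :
    ∃ M : ℝ, ∀ x, ‖iteratedFDeriv ℝ j f x‖ ≤ M := by
  have h1 : supNorm (iteratedFDeriv ℝ j f) < ⊤ := lt_of_le_of_lt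
    (Finset.single_le_sum (f := fun j => supNorm (iteratedFDeriv ℝ j f)) (fun _ _ => zero_le)
      (Finset.mem_range.2 (Nat.lt_succ_of_le hj))) hf.2
  refine ⟨(supNorm (iteratedFDeriv ℝ j f)).toReal, fun x => ?_⟩
  rw [← ENNReal.ofReal_le_iff_le_toReal h1.ne, ofReal_norm]
  exact le_iSup (fun x => ‖iteratedFDeriv ℝ j f x‖ₑ) x

/-- Characteristic functions of convolutions multiply, and `e^{-sψ} e^{-tψ} = e^{-(s+t)ψ}`.
Injectivity of the characteristic function and continuity of the densities give equality at every
point. -/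
lemma HeatKernelCondition.semigroup {A : Matrix (Fin d) (Fin d) ℝ} {μ : Measure 𝔼 d}
    {α c T : ℝ} {p : ℝ → 𝔼 d → ℝ} (h : HeatKernelCondition A μ α c T p) {s t : ℝ} (hs : 0 < s)
    (ht : 0 < t) (hst : s + t ≤ T) : p (s + t) = kernelConv (p s) (p t) := by
  obtain ⟨hs1, hs2, -⟩ := h s ⟨hs, by linarith⟩
  obtain ⟨ht1, ht2, -⟩ := h t ⟨ht, by linarith⟩
  obtain ⟨hst1, hst2, -⟩ := h (s + t) ⟨by linarith, hst⟩
  have cs : Continuous (p s) := (hs2 0).1.continuous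
  have ct : Continuous (p t) := (ht2 0).1.continuous
  have cst : Continuous (p (s + t)) := (hst2 0).1.continuous
  obtain ⟨M, hM⟩ := exists_bound_of_memCb (ht2 0) le_rfl
  simp only [norm_iteratedFDeriv_zero] at hM
  have := isProbabilityMeasure_kernelMeasure hs1.2.1 hs1.1 hs1.integral_eq_one
  have := isProbabilityMeasure_kernelMeasure ht1.2.1 ht1.1 ht1.integral_eq_one
  have := isProbabilityMeasure_kernelMeasure hst1.2.1 hst1.1 hst1.integral_eq_one
  refine eq_of_kernelMeasure_eq cst hst1.2.1 hst1.1 (continuous_kernelConv hs1.2.1 ct hM)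
    (fun x => integral_nonneg fun y => mul_nonneg (hs1.1 _) (ht1.1 _)) ?_
  rw [← kernelMeasure_conv cs hs1.2.1 hs1.1 ct ht1.1 hM]
  refine Measure.ext_of_charFun (funext fun ξ => ?_)
  rw [charFun_conv, hs1.charFun_eq cs.measurable, ht1.charFun_eq ct.measurable,
    hst1.charFun_eq cst.measurable, ← Complex.exp_add]
  congr 1
  push_cast
  ring

/-- Lévy's continuity theorem: `e^{-tψ(-ξ)}` is continuous in `t` for each `ξ`, so the kernels
converge weakly. -/
lemma HeatKernelCondition.tendsto_integral {A : Matrix (Fin d) (Fin d) ℝ} {μ : Measure 𝔼 d}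
    {α c T : ℝ} {p : ℝ → 𝔼 d → ℝ} (h : HeatKernelCondition A μ α c T p) {t : ℝ}
    (ht : t ∈ Ioc 0 T) {s : ℕ → ℝ} (hs : ∀ n, s n ∈ Ioc 0 T) (hst : Tendsto s atTop (𝓝 t))
    {f : 𝔼 d → ℝ} (hf : Continuous f) {M : ℝ} (hM : ∀ x, ‖f x‖ ≤ M) :
    Tendsto (fun n => ∫ y, p (s n) y * f y) atTop (𝓝 (∫ y, p t y * f y)) := by
  have hprob : ∀ r ∈ Ioc 0 T, IsProbabilityMeasure (kernelMeasure (p r)) := fun r hr =>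
    isProbabilityMeasure_kernelMeasure (h r hr).1.2.1 (h r hr).1.1 (h r hr).1.integral_eq_one
  have hmeas : ∀ r ∈ Ioc 0 T, Measurable (p r) := fun r hr =>
    ((h r hr).2.1 0).1.continuous.measurable
  have hw : Tendsto (β := ProbabilityMeasure 𝔼 d)
      (fun n => ⟨kernelMeasure (p (s n)), hprob _ (hs n)⟩)
      atTop (𝓝 ⟨kernelMeasure (p t), hprob _ ht⟩) := by
    refine ProbabilityMeasure.tendsto_iff_tendsto_charFun.2 fun ξ => ?_
    change Tendsto (fun n => charFun (kernelMeasure (p (s n))) ξ) atTop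
      (𝓝 (charFun (kernelMeasure (p t)) ξ))
    simp only [(h _ (hs _)).1.charFun_eq (hmeas _ (hs _)),
      (h _ ht).1.charFun_eq (hmeas _ ht)]
    have : Continuous fun r : ℝ => Complex.exp (-((r : ℂ) * levySymbol A μ (-ξ))) := by fun_prop
    exact (this.tendsto t).comp hst
  have := (ProbabilityMeasure.tendsto_iff_forall_integral_tendsto.1 hw)
    (BoundedContinuousFunction.ofNormedAddCommGroup f hf M hM)
  simpa only [BoundedContinuousFunction.coe_ofNormedAddCommGroup, ProbabilityMeasure.coe_mk,
    integral_kernelMeasure (hmeas _ (hs _)) (h _ (hs _)).1.1,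
    integral_kernelMeasure (hmeas _ ht) (h _ ht).1.1, smul_eq_mul] using this

/-- Weak continuity becomes pointwise continuity by splitting off a fixed time `t/2`: the value
`p_r(x)` is the integral of the fixed bounded continuous function `p_{t/2}(x - ·)` against
`p_{r-t/2}`. -/
lemma HeatKernelCondition.continuousOn {A : Matrix (Fin d) (Fin d) ℝ} {μ : Measure 𝔼 d}
    {α c T : ℝ} {p : ℝ → 𝔼 d → ℝ} (h : HeatKernelCondition A μ α c T p) (x : 𝔼 d) :
    ContinuousOn (fun t => p t x) (Ioc 0 T) := by
  intro t ht
  refine tendsto_of_seq_tendsto fun s hs => ?_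
  have ht2 : t / 2 ∈ Ioc 0 T := ⟨by linarith [ht.1], by linarith [ht.1, ht.2]⟩
  have hs1 := tendsto_nhdsWithin_iff.1 hs
  obtain ⟨M, hM⟩ := exists_bound_of_memCb ((h _ ht2).2.1 0) le_rfl
  simp only [norm_iteratedFDeriv_zero] at hM
  have hc : Continuous (p (t / 2)) := ((h _ ht2).2.1 0).1.continuous
  have hev : ∀ᶠ n in atTop, s n ∈ Ioc (t / 2) T := by
    filter_upwards [hs1.2, hs1.1.eventually (lt_mem_nhds (half_lt_self ht.1))] with n h1 h2
    exact ⟨h2, h1.2⟩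
  obtain ⟨N, hN⟩ := eventually_atTop.1 hev
  have hrep : ∀ r ∈ Ioc (t / 2) T, p r x = ∫ y, p (r - t / 2) y * p (t / 2) (x - y) := by
    intro r hr
    conv_lhs => rw [show r = (r - t / 2) + t / 2 by ring]
    rw [h.semigroup (by linarith [hr.1]) ht2.1 (by linarith [hr.2])]
    rfl
  rw [← tendsto_add_atTop_iff_nat N]
  have hlim : Tendsto (fun n => s (n + N) - t / 2) atTop (𝓝 (t - t / 2)) :=
    ((tendsto_add_atTop_iff_nat N).2 hs1.1).sub_const _
  have := h.tendsto_integral (t := t - t / 2) ⟨by linarith [ht.1], by linarith [ht.1, ht.2]⟩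
    (s := fun n => s (n + N) - t / 2)
    (fun n => ⟨by linarith [(hN (n + N) (by omega)).1],
      by linarith [(hN (n + N) (by omega)).2, ht.1]⟩) hlim
    (f := fun y => p (t / 2) (x - y)) (by fun_prop) (fun y => hM _)
  rw [← hrep t ⟨half_lt_self ht.1, ht.2⟩] at this
  refine this.congr fun n => ?_
  simp only [Function.comp]
  rw [hrep _ (hN (n + N) (by omega))]

lemma HeatKernelCondition.heatFamily {A : Matrix (Fin d) (Fin d) ℝ} {μ : Measure 𝔼 d}
    {α c T : ℝ} (hc : 0 ≤ c) {p : ℝ → 𝔼 d → ℝ} (h : HeatKernelCondition A μ α c T p) :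
    HeatFamily α c T p where
  nonneg t ht := (h t ht).1.1
  contDiff t ht := ((h t ht).2.1 1).1
  bounded t ht := by
    simpa only [norm_iteratedFDeriv_zero] using exists_bound_of_memCb ((h t ht).2.1 0) le_rfl
  integrable t ht := (h t ht).1.2.1
  integral_eq_one t ht := (h t ht).1.integral_eq_one
  integrable_fderiv t ht := by
    refine ⟨(((h t ht).2.1 1).1.continuous_fderiv one_ne_zero).aestronglyMeasurable, ?_⟩
    exact lt_of_le_of_lt (h t ht).2.2 ENNReal.ofReal_lt_top
  integral_norm_fderiv_le t ht := by
    rw [integral_norm_eq_lintegral_enorm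
      (((h t ht).2.1 1).1.continuous_fderiv one_ne_zero).aestronglyMeasurable]
    exact ENNReal.toReal_le_of_le_ofReal (mul_nonneg hc (Real.rpow_nonneg ht.1.le _)) (h t ht).2.2
  semigroup s t hs ht hst := h.semigroup hs ht hst
  continuousOn := h.continuousOn

end HeatFamily

/-! ### Smoothing estimates and time continuity for the semigroup -/

noncomputable section HeatFamilyEstimates

variable {d : ℕ} {F : Type} [NormedAddCommGroup F] [NormedSpace ℝ F]

local notation:max "𝔼" d:max => EuclideanSpace ℝ (Fin d)

lemma kernelConv_comp_add_right (k : 𝔼 d → ℝ) (f : 𝔼 d → F) (h x : 𝔼 d) :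
    kernelConv k (fun y => f (y + h)) x = kernelConv k f (x + h) := by
  simp only [kernelConv, sub_add_eq_add_sub]

namespace HeatFamily

variable {α c T : ℝ} {p : ℝ → 𝔼 d → ℝ}

lemma const_nonneg (hp : HeatFamily α c T p) {t : ℝ} (ht : t ∈ Ioc 0 T) : 0 ≤ c :=
  nonneg_of_mul_nonneg_left ((integral_nonneg fun _ => norm_nonneg _).trans
    (hp.integral_norm_fderiv_le t ht)) (Real.rpow_pos_of_pos ht.1 _)

lemma norm_conv_le (hp : HeatFamily α c T p) {t : ℝ} (ht : t ∈ Ioc 0 T) {f : 𝔼 d → F} {M : ℝ}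
    (hM : ∀ x, ‖f x‖ ≤ M) (x : 𝔼 d) : ‖kernelConv (p t) f x‖ ≤ M := by
  have h := norm_kernelConv_le (hp.integrable t ht) hM x
  simp_rw [abs_of_nonneg (hp.nonneg t ht _)] at h
  rwa [hp.integral_eq_one t ht, mul_one] at h

lemma conv_conv (hp : HeatFamily α c T p) {s t : ℝ} (hs : 0 < s) (ht : 0 < t) (hst : s + t ≤ T)
    {f : 𝔼 d → F} (hf : StronglyMeasurable f) {M : ℝ} (hM : ∀ x, ‖f x‖ ≤ M) :
    kernelConv (p s) (kernelConv (p t) f) = kernelConv (p (s + t)) f := by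
  have hs' : s ∈ Ioc 0 T := ⟨hs, by linarith⟩
  have ht' : t ∈ Ioc 0 T := ⟨ht, by linarith⟩
  obtain ⟨L, hL⟩ := hp.bounded t ht'
  ext x
  rw [hp.semigroup s t hs ht hst]
  exact kernelConv_kernelConv (hp.contDiff s hs').continuous (hp.integrable s hs')
    (hp.nonneg s hs') (hp.contDiff t ht').continuous (hp.integrable t ht') (hp.nonneg t ht') hL
    (hp.integral_eq_one s hs') (hp.integral_eq_one t ht') hf hM x

/-- Convolution commutes with translations and a probability density does not increase sup norms, so
every modulus of continuity is preserved. -/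
lemma norm_conv_sub_translate_le (hp : HeatFamily α c T p) {t : ℝ} (ht : t ∈ Ioc 0 T)
    {f : 𝔼 d → F} (hf : StronglyMeasurable f) {M : ℝ} (hM : ∀ x, ‖f x‖ ≤ M) {m : ℝ} {h : 𝔼 d}
    (hm : ∀ x, ‖f x - f (x + h)‖ ≤ m) (x : 𝔼 d) :
    ‖kernelConv (p t) f x - kernelConv (p t) f (x + h)‖ ≤ m := by
  rw [← kernelConv_comp_add_right, ← kernelConv_sub (hp.integrable t ht) hf
    (show StronglyMeasurable fun y => f (y + h) from
      hf.comp_measurable (measurable_add_const h)) hM (fun _ => hM _)]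
  exact hp.norm_conv_le ht hm x

lemma conv_holder (hp : HeatFamily α c T p) {t : ℝ} (ht : t ∈ Ioc 0 T)
    {f : 𝔼 d → F} (hf : StronglyMeasurable f) {M : ℝ} (hM : ∀ x, ‖f x‖ ≤ M) {N θ : ℝ}
    (hN : ∀ x x', ‖f x - f x'‖ ≤ N * ‖x - x'‖ ^ θ) (x x' : 𝔼 d) :
    ‖kernelConv (p t) f x - kernelConv (p t) f x'‖ ≤ N * ‖x - x'‖ ^ θ := by
  have := hp.norm_conv_sub_translate_le ht hf hM (m := N * ‖x - x'‖ ^ θ) (h := x' - x)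
    (fun y => by simpa [norm_sub_rev] using hN y (y + (x' - x))) x
  simpa using this

lemma norm_conv_sub_le [CompleteSpace F] (hp : HeatFamily α c T p) {t : ℝ} (ht : t ∈ Ioc 0 T)
    {f : 𝔼 d → F} (hf : StronglyMeasurable f) {M : ℝ} (hM : ∀ x, ‖f x‖ ≤ M) (x x' : 𝔼 d) :
    ‖kernelConv (p t) f x - kernelConv (p t) f x'‖ ≤ c * t ^ (-(1 / α)) * M * ‖x - x'‖ := by
  have hM0 : 0 ≤ M := (norm_nonneg _).trans (hM 0)
  refine (norm_kernelConv_sub_le (hp.contDiff t ht) (hp.integrable t ht)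
    (hp.integrable_fderiv t ht) hf hM x x').trans ?_
  rw [mul_comm M]
  gcongr
  exact hp.integral_norm_fderiv_le t ht

lemma continuous_conv [CompleteSpace F] (hp : HeatFamily α c T p) {t : ℝ} (ht : t ∈ Ioc 0 T)
    {f : 𝔼 d → F} (hf : StronglyMeasurable f) {M : ℝ} (hM : ∀ x, ‖f x‖ ≤ M) :
    Continuous (kernelConv (p t) f) := by
  refine (LipschitzWith.of_dist_le' (K := c * t ^ (-(1 / α)) * M) fun x x' => ?_).continuous
  rw [dist_eq_norm, dist_eq_norm]
  exact hp.norm_conv_sub_le ht hf hM x x'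

/-- Half of the time turns measurable data into Lipschitz, hence continuous, data; the other half
differentiates them. -/
lemma contDiff_one_conv [CompleteSpace F] (hp : HeatFamily α c T p) {t : ℝ} (ht : t ∈ Ioc 0 T)
    {f : 𝔼 d → F} (hf : StronglyMeasurable f) {M : ℝ} (hM : ∀ x, ‖f x‖ ≤ M) :
    ContDiff ℝ 1 (kernelConv (p t) f) := by
  have ht2 : t / 2 ∈ Ioc 0 T := ⟨by linarith [ht.1], by linarith [ht.1, ht.2]⟩
  have hc := hp.continuous_conv ht2 hf hM
  have hd := hasFDerivAt_kernelConv (hp.contDiff _ ht2) (hp.integrable _ ht2)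
    (hp.integrable_fderiv _ ht2) hc (hp.norm_conv_le ht2 hM)
  rw [hp.conv_conv ht2.1 ht2.1 (by linarith [ht.2]) hf hM, add_halves] at hd
  rw [contDiff_one_iff_fderiv]
  refine ⟨fun x => (hd x).differentiableAt, ?_⟩
  rw [funext fun x => (hd x).fderiv]
  exact continuous_kernelGrad (hp.integrable_fderiv _ ht2) hc (hp.norm_conv_le ht2 hM)

lemma norm_fderiv_conv_le [CompleteSpace F] (hp : HeatFamily α c T p) {t : ℝ} (ht : t ∈ Ioc 0 T)
    {f : 𝔼 d → F} (hf : StronglyMeasurable f) {M : ℝ} (hM : ∀ x, ‖f x‖ ≤ M) (x : 𝔼 d) :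
    ‖fderiv ℝ (kernelConv (p t) f) x‖ ≤ c * t ^ (-(1 / α)) * M := by
  have hM0 : 0 ≤ M := (norm_nonneg _).trans (hM 0)
  have hc := hp.const_nonneg ht
  have := Real.rpow_nonneg ht.1.le (-(1 / α))
  exact norm_fderiv_le_of_lip' ℝ (by positivity)
    (Eventually.of_forall fun y => hp.norm_conv_sub_le ht hf hM y x)

/-- This is the gradient bound applied to the difference of `f` and its translate, whose sup norm is
at most `m`. -/
lemma norm_fderiv_conv_sub_translate_le [CompleteSpace F] (hp : HeatFamily α c T p) {t : ℝ}
    (ht : t ∈ Ioc 0 T) {f : 𝔼 d → F} (hf : StronglyMeasurable f) {M : ℝ} (hM : ∀ x, ‖f x‖ ≤ M)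
    {m : ℝ} {h : 𝔼 d} (hm : ∀ x, ‖f x - f (x + h)‖ ≤ m) (x : 𝔼 d) :
    ‖fderiv ℝ (kernelConv (p t) f) x - fderiv ℝ (kernelConv (p t) f) (x + h)‖ ≤
      c * t ^ (-(1 / α)) * m := by
  have hf' : StronglyMeasurable fun y => f (y + h) := hf.comp_measurable (measurable_add_const h)
  have hd := (hp.contDiff_one_conv ht hf hM).differentiable one_ne_zero
  have hd' : DifferentiableAt ℝ (fun x => kernelConv (p t) f (x + h)) x :=
    (differentiableAt_comp_add_right h).2 (hd (x + h))
  have e : kernelConv (p t) (fun y => f y - f (y + h)) =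
      fun x => kernelConv (p t) f x - kernelConv (p t) f (x + h) := by
    ext x
    rw [kernelConv_sub (hp.integrable t ht) hf hf' hM (fun _ => hM _), kernelConv_comp_add_right]
  have := hp.norm_fderiv_conv_le ht (hf.sub hf') hm x
  rw [show (f - fun y => f (y + h)) = fun y => f y - f (y + h) from rfl, e,
    fderiv_fun_sub (hd x) hd', fderiv_comp_add_right] at this
  exact this

lemma fderiv_conv_holder [CompleteSpace F] (hp : HeatFamily α c T p) {t : ℝ}
    (ht : t ∈ Ioc 0 T) {f : 𝔼 d → F} (hf : StronglyMeasurable f) {M : ℝ} (hM : ∀ x, ‖f x‖ ≤ M)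
    {N θ : ℝ} (hN : ∀ x x', ‖f x - f x'‖ ≤ N * ‖x - x'‖ ^ θ) (x x' : 𝔼 d) :
    ‖fderiv ℝ (kernelConv (p t) f) x - fderiv ℝ (kernelConv (p t) f) x'‖ ≤
      c * t ^ (-(1 / α)) * N * ‖x - x'‖ ^ θ := by
  have := hp.norm_fderiv_conv_sub_translate_le ht hf hM (m := N * ‖x - x'‖ ^ θ) (h := x' - x)
    (fun y => by simpa [norm_sub_rev] using hN y (y + (x' - x))) x
  simpa [mul_assoc] using this

lemma fderiv_conv_of_contDiff (hp : HeatFamily α c T p) {t : ℝ} (ht : t ∈ Ioc 0 T)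
    {f : 𝔼 d → F} (hf : ContDiff ℝ 1 f) {M N : ℝ} (hM : ∀ x, ‖f x‖ ≤ M)
    (hN : ∀ x, ‖fderiv ℝ f x‖ ≤ N) :
    fderiv ℝ (kernelConv (p t) f) = kernelConv (p t) (fderiv ℝ f) :=
  funext fun x => (hasFDerivAt_kernelConv_of_contDiff (hp.integrable t ht) hf hM hN x).fderiv

lemma fderiv_conv_add [CompleteSpace F] (hp : HeatFamily α c T p) {s t : ℝ} (hs : 0 < s)
    (ht : 0 < t) (hst : s + t ≤ T) {f : 𝔼 d → F} (hf : StronglyMeasurable f) {M : ℝ}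
    (hM : ∀ x, ‖f x‖ ≤ M) :
    fderiv ℝ (kernelConv (p (s + t)) f) = kernelConv (p s) (fderiv ℝ (kernelConv (p t) f)) := by
  have ht' : t ∈ Ioc 0 T := ⟨ht, by linarith⟩
  rw [← hp.conv_conv hs ht hst hf hM]
  exact hp.fderiv_conv_of_contDiff ⟨hs, by linarith⟩ (hp.contDiff_one_conv ht' hf hM)
    (hp.norm_conv_le ht' hM) (hp.norm_fderiv_conv_le ht' hf hM)

lemma fderiv_conv_half [CompleteSpace F] (hp : HeatFamily α c T p) {t : ℝ} (ht : t ∈ Ioc 0 T)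
    {f : 𝔼 d → F} (hf : StronglyMeasurable f) {M : ℝ} (hM : ∀ x, ‖f x‖ ≤ M) :
    fderiv ℝ (kernelConv (p t) f) =
      kernelConv (p (t / 2)) (fderiv ℝ (kernelConv (p (t / 2)) f)) := by
  conv_lhs => rw [← add_halves t]
  exact hp.fderiv_conv_add (half_pos ht.1) (half_pos ht.1) (by linarith [ht.2]) hf hM

/-- Each derivative uses up half of the remaining time. The induction varies the target space
because the gradient is again a convolution, now with values in linear maps. -/
lemma contDiff_conv [CompleteSpace F] (hp : HeatFamily α c T p) (n : ℕ) {t : ℝ}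
    (ht : t ∈ Ioc 0 T) {f : 𝔼 d → F} (hf : StronglyMeasurable f) {M : ℝ} (hM : ∀ x, ‖f x‖ ≤ M) :
    ContDiff ℝ n (kernelConv (p t) f) := by
  induction n generalizing F t M with
  | zero => exact contDiff_zero.2 (hp.contDiff_one_conv ht hf hM).continuous
  | succ n ih =>
    have ht2 : t / 2 ∈ Ioc 0 T := ⟨by linarith [ht.1], by linarith [ht.1, ht.2]⟩
    have h1 := hp.contDiff_one_conv ht hf hM
    rw [Nat.cast_add, Nat.cast_one, contDiff_succ_iff_fderiv]
    refine ⟨h1.differentiable one_ne_zero, by simp, ?_⟩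
    rw [hp.fderiv_conv_half ht hf hM]
    exact ih ht2 ((hp.contDiff_one_conv ht2 hf hM).continuous_fderiv
      one_ne_zero).stronglyMeasurable (hp.norm_fderiv_conv_le ht2 hf hM)

/-- Interpolation: the gradient bound for `θ`-Hölder data. -/
lemma norm_fderiv_conv_le_of_holder [CompleteSpace F] (hp : HeatFamily α c T p) {t : ℝ}
    (ht : t ∈ Ioc 0 T) {f : 𝔼 d → F} (hf : StronglyMeasurable f) {M : ℝ} (hM : ∀ x, ‖f x‖ ≤ M)
    {N θ : ℝ} (hN0 : 0 ≤ N) (hθ : 0 ≤ θ) (hN : ∀ x x', ‖f x - f x'‖ ≤ N * ‖x - x'‖ ^ θ) (x : 𝔼 d) :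
    ‖fderiv ℝ (kernelConv (p t) f) x‖ ≤ (1 + c) * N * t ^ (-((1 - θ) / α)) := by
  have hc := hp.const_nonneg ht
  set g := kernelConv (p t) f with hg
  have hd := (hp.contDiff_one_conv ht hf hM).differentiable one_ne_zero
  -- At this length scale the increment bound `N r^θ` and the Taylor remainder bound `c t^(-1/α) N
  -- r^θ · r` agree up to the factor `c`. The gradient is tested on vectors of length `r`.
  set r : ℝ := t ^ (1 / α) with hr
  have hr0 : 0 < r := Real.rpow_pos_of_pos ht.1 _
  set K : ℝ := c * t ^ (-(1 / α)) * N * r ^ θ with hK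
  have hB : 0 ≤ (1 + c) * N * t ^ (-((1 - θ) / α)) := by
    have := Real.rpow_nonneg ht.1.le (-((1 - θ) / α))
    positivity
  refine ContinuousLinearMap.opNorm_le_bound _ hB fun e => ?_
  rcases eq_or_ne e 0 with rfl | he
  · simp
  have he0 : 0 < ‖e‖ := norm_pos_iff.2 he
  set h : 𝔼 d := (r / ‖e‖) • e with hh
  have hhn : ‖h‖ = r := by
    rw [hh, norm_smul, Real.norm_of_nonneg (by positivity), div_mul_cancel₀ _ he0.ne']
  have h1 : ‖g (x + h) - g x - fderiv ℝ g x h‖ ≤ K * ‖h‖ := by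
    have := Convex.norm_image_sub_le_of_norm_fderiv_le' (𝕜 := ℝ) (f := g) (s := segment ℝ x (x + h))
      (x := x) (y := x + h) (C := K) (φ := fderiv ℝ g x) (fun y _ => hd y) (fun y hy => ?_)
      (convex_segment _ _) (left_mem_segment _ _ _) (right_mem_segment _ _ _)
    · simpa using this
    · refine (hp.fderiv_conv_holder ht hf hM hN y x).trans ?_
      have := Real.rpow_nonneg ht.1.le (-(1 / α))
      have hyx : ‖y - x‖ ≤ r := by
        rw [← hhn]
        simpa using norm_sub_le_of_mem_segment hy
      rw [hK]
      gcongr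
  have h2 : ‖g (x + h) - g x‖ ≤ N * r ^ θ := by
    have := hp.conv_holder ht hf hM hN (x + h) x
    rwa [add_sub_cancel_left, hhn] at this
  have h3 : ‖fderiv ℝ g x h‖ ≤ N * r ^ θ + K * r := by
    rw [← hhn, ← sub_sub_cancel (g (x + h) - g x) (fderiv ℝ g x h), hhn]
    refine (norm_sub_le _ _).trans (add_le_add h2 ?_)
    rwa [hhn] at h1
  have h4 : ‖fderiv ℝ g x e‖ = ‖fderiv ℝ g x h‖ * (‖e‖ / r) := by
    rw [hh, map_smul, norm_smul, Real.norm_of_nonneg (by positivity)]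
    field_simp
  have h5 : N * r ^ θ + K * r = (1 + c) * N * t ^ (-((1 - θ) / α)) * r := by
    have e1 : t ^ (-(1 / α)) * r = 1 := by
      rw [hr, ← Real.rpow_add ht.1]
      simp
    have e2 : t ^ (-((1 - θ) / α)) * r = r ^ θ := by
      rw [hr, ← Real.rpow_add ht.1, ← Real.rpow_mul ht.1.le]
      congr 1
      ring
    rw [hK]
    linear_combination c * N * r ^ θ * e1 - (1 + c) * N * e2
  rw [h4]
  calc _ ≤ ((1 + c) * N * t ^ (-((1 - θ) / α)) * r) * (‖e‖ / r) := by
        gcongr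
        rw [← h5]
        exact h3
    _ = _ := by field_simp

/-- Scheffé's argument: since both densities have mass one, `∫ |p_s - p_t| = 2 ∫ (p_t - p_s)⁺`, and
the positive part is dominated by `p_t`. Pointwise convergence therefore suffices. -/
lemma tendsto_integral_abs_sub (hp : HeatFamily α c T p) {t : ℝ} (ht : t ∈ Ioc 0 T) :
    Tendsto (fun s => ∫ y, |p s y - p t y|) (𝓝[Ioc 0 T] t) (𝓝 0) := by
  have e : ∀ s ∈ Ioc 0 T, ∫ y, |p s y - p t y| = 2 * ∫ y, max (p t y - p s y) 0 := by
    intro s hs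
    have hi : Integrable fun y => p t y - p s y :=
      (hp.integrable t ht).sub (hp.integrable s hs)
    have h1 : ∀ y, |p s y - p t y| = 2 * max (p t y - p s y) 0 - (p t y - p s y) := by
      intro y
      rcases le_total (p t y - p s y) 0 with h | h
      · rw [max_eq_right h, abs_of_nonneg (by linarith)]
        ring
      · rw [max_eq_left h, abs_of_nonpos (by linarith)]
        ring
    simp_rw [h1]
    rw [integral_sub (hi.pos_part.const_mul 2) hi, integral_const_mul,
      integral_sub (hp.integrable t ht) (hp.integrable s hs), hp.integral_eq_one t ht,
      hp.integral_eq_one s hs]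
    simp
  have hmeas : ∀ᶠ s in 𝓝[Ioc 0 T] t,
      AEStronglyMeasurable (fun y => max (p t y - p s y) 0) volume :=
    eventually_nhdsWithin_of_forall fun s hs =>
      ((hp.integrable t ht).sub (hp.integrable s hs)).pos_part.1
  have hbound : ∀ᶠ s in 𝓝[Ioc 0 T] t, ∀ᵐ y, ‖max (p t y - p s y) 0‖ ≤ p t y :=
    eventually_nhdsWithin_of_forall fun s hs => Eventually.of_forall fun y => by
      rw [Real.norm_of_nonneg (le_max_right _ _)]
      exact max_le (sub_le_self _ (hp.nonneg s hs y)) (hp.nonneg t ht y)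
  have hptw : ∀ᵐ y : 𝔼 d, Tendsto (fun s => max (p t y - p s y) 0) (𝓝[Ioc 0 T] t) (𝓝 0) :=
    Eventually.of_forall fun y => by
      have h1 : Tendsto (fun s => p s y) (𝓝[Ioc 0 T] t) (𝓝 (p t y)) := hp.continuousOn y t ht
      have h2 := (h1.const_sub (p t y)).max (tendsto_const_nhds (x := (0 : ℝ)))
      rwa [sub_self, max_self] at h2
  have hlim := tendsto_integral_filter_of_dominated_convergence (p t) hmeas hbound
    (hp.integrable t ht) hptw
  have := hlim.const_mul 2
  simp only [integral_zero, mul_zero] at this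
  refine this.congr' ?_
  filter_upwards [self_mem_nhdsWithin] with s hs using (e s hs).symm

lemma norm_conv_sub_conv_le (hp : HeatFamily α c T p) {s t : ℝ} (hs : s ∈ Ioc 0 T)
    (ht : t ∈ Ioc 0 T) {f : 𝔼 d → F} (hf : StronglyMeasurable f) {M : ℝ} (hM : ∀ x, ‖f x‖ ≤ M)
    (x : 𝔼 d) :
    ‖kernelConv (p s) f x - kernelConv (p t) f x‖ ≤ M * ∫ y, |p s y - p t y| := by
  rw [← kernelConv_sub_kernel (hp.integrable s hs) (hp.integrable t ht) hf hM]
  exact norm_kernelConv_le ((hp.integrable s hs).sub (hp.integrable t ht)) hM x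

/-- The common time `r` absorbs the derivative, and the remaining difference is controlled in sup
norm by the `L¹` distance of the kernels. -/
lemma norm_fderiv_conv_sub_conv_le [CompleteSpace F] (hp : HeatFamily α c T p) {r s t : ℝ}
    (hr : 0 < r) (hs : 0 < s) (ht : 0 < t) (hrs : r + s ≤ T) (hrt : r + t ≤ T)
    {f : 𝔼 d → F} (hf : StronglyMeasurable f) {M : ℝ} (hM : ∀ x, ‖f x‖ ≤ M) (x : 𝔼 d) :
    ‖fderiv ℝ (kernelConv (p (r + s)) f) x - fderiv ℝ (kernelConv (p (r + t)) f) x‖ ≤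
      c * r ^ (-(1 / α)) * (M * ∫ y, |p s y - p t y|) := by
  have hr' : r ∈ Ioc 0 T := ⟨hr, by linarith⟩
  have hs' : s ∈ Ioc 0 T := ⟨hs, by linarith⟩
  have ht' : t ∈ Ioc 0 T := ⟨ht, by linarith⟩
  have cs := (hp.continuous_conv hs' hf hM).stronglyMeasurable
  have ct := (hp.continuous_conv ht' hf hM).stronglyMeasurable
  rw [← hp.conv_conv hr hs hrs hf hM, ← hp.conv_conv hr ht hrt hf hM, ← fderiv_fun_sub
    ((hp.contDiff_one_conv hr' cs (hp.norm_conv_le hs' hM)).differentiable one_ne_zero x)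
    ((hp.contDiff_one_conv hr' ct (hp.norm_conv_le ht' hM)).differentiable one_ne_zero x)]
  simp_rw [← kernelConv_sub (hp.integrable r hr') cs ct (hp.norm_conv_le hs' hM)
    (hp.norm_conv_le ht' hM)]
  exact hp.norm_fderiv_conv_le hr' (cs.sub ct) (hp.norm_conv_sub_conv_le hs' ht' hf hM) x

/-- Time continuity in `C^1_b`. -/
lemma eventually_norm_conv_sub_le [CompleteSpace F] (hp : HeatFamily α c T p) {t : ℝ}
    (ht : t ∈ Ioc 0 T) {f : 𝔼 d → F} (hf : StronglyMeasurable f) {M : ℝ} (hM : ∀ x, ‖f x‖ ≤ M)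
    {ε : ℝ} (hε : 0 < ε) :
    ∀ᶠ s in 𝓝[Ioc 0 T] t, ∀ x, ‖kernelConv (p s) f x - kernelConv (p t) f x‖ ≤ ε ∧
      ‖fderiv ℝ (kernelConv (p s) f) x - fderiv ℝ (kernelConv (p t) f) x‖ ≤ ε := by
  have ht2 : t / 2 ∈ Ioc 0 T := ⟨by linarith [ht.1], by linarith [ht.1, ht.2]⟩
  have h1 := (hp.tendsto_integral_abs_sub ht).const_mul M
  have hmap : Tendsto (fun s => s - t / 2) (𝓝[Ioc 0 T] t) (𝓝[Ioc 0 T] (t / 2)) := by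
    refine tendsto_nhdsWithin_iff.2 ⟨?_, ?_⟩
    · refine Tendsto.mono_left ?_ nhdsWithin_le_nhds
      have : Continuous fun s : ℝ => s - t / 2 := by fun_prop
      simpa [sub_half] using this.tendsto t
    · filter_upwards [self_mem_nhdsWithin,
        mem_nhdsWithin_of_mem_nhds (lt_mem_nhds (half_lt_self ht.1))] with s hs hs'
      exact ⟨sub_pos.2 hs', by linarith [hs.2, ht2.1]⟩
  have h2 := (((hp.tendsto_integral_abs_sub ht2).comp hmap).const_mul M).const_mul
    (c * (t / 2) ^ (-(1 / α)))
  simp only [mul_zero] at h1 h2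
  filter_upwards [h1.eventually (gt_mem_nhds hε), h2.eventually (gt_mem_nhds hε),
    self_mem_nhdsWithin, hmap self_mem_nhdsWithin] with s hs1 hs2 hs hs'
  intro x
  refine ⟨(hp.norm_conv_sub_conv_le hs ht hf hM x).trans hs1.le, ?_⟩
  have := hp.norm_fderiv_conv_sub_conv_le ht2.1 hs'.1 ht2.1 (by linarith [hs.2])
    (by linarith [ht.2]) hf hM x
  rw [add_sub_cancel, add_halves] at this
  exact this.trans hs2.le

end HeatFamily

end HeatFamilyEstimates

/-! ### Time integrals with power singularities -/

noncomputable section TimeIntegrals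

variable {d : ℕ} {F : Type} [NormedAddCommGroup F] [NormedSpace ℝ F]

local notation:max "𝔼" d:max => EuclideanSpace ℝ (Fin d)

lemma aestronglyMeasurable_of_apply {Ω : Type*} [MeasurableSpace Ω] {μ : Measure Ω}
    {L : Ω → 𝔼 d →L[ℝ] F} (h : ∀ e, AEStronglyMeasurable (fun ω => L ω e) μ) :
    AEStronglyMeasurable L μ := by
  have e : L = fun ω => ∑ i : Fin d, ContinuousLinearMap.smulRightL ℝ (𝔼 d) F
      (EuclideanSpace.proj i) (L ω (EuclideanSpace.single i 1)) := by
    ext ω v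
    simp only [sum_apply, ContinuousLinearMap.smulRightL_apply_apply]
    conv_lhs => rw [← (EuclideanSpace.basisFun (Fin d) ℝ).sum_repr v]
    simp [map_sum]
  rw [e]
  exact Finset.aestronglyMeasurable_fun_sum _ fun i _ =>
    (ContinuousLinearMap.continuous _).comp_aestronglyMeasurable (h _)

/-- Directional derivatives are limits of difference quotients with step `1/n`, and in finite
dimension the directions determine the derivative measurably. -/
lemma aestronglyMeasurable_fderiv_apply {Ω : Type*} [MeasurableSpace Ω] {μ : Measure Ω}
    {g : Ω → 𝔼 d → F} (hg : ∀ x, AEStronglyMeasurable (fun ω => g ω x) μ)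
    (hd : ∀ᵐ ω ∂μ, Differentiable ℝ (g ω)) (x : 𝔼 d) :
    AEStronglyMeasurable (fun ω => fderiv ℝ (g ω) x) μ := by
  refine aestronglyMeasurable_of_apply fun e => ?_
  refine aestronglyMeasurable_of_tendsto_ae atTop
    (f := fun (n : ℕ) ω => (n : ℝ) • (g ω (x + (n : ℝ)⁻¹ • e) - g ω x))
    (fun n => ((hg _).sub (hg _)).const_smul _) ?_
  filter_upwards [hd] with ω hω
  refine (hω x).hasFDerivAt.lim e ?_
  simpa using tendsto_natCast_atTop_atTop (R := ℝ)

omit [NormedSpace ℝ F] in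
lemma intervalIntegrable_of_norm_le {t : ℝ} (ht : 0 ≤ t) {g : ℝ → F} {b : ℝ → ℝ}
    (hg : AEStronglyMeasurable g (volume.restrict (Ioc 0 t)))
    (hb : IntervalIntegrable b volume 0 t) (hgb : ∀ τ ∈ Ioc 0 t, ‖g τ‖ ≤ b τ) :
    IntervalIntegrable g volume 0 t := by
  rw [intervalIntegrable_iff_integrableOn_Ioc_of_le ht] at hb ⊢
  exact Integrable.mono' hb hg ((ae_restrict_iff' measurableSet_Ioc).2
    (Eventually.of_forall hgb))

/-- Differentiation of a time integral of functions of `x`. -/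
lemma hasFDerivAt_timeIntegral {t : ℝ} (ht : 0 ≤ t) {g : ℝ → 𝔼 d → F} {b : ℝ → ℝ}
    (hg : ∀ x, IntervalIntegrable (fun τ => g τ x) volume 0 t)
    (hd : ∀ τ ∈ Ioc 0 t, Differentiable ℝ (g τ)) (hb : IntervalIntegrable b volume 0 t)
    (hgb : ∀ τ ∈ Ioc 0 t, ∀ x, ‖fderiv ℝ (g τ) x‖ ≤ b τ) :
    (∀ x, IntervalIntegrable (fun τ => fderiv ℝ (g τ) x) volume 0 t) ∧
      ∀ x, HasFDerivAt (fun x => ∫ τ in (0 : ℝ)..t, g τ x)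
        (∫ τ in (0 : ℝ)..t, fderiv ℝ (g τ) x) x := by
  have hm : ∀ x, AEStronglyMeasurable (fun τ => g τ x) (volume.restrict (Ioc 0 t)) :=
    fun x => ((intervalIntegrable_iff_integrableOn_Ioc_of_le ht).1 (hg x)).1
  have hm' : ∀ x, AEStronglyMeasurable (fun τ => fderiv ℝ (g τ) x) (volume.restrict (Ioc 0 t)) :=
    aestronglyMeasurable_fderiv_apply hm
      ((ae_restrict_iff' measurableSet_Ioc).2 (Eventually.of_forall hd))
  refine ⟨fun x => intervalIntegrable_of_norm_le ht (hm' x) hb fun τ hτ => hgb τ hτ x,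
    fun x => ?_⟩
  have e := uIoc_of_le ht
  refine intervalIntegral.hasFDerivAt_integral_of_dominated_of_fderiv_le (s := univ) (bound := b)
    (F' := fun x τ => fderiv ℝ (g τ) x) univ_mem ?_ (hg x) ?_ ?_ hb ?_
  · filter_upwards with x
    rw [e]
    exact hm x
  · rw [e]
    exact hm' x
  · filter_upwards with τ hτ x _
    exact hgb τ (e ▸ hτ) x
  · filter_upwards with τ hτ x _
    exact (hd τ (e ▸ hτ) x).hasFDerivAt

lemma intervalIntegrable_rpow_neg {a : ℝ} (ha : a < 1) (s t : ℝ) :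
    IntervalIntegrable (fun τ : ℝ => τ ^ (-a)) volume s t :=
  intervalIntegral.intervalIntegrable_rpow' (by linarith)

lemma integral_rpow_neg {a : ℝ} (ha : a < 1) (t : ℝ) :
    ∫ τ in (0 : ℝ)..t, τ ^ (-a) = t ^ (1 - a) / (1 - a) := by
  rw [integral_rpow (Or.inl (by linarith)), Real.zero_rpow (by linarith), sub_zero,
    neg_add_eq_sub]

lemma norm_timeIntegral_le {t : ℝ} (ht : 0 ≤ t) {g : ℝ → F} {b : ℝ → ℝ}
    (hb : IntervalIntegrable b volume 0 t) (hgb : ∀ τ ∈ Ioc 0 t, ‖g τ‖ ≤ b τ) :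
    ‖∫ τ in (0 : ℝ)..t, g τ‖ ≤ ∫ τ in (0 : ℝ)..t, b τ :=
  intervalIntegral.norm_integral_le_of_norm_le ht
    (Eventually.of_forall fun τ hτ => hgb τ hτ) hb

lemma norm_timeIntegral_le_rpow {t a K : ℝ} (ht : 0 ≤ t) (ha : a < 1) {g : ℝ → F}
    (hgb : ∀ τ ∈ Ioc 0 t, ‖g τ‖ ≤ K * τ ^ (-a)) :
    ‖∫ τ in (0 : ℝ)..t, g τ‖ ≤ K * (t ^ (1 - a) / (1 - a)) := by
  rw [← integral_rpow_neg ha, ← intervalIntegral.integral_const_mul]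
  exact norm_timeIntegral_le ht ((intervalIntegrable_rpow_neg ha _ _).const_mul K) hgb

/-- The interpolation at the heart of the Schauder estimate. -/
lemma norm_timeIntegral_le_of_min {t a b K r : ℝ} (ht : 0 ≤ t) (ha : a < 1) (hb : 1 < b)
    (hK : 0 ≤ K) (hr : 0 < r) {g : ℝ → F} (hg : IntervalIntegrable g volume 0 t)
    (h1 : ∀ τ ∈ Ioc 0 t, ‖g τ‖ ≤ 2 * K * τ ^ (-a))
    (h2 : ∀ τ ∈ Ioc 0 t, ‖g τ‖ ≤ K * r * τ ^ (-b)) :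
    ‖∫ τ in (0 : ℝ)..t, g τ‖ ≤ K * (2 / (1 - a) + 1 / (b - 1)) * r ^ ((1 - a) / (b - a)) := by
  have ha' : 0 < 1 - a := by linarith
  have hb' : 0 < b - 1 := by linarith
  have hba : 0 < b - a := by linarith
  -- Here `τ^(-a)` and `r τ^(-b)` coincide. The first bound is integrable at `0` since `a < 1`, the
  -- second at infinity since `b > 1`.
  set δ : ℝ := r ^ (1 / (b - a)) with hδ
  have hδ0 : 0 < δ := Real.rpow_pos_of_pos hr _
  have e1 : δ ^ (1 - a) = r ^ ((1 - a) / (b - a)) := by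
    rw [hδ, ← Real.rpow_mul hr.le]
    congr 1
    ring
  have e2 : r = δ ^ (b - a) := by
    rw [hδ, ← Real.rpow_mul hr.le]
    field_simp
    simp
  rw [← e1]
  have hδa : 0 ≤ δ ^ (1 - a) := Real.rpow_nonneg hδ0.le _
  rcases le_total t δ with htδ | htδ
  · calc _ ≤ 2 * K * (t ^ (1 - a) / (1 - a)) := norm_timeIntegral_le_rpow ht ha h1
      _ ≤ 2 * K * (δ ^ (1 - a) / (1 - a)) := by gcongr
      _ = K * (2 / (1 - a) + 0) * δ ^ (1 - a) := by ring
      _ ≤ _ := by gcongr; positivity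
  · have hsub : Set.uIcc 0 δ ⊆ Set.uIcc 0 t := by
      rw [uIcc_of_le hδ0.le, uIcc_of_le ht]
      exact Icc_subset_Icc_right htδ
    have hsub' : Set.uIcc δ t ⊆ Set.uIcc 0 t := by
      rw [uIcc_of_le htδ, uIcc_of_le ht]
      exact Icc_subset_Icc_left hδ0.le
    rw [← intervalIntegral.integral_add_adjacent_intervals (hg.mono_set hsub) (hg.mono_set hsub')]
    have i1 : ‖∫ τ in (0 : ℝ)..δ, g τ‖ ≤ 2 * K * (δ ^ (1 - a) / (1 - a)) :=
      norm_timeIntegral_le_rpow hδ0.le ha fun τ hτ => h1 τ ⟨hτ.1, hτ.2.trans htδ⟩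
    have h0 : (0 : ℝ) ∉ Set.uIcc δ t := by
      rw [uIcc_of_le htδ]
      exact fun h => hδ0.not_ge h.1
    have i2 : ‖∫ τ in δ..t, g τ‖ ≤ K * r * (δ ^ (1 - b) / (b - 1)) := by
      calc _ ≤ ∫ τ in δ..t, K * r * τ ^ (-b) :=
            intervalIntegral.norm_integral_le_of_norm_le htδ
              (Eventually.of_forall fun τ hτ => h2 τ ⟨hδ0.trans hτ.1, hτ.2⟩)
              ((intervalIntegral.intervalIntegrable_rpow (Or.inr h0)).const_mul _)
        _ = K * r * ((δ ^ (1 - b) - t ^ (1 - b)) / (b - 1)) := by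
            rw [intervalIntegral.integral_const_mul,
              integral_rpow (Or.inr ⟨by linarith, h0⟩), neg_add_eq_sub, ← neg_sub b 1, div_neg,
              ← neg_div, neg_sub]
        _ ≤ _ := by
            gcongr
            linarith [Real.rpow_nonneg ht (1 - b)]
    have e3 : r * δ ^ (1 - b) = δ ^ (1 - a) := by
      conv_lhs => rw [e2]
      rw [← Real.rpow_add hδ0]
      congr 1
      ring
    refine (norm_add_le _ _).trans ((add_le_add i1 i2).trans_eq ?_)
    linear_combination K / (b - 1) * e3

/-- A Beta integral: on each half of `[0,t]` one of the factors is nonsingular and is replaced by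
its value at `t/2`. -/
lemma integral_mul_rpow_le {t a b : ℝ} (ht : 0 < t) (ha0 : 0 ≤ a) (hb0 : 0 ≤ b) (ha : a < 1)
    (hb : b < 1) :
    IntervalIntegrable (fun τ : ℝ => τ ^ (-a) * (t - τ) ^ (-b)) volume 0 t ∧
    ∫ τ in (0 : ℝ)..t, τ ^ (-a) * (t - τ) ^ (-b) ≤
      2 ^ (a + b) * (1 / (1 - a) + 1 / (1 - b)) * t ^ (1 - a - b) := by
  have ht2 : 0 < t / 2 := half_pos ht
  have ib : IntervalIntegrable (fun τ : ℝ => (t - τ) ^ (-b)) volume 0 t := by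
    have := (intervalIntegrable_rpow_neg hb t 0).comp_sub_left t
    simpa using this
  have hB : IntervalIntegrable (fun τ : ℝ => (t / 2) ^ (-b) * τ ^ (-a) +
      (t / 2) ^ (-a) * (t - τ) ^ (-b)) volume 0 t :=
    ((intervalIntegrable_rpow_neg ha 0 t).const_mul _).add (ib.const_mul _)
  have hle : ∀ τ ∈ Ioc 0 t, ‖τ ^ (-a) * (t - τ) ^ (-b)‖ ≤ (t / 2) ^ (-b) * τ ^ (-a) +
      (t / 2) ^ (-a) * (t - τ) ^ (-b) := by
    intro τ hτ
    have p1 := Real.rpow_nonneg hτ.1.le (-a)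
    have p2 := Real.rpow_nonneg (sub_nonneg.2 hτ.2) (-b)
    have p3 := Real.rpow_nonneg ht2.le (-a)
    have p4 := Real.rpow_nonneg ht2.le (-b)
    rw [Real.norm_of_nonneg (by positivity)]
    rcases le_total τ (t / 2) with h | h
    · have : (t - τ) ^ (-b) ≤ (t / 2) ^ (-b) :=
        Real.rpow_le_rpow_of_nonpos ht2 (by linarith) (by linarith)
      nlinarith [mul_le_mul_of_nonneg_left this p1, mul_nonneg p3 p2]
    · have : τ ^ (-a) ≤ (t / 2) ^ (-a) :=
        Real.rpow_le_rpow_of_nonpos ht2 (by linarith) (by linarith)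
      nlinarith [mul_le_mul_of_nonneg_right this p2, mul_nonneg p4 p1]
  have hm : AEStronglyMeasurable (fun τ : ℝ => τ ^ (-a) * (t - τ) ^ (-b))
      (volume.restrict (Ioc 0 t)) := by
    refine Measurable.aestronglyMeasurable ?_
    fun_prop
  have hI := intervalIntegrable_of_norm_le ht.le hm hB hle
  refine ⟨hI, ?_⟩
  have h1 := norm_timeIntegral_le ht.le hB hle
  refine (le_abs_self _).trans (h1.trans ?_)
  have e1 : ∫ τ in (0 : ℝ)..t, (t - τ) ^ (-b) = t ^ (1 - b) / (1 - b) := by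
    rw [intervalIntegral.integral_comp_sub_left (fun τ => τ ^ (-b)), sub_self, sub_zero,
      integral_rpow_neg hb]
  rw [intervalIntegral.integral_add ((intervalIntegrable_rpow_neg ha 0 t).const_mul _)
    (ib.const_mul _), intervalIntegral.integral_const_mul, intervalIntegral.integral_const_mul,
    e1, integral_rpow_neg ha]
  have e2 : ∀ x y : ℝ, 0 ≤ x → 0 ≤ y → x + y = a + b →
      (t / 2) ^ (-x) * t ^ (1 - y) ≤ 2 ^ (a + b) * t ^ (1 - a - b) := by
    intro x y hx hy hxy
    rw [Real.div_rpow ht.le zero_le_two, Real.rpow_neg zero_le_two, div_inv_eq_mul,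
      mul_comm _ ((2 : ℝ) ^ x), mul_assoc, ← Real.rpow_add ht,
      show -x + (1 - y) = 1 - a - b by linarith]
    gcongr
    · exact one_le_two
    · linarith
  have ha' : 0 < 1 - a := by linarith
  have hb' : 0 < 1 - b := by linarith
  have f1 := e2 b a hb0 ha0 (add_comm _ _)
  have f2 := e2 a b ha0 hb0 rfl
  calc _ = ((t / 2) ^ (-b) * t ^ (1 - a)) / (1 - a) +
        ((t / 2) ^ (-a) * t ^ (1 - b)) / (1 - b) := by ring
    _ ≤ (2 ^ (a + b) * t ^ (1 - a - b)) / (1 - a) +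
        (2 ^ (a + b) * t ^ (1 - a - b)) / (1 - b) := by gcongr
    _ = _ := by ring

end TimeIntegrals

/-! ### The Duhamel integral in `C^1` -/

noncomputable section Duhamel

variable {d : ℕ}

local notation:max "𝔼" d:max => EuclideanSpace ℝ (Fin d)

/-- Jointly measurable source terms bounded by `M`. -/
structure IsSource (f : ℝ → 𝔼 d → ℝ) (M : ℝ) : Prop where
  measurable : Measurable (Function.uncurry f)
  bound : ∀ s x, ‖f s x‖ ≤ M

/-- `∫_0^t P_τ f(τ) dτ`. -/
def heatIntegral (p : ℝ → 𝔼 d → ℝ) (f : ℝ → 𝔼 d → ℝ) (t : ℝ) (x : 𝔼 d) : ℝ :=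
  ∫ τ in (0 : ℝ)..t, kernelConv (p τ) (f τ) x

/-- The Duhamel integral `∫_0^t P_{t-s} f(s) ds`, written with `τ = t - s`. -/
def duhamel (p : ℝ → 𝔼 d → ℝ) (f : ℝ → 𝔼 d → ℝ) (t : ℝ) : 𝔼 d → ℝ :=
  heatIntegral p (fun τ => f (t - τ)) t

namespace IsSource

variable {f g : ℝ → 𝔼 d → ℝ} {M N : ℝ}

lemma stronglyMeasurable (hf : IsSource f M) (s : ℝ) : StronglyMeasurable (f s) :=
  (hf.measurable.comp measurable_prodMk_left).stronglyMeasurable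

lemma nonneg (hf : IsSource f M) : 0 ≤ M := (norm_nonneg _).trans (hf.bound 0 0)

lemma comp_sub (hf : IsSource f M) (t : ℝ) : IsSource (fun τ => f (t - τ)) M :=
  ⟨hf.measurable.comp ((measurable_const.sub measurable_fst).prodMk measurable_snd),
    fun _ _ => hf.bound _ _⟩

lemma sub (hf : IsSource f M) (hg : IsSource g N) {m : ℝ} (h : ∀ s x, ‖f s x - g s x‖ ≤ m) :
    IsSource (fun s x => f s x - g s x) m :=
  ⟨hf.measurable.sub hg.measurable, h⟩

end IsSource

/-- Extension by zero of a measurable function on `(0,T] × X`. -/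
lemma measurable_extend {X : Type*} [MeasurableSpace X] {T : ℝ} {u : Ioc (0 : ℝ) T × X → ℝ}
    (hu : Measurable u) :
    Measurable fun z : ℝ × X => if h : z.1 ∈ Ioc (0 : ℝ) T then u (⟨z.1, h⟩, z.2) else 0 := by
  classical
  have hs : MeasurableSet {z : ℝ × X | z.1 ∈ Ioc (0 : ℝ) T} := measurable_fst measurableSet_Ioc
  refine Measurable.dite (s := {z : ℝ × X | z.1 ∈ Ioc (0 : ℝ) T})
    (f := fun z => u (⟨z.1.1, z.2⟩, z.1.2)) (g := fun _ => 0) ?_ measurable_const hs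
  exact hu.comp (((measurable_fst.comp measurable_subtype_coe).subtype_mk).prodMk
    (measurable_snd.comp measurable_subtype_coe))

namespace HeatFamily

variable {α c T : ℝ} {p : ℝ → 𝔼 d → ℝ}

/-- A Carathéodory function: continuous in time for fixed `x`, measurable in `x` for fixed time. -/
lemma measurable_extend (hp : HeatFamily α c T p) :
    Measurable fun z : ℝ × 𝔼 d => if z.1 ∈ Ioc (0 : ℝ) T then p z.1 z.2 else 0 := by
  have h1 : Measurable (Function.uncurry fun (t : Ioc (0 : ℝ) T) x => p t x) :=
    measurable_uncurry_of_continuous_of_measurable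
      (fun x => continuousOn_iff_continuous_domRestrict.1 (hp.continuousOn x))
      fun t => (hp.contDiff t t.2).continuous.measurable
  simpa [Function.uncurry] using _root_.measurable_extend h1

lemma stronglyMeasurable_conv (hp : HeatFamily α c T p) {f : ℝ → 𝔼 d → ℝ}
    (hf : Measurable (Function.uncurry f)) :
    StronglyMeasurable fun z : ℝ × 𝔼 d =>
      if z.1 ∈ Ioc (0 : ℝ) T then kernelConv (p z.1) (f z.1) z.2 else 0 := by
  have h1 : StronglyMeasurable fun w : (ℝ × 𝔼 d) × 𝔼 d =>
      (if w.1.1 ∈ Ioc (0 : ℝ) T then p w.1.1 w.2 else 0) * f w.1.1 (w.1.2 - w.2) := by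
    refine Measurable.stronglyMeasurable (Measurable.mul ?_ ?_)
    · exact hp.measurable_extend.comp ((measurable_fst.comp measurable_fst).prodMk measurable_snd)
    · exact hf.comp ((measurable_fst.comp measurable_fst).prodMk
        ((measurable_snd.comp measurable_fst).sub measurable_snd))
  convert! h1.integral_prod_right' (ν := (volume : Measure (𝔼 d))) using 2 with z
  split_ifs <;> simp [kernelConv]

variable {f g : ℝ → 𝔼 d → ℝ} {M N t : ℝ}

lemma aestronglyMeasurable_conv (hp : HeatFamily α c T p) (hf : IsSource f M) (htT : t ≤ T)
    (x : 𝔼 d) :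
    AEStronglyMeasurable (fun τ => kernelConv (p τ) (f τ) x) (volume.restrict (Ioc 0 t)) := by
  have h1 := ((hp.stronglyMeasurable_conv hf.measurable).comp_measurable
    (measurable_prodMk_right (y := x))).aestronglyMeasurable (μ := volume.restrict (Ioc 0 t))
  refine h1.congr ((ae_restrict_iff' measurableSet_Ioc).2 (Eventually.of_forall fun τ hτ => ?_))
  exact if_pos (show τ ∈ Ioc 0 T from ⟨hτ.1, hτ.2.trans htT⟩)

lemma intervalIntegrable_conv (hp : HeatFamily α c T p) (hf : IsSource f M) (ht : 0 ≤ t)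
    (htT : t ≤ T) (x : 𝔼 d) :
    IntervalIntegrable (fun τ => kernelConv (p τ) (f τ) x) volume 0 t :=
  intervalIntegrable_of_norm_le ht (hp.aestronglyMeasurable_conv hf htT x)
    (intervalIntegrable_const (c := M))
    fun _ hτ => hp.norm_conv_le ⟨hτ.1, hτ.2.trans htT⟩ (hf.bound _) x

lemma norm_heatIntegral_le (hp : HeatFamily α c T p) (hf : IsSource f M) (ht : 0 ≤ t)
    (htT : t ≤ T) (x : 𝔼 d) : ‖heatIntegral p f t x‖ ≤ M * t := by
  have := norm_timeIntegral_le (b := fun _ => M) ht intervalIntegrable_const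
    fun τ hτ => hp.norm_conv_le ⟨hτ.1, hτ.2.trans htT⟩ (hf.bound τ) x
  simpa [heatIntegral, mul_comm] using this

lemma norm_fderiv_source_le (hp : HeatFamily α c T p) (hf : IsSource f M) {τ : ℝ}
    (hτ : τ ∈ Ioc 0 t) (htT : t ≤ T) (x : 𝔼 d) :
    ‖fderiv ℝ (kernelConv (p τ) (f τ)) x‖ ≤ c * M * τ ^ (-(1 / α)) :=
  (hp.norm_fderiv_conv_le ⟨hτ.1, hτ.2.trans htT⟩ (hf.stronglyMeasurable τ) (hf.bound τ) x).trans_eq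
    (by ring)

lemma hasFDerivAt_heatIntegral (hp : HeatFamily α c T p) (hα : 1 < α) (hf : IsSource f M)
    (ht : 0 ≤ t) (htT : t ≤ T) :
    (∀ x, IntervalIntegrable (fun τ => fderiv ℝ (kernelConv (p τ) (f τ)) x) volume 0 t) ∧
    ∀ x, HasFDerivAt (heatIntegral p f t)
      (∫ τ in (0 : ℝ)..t, fderiv ℝ (kernelConv (p τ) (f τ)) x) x := by
  refine hasFDerivAt_timeIntegral ht (b := fun τ => c * M * τ ^ (-(1 / α)))
    (hp.intervalIntegrable_conv hf ht htT) (fun τ hτ => ?_) ?_ ?_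
  · exact (hp.contDiff_one_conv ⟨hτ.1, hτ.2.trans htT⟩ (hf.stronglyMeasurable τ)
      (hf.bound τ)).differentiable one_ne_zero
  · exact (intervalIntegrable_rpow_neg ((div_lt_one (by linarith)).2 hα) _ _).const_mul _
  · exact fun τ hτ x => hp.norm_fderiv_source_le hf hτ htT x

lemma norm_fderiv_heatIntegral_le (hp : HeatFamily α c T p) (hα : 1 < α) (hf : IsSource f M)
    (ht : 0 ≤ t) (htT : t ≤ T) (x : 𝔼 d) :
    ‖fderiv ℝ (heatIntegral p f t) x‖ ≤ c * M * (t ^ (1 - 1 / α) / (1 - 1 / α)) := by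
  rw [((hp.hasFDerivAt_heatIntegral hα hf ht htT).2 x).fderiv]
  exact norm_timeIntegral_le_rpow ht ((div_lt_one (by linarith)).2 hα)
    fun τ hτ => hp.norm_fderiv_source_le hf hτ htT x

lemma contDiff_heatIntegral (hp : HeatFamily α c T p) (hα : 1 < α) (hf : IsSource f M)
    (ht : 0 ≤ t) (htT : t ≤ T) : ContDiff ℝ 1 (heatIntegral p f t) := by
  obtain ⟨h1, h2⟩ := hp.hasFDerivAt_heatIntegral hα hf ht htT
  rw [contDiff_one_iff_fderiv]
  refine ⟨fun x => (h2 x).differentiableAt, ?_⟩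
  rw [funext fun x => (h2 x).fderiv]
  have e := uIoc_of_le ht
  refine intervalIntegral.continuous_of_dominated_interval
    (bound := fun τ => c * M * τ ^ (-(1 / α))) (fun x => ?_) (fun x => ?_)
    ((intervalIntegrable_rpow_neg ((div_lt_one (by linarith)).2 hα) _ _).const_mul _) ?_
  · exact e ▸ ((intervalIntegrable_iff_integrableOn_Ioc_of_le ht).1 (h1 x)).1
  · exact Eventually.of_forall fun τ hτ => hp.norm_fderiv_source_le hf (e ▸ hτ) htT x
  · refine Eventually.of_forall fun τ hτ => ?_
    rw [e] at hτ
    exact (hp.contDiff_one_conv ⟨hτ.1, hτ.2.trans htT⟩ (hf.stronglyMeasurable τ)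
      (hf.bound τ)).continuous_fderiv one_ne_zero

/-- The gradient of the time integral inherits the spatial regularity of the source. -/
lemma fderiv_heatIntegral_holder (hp : HeatFamily α c T p) (hα : 1 < α) (hf : IsSource f M)
    (ht : 0 < t) (htT : t ≤ T) {A B b θ : ℝ} (hb0 : 0 ≤ b) (hb : b < 1) (hB : 0 ≤ B)
    (hN : ∀ τ ∈ Ioc 0 t, ∀ x x', ‖f τ x - f τ x'‖ ≤ (A + B * (t - τ) ^ (-b)) * ‖x - x'‖ ^ θ)
    (x x' : 𝔼 d) :
    ‖fderiv ℝ (heatIntegral p f t) x - fderiv ℝ (heatIntegral p f t) x'‖ ≤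
      c * (A * (t ^ (1 - 1 / α) / (1 - 1 / α)) + B * (2 ^ (1 / α + b) *
        (1 / (1 - 1 / α) + 1 / (1 - b)) * t ^ (1 - 1 / α - b))) * ‖x - x'‖ ^ θ := by
  have hα0 : 0 < α := by linarith
  have ha : 1 / α < 1 := (div_lt_one hα0).2 hα
  have hc := hp.const_nonneg ⟨ht, htT⟩
  obtain ⟨h1, h2⟩ := hp.hasFDerivAt_heatIntegral hα hf ht.le htT
  obtain ⟨i1, i2⟩ := integral_mul_rpow_le ht (by positivity : (0 : ℝ) ≤ 1 / α) hb0 ha hb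
  have hi1 := intervalIntegrable_rpow_neg ha 0 t
  rw [(h2 x).fderiv, (h2 x').fderiv, ← intervalIntegral.integral_sub (h1 x) (h1 x')]
  -- The weight `(t - τ)^(-b)` is the blow-up of the source's Hölder constant at source time `t - τ
  -- → 0`; with the kernel's `τ^(-1/α)` it forms the Beta integral.
  refine (norm_timeIntegral_le ht.le (b := fun τ => (c * A * ‖x - x'‖ ^ θ) * τ ^ (-(1 / α)) +
    (c * B * ‖x - x'‖ ^ θ) * (τ ^ (-(1 / α)) * (t - τ) ^ (-b)))
    ((hi1.const_mul _).add (i1.const_mul _)) fun τ hτ => ?_).trans ?_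
  · refine (hp.fderiv_conv_holder ⟨hτ.1, hτ.2.trans htT⟩ (hf.stronglyMeasurable τ) (hf.bound τ)
      (hN τ hτ) x x').trans_eq (by ring)
  · rw [intervalIntegral.integral_add (hi1.const_mul _) (i1.const_mul _),
      intervalIntegral.integral_const_mul, intervalIntegral.integral_const_mul,
      integral_rpow_neg ha]
    have : 0 ≤ c * B * ‖x - x'‖ ^ θ := by positivity
    nlinarith [mul_le_mul_of_nonneg_left i2 this]

lemma heatIntegral_sub (hp : HeatFamily α c T p) (hf : IsSource f M) (hg : IsSource g N)
    (ht : 0 ≤ t) (htT : t ≤ T) (x : 𝔼 d) :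
    heatIntegral p (fun s x => f s x - g s x) t x =
      heatIntegral p f t x - heatIntegral p g t x := by
  rw [heatIntegral, heatIntegral, heatIntegral, ← intervalIntegral.integral_sub
    (hp.intervalIntegrable_conv hf ht htT x) (hp.intervalIntegrable_conv hg ht htT x)]
  refine intervalIntegral.integral_congr_ae (Eventually.of_forall fun τ hτ => ?_)
  rw [uIoc_of_le ht] at hτ
  exact kernelConv_sub (hp.integrable τ ⟨hτ.1, hτ.2.trans htT⟩) (hf.stronglyMeasurable τ)
    (hg.stronglyMeasurable τ) (hf.bound τ) (hg.bound τ) x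

/-- Differences of time integrals in `C^1`. -/
lemma heatIntegral_sub_le (hp : HeatFamily α c T p) (hα : 1 < α) (hf : IsSource f M)
    (hg : IsSource g N) (ht : 0 ≤ t) (htT : t ≤ T) {m : ℝ} (hm : ∀ s x, ‖f s x - g s x‖ ≤ m)
    (x : 𝔼 d) :
    ‖heatIntegral p f t x - heatIntegral p g t x‖ ≤ m * t ∧
    ‖fderiv ℝ (heatIntegral p f t) x - fderiv ℝ (heatIntegral p g t) x‖ ≤
      c * m * (t ^ (1 - 1 / α) / (1 - 1 / α)) := by
  have hs := hf.sub hg hm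
  have e : (fun x => heatIntegral p f t x - heatIntegral p g t x) =
      heatIntegral p (fun s x => f s x - g s x) t :=
    funext fun x => (hp.heatIntegral_sub hf hg ht htT x).symm
  refine ⟨?_, ?_⟩
  · rw [← hp.heatIntegral_sub hf hg ht htT]
    exact hp.norm_heatIntegral_le hs ht htT x
  · rw [← fderiv_fun_sub
      ((hp.contDiff_heatIntegral hα hf ht htT).differentiable one_ne_zero x)
      ((hp.contDiff_heatIntegral hα hg ht htT).differentiable one_ne_zero x), e]
    exact hp.norm_fderiv_heatIntegral_le hα hs ht htT x

lemma conv_heatIntegral (hp : HeatFamily α c T p) (hf : IsSource f M) {δ : ℝ} (hδ : 0 < δ)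
    (ht : 0 ≤ t) (htT : δ + t ≤ T) (x : 𝔼 d) :
    kernelConv (p δ) (heatIntegral p f t) x =
      ∫ τ in (0 : ℝ)..t, kernelConv (p (δ + τ)) (f τ) x := by
  have hδ' : δ ∈ Ioc 0 T := ⟨hδ, by linarith⟩
  have ht' : t ≤ T := by linarith
  have hint : Integrable (Function.uncurry fun (y : 𝔼 d) (τ : ℝ) =>
      p δ y • kernelConv (p τ) (f τ) (x - y)) (volume.prod (volume.restrict (Ioc 0 t))) := by
    have hmeas : AEStronglyMeasurable (Function.uncurry fun (y : 𝔼 d) (τ : ℝ) =>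
        p δ y • kernelConv (p τ) (f τ) (x - y)) (volume.prod (volume.restrict (Ioc 0 t))) := by
      have h0 : StronglyMeasurable fun w : 𝔼 d × ℝ =>
          p δ w.1 • (if w.2 ∈ Ioc (0 : ℝ) T then kernelConv (p w.2) (f w.2) (x - w.1) else 0) :=
        ((hp.contDiff δ hδ').continuous.stronglyMeasurable.comp_measurable measurable_fst).smul
          ((hp.stronglyMeasurable_conv hf.measurable).comp_measurable
            (measurable_snd.prodMk (measurable_const.sub measurable_fst)))
      refine h0.aestronglyMeasurable.congr ?_
      have : ∀ᵐ w : 𝔼 d × ℝ ∂(volume.prod (volume.restrict (Ioc 0 t))), w.2 ∈ Ioc 0 t :=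
        Measure.quasiMeasurePreserving_snd.ae (ae_restrict_mem measurableSet_Ioc)
      filter_upwards [this] with w hw
      rw [if_pos (show w.2 ∈ Ioc 0 T from ⟨hw.1, hw.2.trans ht'⟩)]
      rfl
    have hdom : Integrable (fun w : 𝔼 d × ℝ => p δ w.1 * M)
        (volume.prod (volume.restrict (Ioc 0 t))) :=
      (hp.integrable δ hδ').mul_prod (integrable_const M)
    refine hdom.mono' hmeas ?_
    have : ∀ᵐ w : 𝔼 d × ℝ ∂(volume.prod (volume.restrict (Ioc 0 t))), w.2 ∈ Ioc 0 t :=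
      Measure.quasiMeasurePreserving_snd.ae (ae_restrict_mem measurableSet_Ioc)
    filter_upwards [this] with w hw
    rw [Function.uncurry_def, norm_smul, Real.norm_of_nonneg (hp.nonneg δ hδ' _)]
    exact mul_le_mul_of_nonneg_left
      (hp.norm_conv_le ⟨hw.1, hw.2.trans ht'⟩ (hf.bound _) _) (hp.nonneg δ hδ' _)
  have e1 : kernelConv (p δ) (heatIntegral p f t) x =
      ∫ y, ∫ τ in Ioc 0 t, p δ y • kernelConv (p τ) (f τ) (x - y) := by
    refine integral_congr_ae (Eventually.of_forall fun y => ?_)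
    simp only [heatIntegral, intervalIntegral.integral_of_le ht, integral_smul]
  rw [e1, integral_integral_swap hint, intervalIntegral.integral_of_le ht]
  refine setIntegral_congr_fun measurableSet_Ioc fun τ hτ => ?_
  exact congrFun (hp.conv_conv hδ hτ.1 (by linarith [hτ.2]) (hf.stronglyMeasurable τ)
    (hf.bound τ)) x

/-- Restarting the Duhamel integral at time `r`. -/
lemma duhamel_add (hp : HeatFamily α c T p) (hf : IsSource f M) {r δ : ℝ} (hr : 0 ≤ r)
    (hδ : 0 < δ) (hrT : r + δ ≤ T) (x : 𝔼 d) :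
    duhamel p f (r + δ) x = kernelConv (p δ) (duhamel p f r) x +
      heatIntegral p (fun τ => f (r + δ - τ)) δ x := by
  have hI := hp.intervalIntegrable_conv (hf.comp_sub (r + δ)) (by linarith : 0 ≤ r + δ) hrT x
  have s1 : uIcc 0 δ ⊆ uIcc 0 (r + δ) := by
    rw [uIcc_of_le hδ.le, uIcc_of_le (by linarith)]
    exact Icc_subset_Icc_right (by linarith)
  have s2 : uIcc δ (r + δ) ⊆ uIcc 0 (r + δ) := by
    rw [uIcc_of_le (by linarith), uIcc_of_le (by linarith)]
    exact Icc_subset_Icc_left hδ.le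
  rw [duhamel, duhamel, hp.conv_heatIntegral (hf.comp_sub r) hδ hr (by linarith), heatIntegral,
    heatIntegral, ← intervalIntegral.integral_add_adjacent_intervals (hI.mono_set s1)
    (hI.mono_set s2), add_comm]
  congr 1
  have := intervalIntegral.integral_comp_add_left
    (fun τ => kernelConv (p τ) (f (r + δ - τ)) x) (a := 0) (b := r) δ
  rw [add_zero, add_comm δ r] at this
  rw [← this]
  simp only [add_comm r δ, add_sub_add_left_eq_sub]

end HeatFamily

end Duhamel

/-! ### Time continuity of the Duhamel integral and Schauder estimates -/

noncomputable section Schauder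

variable {d : ℕ}

local notation:max "𝔼" d:max => EuclideanSpace ℝ (Fin d)

namespace HeatFamily

variable {α c T : ℝ} {p : ℝ → 𝔼 d → ℝ} {f : ℝ → 𝔼 d → ℝ} {M t : ℝ}

/-- The source is only measurable in time, so shifting it in time is no use. Restarting at a time
`r` slightly before `t` writes both values as the semigroup applied to the same function, plus a
tail over a short interval. The former is continuous in time and the latter is small. -/
lemma eventually_duhamel_sub_le (hp : HeatFamily α c T p) (hα : 1 < α) (hf : IsSource f M)
    (ht : t ∈ Ioc 0 T) {ε : ℝ} (hε : 0 < ε) :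
    ∀ᶠ s in 𝓝[Ioc 0 T] t, ∀ x, ‖duhamel p f s x - duhamel p f t x‖ ≤ ε ∧
      ‖fderiv ℝ (duhamel p f s) x - fderiv ℝ (duhamel p f t) x‖ ≤ ε := by
  have hM := hf.nonneg
  have hc := hp.const_nonneg ht
  have hη : 0 < 1 - 1 / α := sub_pos.2 ((div_lt_one (by linarith)).2 hα)
  -- With `r = t - δ` and `s < t + δ` the tail has length at most `2δ`. The two tails take `ε/4`
  -- each and the semigroup part `ε/2`.
  obtain ⟨δ, hδ0, hδt, hδε⟩ : ∃ δ : ℝ, 0 < δ ∧ δ < t ∧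
      M * (2 * δ) + c * M * ((2 * δ) ^ (1 - 1 / α) / (1 - 1 / α)) < ε / 4 := by
    have hφ : Continuous fun δ : ℝ =>
        M * (2 * δ) + c * M * ((2 * δ) ^ (1 - 1 / α) / (1 - 1 / α)) := by
      have : Continuous fun δ : ℝ => (2 * δ) ^ (1 - 1 / α) :=
        (continuous_const.mul continuous_id).rpow_const fun _ => Or.inr hη.le
      fun_prop
    have h0 : Tendsto _ (𝓝[>] (0 : ℝ)) _ := (hφ.tendsto 0).mono_left nhdsWithin_le_nhds
    simp only [mul_zero, Real.zero_rpow hη.ne', zero_div, add_zero] at h0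
    have h1 := h0.eventually (gt_mem_nhds (show (0 : ℝ) < ε / 4 by linarith))
    have h2 : ∀ᶠ δ in 𝓝[>] (0 : ℝ), δ < t := mem_nhdsWithin_of_mem_nhds (gt_mem_nhds ht.1)
    obtain ⟨δ, ⟨h3, h4⟩, h5⟩ := ((h1.and h2).and self_mem_nhdsWithin).exists
    exact ⟨δ, h5, h4, h3⟩
  set r := t - δ with hr
  have hr0 : 0 ≤ r := by linarith
  have hrT : r ≤ T := by linarith [ht.2]
  have hWs : StronglyMeasurable (duhamel p f r) :=
    (hp.contDiff_heatIntegral hα (hf.comp_sub r) hr0 hrT).continuous.stronglyMeasurable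
  have hWb : ∀ x, ‖duhamel p f r x‖ ≤ M * r :=
    hp.norm_heatIntegral_le (hf.comp_sub r) hr0 hrT
  have key : ∀ s ∈ Ioc 0 T, r < s → s - r ≤ 2 * δ → ∀ x,
      ‖duhamel p f s x - kernelConv (p (s - r)) (duhamel p f r) x‖ ≤ ε / 4 ∧
      ‖fderiv ℝ (duhamel p f s) x -
        fderiv ℝ (kernelConv (p (s - r)) (duhamel p f r)) x‖ ≤ ε / 4 := by
    intro s hs hrs hsδ x
    have hsr : 0 < s - r := sub_pos.2 hrs
    have hsrT : s - r ≤ T := by linarith [hs.2]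
    have hg := hf.comp_sub s
    have e : duhamel p f s = fun x => kernelConv (p (s - r)) (duhamel p f r) x +
        heatIntegral p (fun τ => f (s - τ)) (s - r) x := by
      ext x
      have := hp.duhamel_add hf hr0 hsr (by linarith [hs.2]) x
      rwa [add_sub_cancel] at this
    have b1 := hp.norm_heatIntegral_le hg hsr.le hsrT x
    have b2 := hp.norm_fderiv_heatIntegral_le hα hg hsr.le hsrT x
    have hmono : (s - r) ^ (1 - 1 / α) ≤ (2 * δ) ^ (1 - 1 / α) :=
      Real.rpow_le_rpow hsr.le hsδ hη.le
    have n1 : 0 ≤ M * (2 * δ) := by positivity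
    have n2 : 0 ≤ c * M * ((2 * δ) ^ (1 - 1 / α) / (1 - 1 / α)) := by positivity
    refine ⟨?_, ?_⟩
    · rw [congrFun e x, add_sub_cancel_left]
      refine b1.trans ((mul_le_mul_of_nonneg_left hsδ hM).trans ?_)
      linarith
    · rw [e, fderiv_fun_add ((hp.contDiff_one_conv ⟨hsr, hsrT⟩ hWs hWb).differentiable
        one_ne_zero x) ((hp.contDiff_heatIntegral hα hg hsr.le hsrT).differentiable
        one_ne_zero x), add_sub_cancel_left]
      refine b2.trans (le_trans ?_ (by linarith :
        c * M * ((2 * δ) ^ (1 - 1 / α) / (1 - 1 / α)) ≤ ε / 4))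
      gcongr
  have hmap : Tendsto (fun s => s - r) (𝓝[Ioc 0 T] t) (𝓝[Ioc 0 T] δ) := by
    refine tendsto_nhdsWithin_iff.2 ⟨?_, ?_⟩
    · refine Tendsto.mono_left ?_ nhdsWithin_le_nhds
      have : Continuous fun s : ℝ => s - r := by fun_prop
      simpa [hr] using this.tendsto t
    · filter_upwards [self_mem_nhdsWithin, mem_nhdsWithin_of_mem_nhds
        (lt_mem_nhds (show r < t by linarith))] with s hs hs'
      exact ⟨sub_pos.2 hs', by linarith [hs.2]⟩
  have hδT : δ ∈ Ioc 0 T := ⟨hδ0, by linarith [ht.2]⟩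
  have hev := hmap.eventually (hp.eventually_norm_conv_sub_le hδT hWs hWb
    (show 0 < ε / 2 by linarith))
  filter_upwards [self_mem_nhdsWithin, hev, mem_nhdsWithin_of_mem_nhds
    (Ioo_mem_nhds (show r < t by linarith) (show t < t + δ by linarith))] with s hs hs1 hs2 x
  obtain ⟨k1, k2⟩ := key s hs hs2.1 (by linarith [hs2.2]) x
  obtain ⟨l1, l2⟩ := key t ht (by linarith) (by linarith) x
  obtain ⟨m1, m2⟩ := hs1 x
  rw [show t - r = δ by linarith] at l1 l2
  have tri : ∀ {G : Type} [NormedAddCommGroup G] (u v u' v' : G), ‖u - u'‖ ≤ ε / 4 →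
      ‖v - v'‖ ≤ ε / 4 → ‖u' - v'‖ ≤ ε / 2 → ‖u - v‖ ≤ ε := by
    intro G _ u v u' v' h1 h2 h3
    calc ‖u - v‖ = ‖(u - u') + (u' - v') - (v - v')‖ := by congr 1; abel
      _ ≤ ‖u - u'‖ + ‖u' - v'‖ + ‖v - v'‖ :=
          (norm_sub_le _ _).trans (add_le_add_left (norm_add_le _ _) _)
      _ ≤ ε := by linarith
  exact ⟨tri _ _ _ _ k1 l1 m1, tri _ _ _ _ k2 l2 m2⟩

/-- Makes singular weights at `τ`, `τ/2` and `τ/4` interchangeable; `64 = 4^3` covers all exponents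
up to `3`. -/
lemma rpow_neg_le_of_quarter_le {τ σ a : ℝ} (hτ : 0 < τ) (hσ : τ / 4 ≤ σ) (ha0 : 0 ≤ a)
    (ha : a ≤ 3) : σ ^ (-a) ≤ 64 * τ ^ (-a) := by
  have h4 : 0 < τ / 4 := by linarith
  calc σ ^ (-a) ≤ (τ / 4) ^ (-a) := Real.rpow_le_rpow_of_nonpos h4 hσ (by linarith)
    _ = 4 ^ a * τ ^ (-a) := by
        rw [Real.div_rpow hτ.le (by norm_num), Real.rpow_neg (by norm_num : (0 : ℝ) ≤ 4),
          div_inv_eq_mul, mul_comm]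
    _ ≤ 4 ^ (3 : ℝ) * τ ^ (-a) := by
        gcongr
        norm_num
    _ = 64 * τ ^ (-a) := by norm_num

/-- Bounds for derivatives up to order three of `P_τ f` from first order bounds near time `τ`. -/
lemma conv_higher_bounds (hp : HeatFamily α c T p) (hα : 1 < α) {τ : ℝ} (hτ : τ ∈ Ioc 0 T)
    {f : 𝔼 d → ℝ} (hf : StronglyMeasurable f) (hM : ∀ x, ‖f x‖ ≤ M) {N θ : ℝ} (hN : 0 ≤ N)
    (hθ : θ ∈ Icc (0 : ℝ) 1)
    (hB : ∀ σ ∈ Icc (τ / 4) τ, ∀ x,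
      ‖fderiv ℝ (kernelConv (p σ) f) x‖ ≤ N * σ ^ (-((1 - θ) / α))) (x x' : 𝔼 d) :
    ‖fderiv ℝ (kernelConv (p τ) f) x‖ ≤ 64 * (1 + c) ^ 2 * N * τ ^ (-((1 - θ) / α)) ∧
    ‖fderiv ℝ (fderiv ℝ (kernelConv (p τ) f)) x‖ ≤
      64 * (1 + c) ^ 2 * N * τ ^ (-((2 - θ) / α)) ∧
    ‖fderiv ℝ (kernelConv (p τ) f) x - fderiv ℝ (kernelConv (p τ) f) x'‖ ≤
      64 * (1 + c) ^ 2 * N * τ ^ (-((2 - θ) / α)) * ‖x - x'‖ ∧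
    ‖fderiv ℝ (fderiv ℝ (kernelConv (p τ) f)) x - fderiv ℝ (fderiv ℝ (kernelConv (p τ) f)) x'‖ ≤
      64 * (1 + c) ^ 2 * N * τ ^ (-((3 - θ) / α)) * ‖x - x'‖ := by
  have hα0 : 0 < α := by linarith
  have hτ0 := hτ.1
  have hc := hp.const_nonneg hτ
  -- The first derivative is taken at time `τ/2` by hypothesis. The remaining `τ/2` pays for one
  -- further derivative, or, split into two quarters, for two.
  have h2 : τ / 2 ∈ Ioc 0 T := ⟨by linarith, by linarith [hτ.2]⟩
  have h4 : τ / 2 / 2 ∈ Ioc 0 T := ⟨by linarith, by linarith [hτ.2]⟩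
  set h := fderiv ℝ (kernelConv (p (τ / 2)) f) with hh
  have hhc : StronglyMeasurable h :=
    ((hp.contDiff_one_conv h2 hf hM).continuous_fderiv one_ne_zero).stronglyMeasurable
  have hhb : ∀ x, ‖h x‖ ≤ N * (τ / 2) ^ (-((1 - θ) / α)) :=
    hB (τ / 2) ⟨by linarith, by linarith⟩
  have e1 : fderiv ℝ (kernelConv (p τ) f) = kernelConv (p (τ / 2)) h :=
    hp.fderiv_conv_half hτ hf hM
  set k := fderiv ℝ (kernelConv (p (τ / 2 / 2)) h) with hk
  have hkc : StronglyMeasurable k :=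
    ((hp.contDiff_one_conv h4 hhc hhb).continuous_fderiv one_ne_zero).stronglyMeasurable
  have hkb := hp.norm_fderiv_conv_le h4 hhc hhb
  have e2 : fderiv ℝ (kernelConv (p (τ / 2)) h) = kernelConv (p (τ / 2 / 2)) k :=
    hp.fderiv_conv_half h2 hhc hhb
  have c1 : ∀ {s : ℝ}, 1 ≤ s → s ≤ 3 → 0 ≤ (s - θ) / α := fun hs _ =>
    div_nonneg (by linarith [hθ.2]) hα0.le
  have c2 : ∀ {s : ℝ}, 1 ≤ s → s ≤ 3 → (s - θ) / α ≤ 3 := fun hs hs3 =>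
    (div_le_iff₀ hα0).2 (by nlinarith [hθ.1])
  have hK : (1 : ℝ) ≤ (1 + c) ^ 2 := one_le_pow₀ (by linarith)
  have hcK : c ≤ (1 + c) ^ 2 := by nlinarith
  have hcK2 : c ^ 2 ≤ (1 + c) ^ 2 := by nlinarith
  have r2 : (τ / 2) ^ (-(1 / α)) * (τ / 2) ^ (-((1 - θ) / α)) = (τ / 2) ^ (-((2 - θ) / α)) := by
    rw [← Real.rpow_add h2.1]
    congr 1
    ring
  have r3 : (τ / 2 / 2) ^ (-(1 / α)) * ((τ / 2 / 2) ^ (-(1 / α)) * (τ / 2) ^ (-((1 - θ) / α))) ≤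
      64 * τ ^ (-((3 - θ) / α)) := by
    have : (τ / 2) ^ (-((1 - θ) / α)) ≤ (τ / 2 / 2) ^ (-((1 - θ) / α)) :=
      Real.rpow_le_rpow_of_nonpos h4.1 (by linarith) (neg_nonpos.2 (c1 le_rfl (by norm_num)))
    have n1 := Real.rpow_nonneg h4.1.le (-(1 / α))
    calc _ ≤ (τ / 2 / 2) ^ (-(1 / α)) *
          ((τ / 2 / 2) ^ (-(1 / α)) * (τ / 2 / 2) ^ (-((1 - θ) / α))) := by gcongr
      _ = (τ / 2 / 2) ^ (-((3 - θ) / α)) := by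
          rw [← Real.rpow_add h4.1, ← Real.rpow_add h4.1]
          congr 1
          ring
      _ ≤ _ := rpow_neg_le_of_quarter_le hτ0 (by linarith) (c1 (by norm_num) le_rfl)
          (c2 (by norm_num) le_rfl)
  have q1 := Real.rpow_nonneg hτ0.le (-((1 - θ) / α))
  have q2 := Real.rpow_nonneg hτ0.le (-((2 - θ) / α))
  have q3 := Real.rpow_nonneg hτ0.le (-((3 - θ) / α))
  have b2 : c * (τ / 2) ^ (-(1 / α)) * (N * (τ / 2) ^ (-((1 - θ) / α))) ≤
      64 * (1 + c) ^ 2 * N * τ ^ (-((2 - θ) / α)) := by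
    have l := rpow_neg_le_of_quarter_le (σ := τ / 2) hτ0 (by linarith)
      (c1 (s := 2) (by norm_num) (by norm_num)) (c2 (by norm_num) (by norm_num))
    calc _ = c * N * (τ / 2) ^ (-((2 - θ) / α)) := by rw [← r2]; ring
      _ ≤ (1 + c) ^ 2 * N * (64 * τ ^ (-((2 - θ) / α))) := by gcongr
      _ = _ := by ring
  have b3 : c * (τ / 2 / 2) ^ (-(1 / α)) *
      (c * (τ / 2 / 2) ^ (-(1 / α)) * (N * (τ / 2) ^ (-((1 - θ) / α)))) ≤
      64 * (1 + c) ^ 2 * N * τ ^ (-((3 - θ) / α)) := by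
    calc _ = c ^ 2 * N * ((τ / 2 / 2) ^ (-(1 / α)) *
          ((τ / 2 / 2) ^ (-(1 / α)) * (τ / 2) ^ (-((1 - θ) / α)))) := by ring
      _ ≤ (1 + c) ^ 2 * N * (64 * τ ^ (-((3 - θ) / α))) := by gcongr
      _ = _ := by ring
  refine ⟨?_, ?_, ?_, ?_⟩
  · refine (hB τ ⟨by linarith, le_rfl⟩ x).trans ?_
    have : N ≤ 64 * (1 + c) ^ 2 * N := by nlinarith
    gcongr
  · rw [e1]
    exact (hp.norm_fderiv_conv_le h2 hhc hhb x).trans b2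
  · rw [e1]
    exact (hp.norm_conv_sub_le h2 hhc hhb x x').trans (by gcongr)
  · rw [e1, e2]
    exact (hp.norm_conv_sub_le h4 hkc hkb x x').trans (by gcongr)

variable {N θ : ℝ}

/-- Schauder estimate below order two. -/
lemma heatIntegral_schauder_one (hp : HeatFamily α c T p) (hα : 1 < α) (hf : IsSource f M)
    (ht : 0 < t) (htT : t ≤ T) (hN : 0 ≤ N) (hθ : θ ∈ Icc (0 : ℝ) 1) (hαθ : α + θ < 2)
    (hB : ∀ τ ∈ Ioc 0 t, ∀ σ ∈ Icc (τ / 4) τ, ∀ x,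
      ‖fderiv ℝ (kernelConv (p σ) (f τ)) x‖ ≤ N * σ ^ (-((1 - θ) / α))) :
    ∃ C : ℝ, ∀ x x', ‖fderiv ℝ (heatIntegral p f t) x - fderiv ℝ (heatIntegral p f t) x'‖ ≤
      C * ‖x - x'‖ ^ (α + θ - 1) := by
  have hα0 : 0 < α := by linarith
  have hc := hp.const_nonneg ⟨ht, htT⟩
  -- The gradient rate is integrable at `0`; the rate of the second derivative is not, exactly
  -- because `α + θ < 2`.
  have ha : (1 - θ) / α < 1 := (div_lt_one hα0).2 (by linarith [hθ.1])
  have hb : 1 < (2 - θ) / α := (one_lt_div hα0).2 (by linarith)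
  obtain ⟨h1, h2⟩ := hp.hasFDerivAt_heatIntegral hα hf ht.le htT
  refine ⟨64 * (1 + c) ^ 2 * N * (2 / (1 - (1 - θ) / α) + 1 / ((2 - θ) / α - 1)),
    fun x x' => ?_⟩
  rcases eq_or_ne x x' with rfl | hx
  · rw [sub_self, sub_self, norm_zero, norm_zero, Real.zero_rpow (by linarith [hθ.1]), mul_zero]
  have hB' := fun τ (hτ : τ ∈ Ioc 0 t) => hp.conv_higher_bounds hα ⟨hτ.1, hτ.2.trans htT⟩
    (hf.stronglyMeasurable τ) (hf.bound τ) hN hθ (hB τ hτ)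
  rw [(h2 x).fderiv, (h2 x').fderiv, ← intervalIntegral.integral_sub (h1 x) (h1 x')]
  have := norm_timeIntegral_le_of_min (K := 64 * (1 + c) ^ 2 * N) (r := ‖x - x'‖) ht.le ha hb
    (by positivity) (norm_pos_iff.2 (sub_ne_zero.2 hx)) ((h1 x).sub (h1 x'))
    (fun τ hτ => (norm_sub_le _ _).trans (by
      linarith [(hB' τ hτ x x).1, (hB' τ hτ x' x').1])) (fun τ hτ => by
      linarith [(hB' τ hτ x x').2.2.1])
  rwa [show (1 - (1 - θ) / α) / ((2 - θ) / α - (1 - θ) / α) = α + θ - 1 by field_simp; ring]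
    at this

/-- Schauder estimate above order two. -/
lemma heatIntegral_schauder_two (hp : HeatFamily α c T p) (hα : 1 < α) (hf : IsSource f M)
    (ht : 0 < t) (htT : t ≤ T) (hN : 0 ≤ N) (hθ : θ ∈ Icc (0 : ℝ) 1) (hαθ : 2 < α + θ)
    (hαθ3 : α + θ < 3)
    (hB : ∀ τ ∈ Ioc 0 t, ∀ σ ∈ Icc (τ / 4) τ, ∀ x,
      ‖fderiv ℝ (kernelConv (p σ) (f τ)) x‖ ≤ N * σ ^ (-((1 - θ) / α))) :
    Differentiable ℝ (fderiv ℝ (heatIntegral p f t)) ∧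
    (∀ x, ‖fderiv ℝ (fderiv ℝ (heatIntegral p f t)) x‖ ≤
      64 * (1 + c) ^ 2 * N * (t ^ (1 - (2 - θ) / α) / (1 - (2 - θ) / α))) ∧
    ∃ C : ℝ, ∀ x x', ‖fderiv ℝ (fderiv ℝ (heatIntegral p f t)) x -
      fderiv ℝ (fderiv ℝ (heatIntegral p f t)) x'‖ ≤ C * ‖x - x'‖ ^ (α + θ - 2) := by
  have hα0 : 0 < α := by linarith
  have hc := hp.const_nonneg ⟨ht, htT⟩
  -- The same dichotomy one order higher: `α + θ > 2` makes the second derivative integrable, `α + θ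
  -- < 3` makes the third one not.
  have ha : (2 - θ) / α < 1 := (div_lt_one hα0).2 (by linarith)
  have hb : 1 < (3 - θ) / α := (one_lt_div hα0).2 (by linarith)
  obtain ⟨h1, h2⟩ := hp.hasFDerivAt_heatIntegral hα hf ht.le htT
  have hB' := fun τ (hτ : τ ∈ Ioc 0 t) => hp.conv_higher_bounds hα ⟨hτ.1, hτ.2.trans htT⟩
    (hf.stronglyMeasurable τ) (hf.bound τ) hN hθ (hB τ hτ)
  obtain ⟨g1, g2⟩ := hasFDerivAt_timeIntegral ht.le
    (g := fun τ => fderiv ℝ (kernelConv (p τ) (f τ)))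
    (b := fun τ => 64 * (1 + c) ^ 2 * N * τ ^ (-((2 - θ) / α))) h1
    (fun τ hτ => (contDiff_succ_iff_fderiv.1 (hp.contDiff_conv 2 ⟨hτ.1, hτ.2.trans htT⟩
      (hf.stronglyMeasurable τ) (hf.bound τ) : ContDiff ℝ (1 + 1) _)).2.2.differentiable
        one_ne_zero)
    ((intervalIntegrable_rpow_neg ha _ _).const_mul _) (fun τ hτ x => (hB' τ hτ x x).2.1)
  rw [funext fun x => (h2 x).fderiv]
  refine ⟨fun x => (g2 x).differentiableAt, fun x => ?_,
    64 * (1 + c) ^ 2 * N * (2 / (1 - (2 - θ) / α) + 1 / ((3 - θ) / α - 1)), fun x x' => ?_⟩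
  · rw [(g2 x).fderiv]
    exact norm_timeIntegral_le_rpow ht.le ha fun τ hτ => (hB' τ hτ x x).2.1
  · rcases eq_or_ne x x' with rfl | hx
    · rw [sub_self, sub_self, norm_zero (E := 𝔼 d), Real.zero_rpow (by linarith), mul_zero]
      exact (norm_zero (E := 𝔼 d →L[ℝ] 𝔼 d →L[ℝ] ℝ)).le
    rw [(g2 x).fderiv, (g2 x').fderiv, ← intervalIntegral.integral_sub (g1 x) (g1 x')]
    have := norm_timeIntegral_le_of_min (K := 64 * (1 + c) ^ 2 * N) (r := ‖x - x'‖) ht.le ha hb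
      (by positivity) (norm_pos_iff.2 (sub_ne_zero.2 hx)) ((g1 x).sub (g1 x'))
      (fun τ hτ => (norm_sub_le _ _).trans (by
        linarith [(hB' τ hτ x x).2.1, (hB' τ hτ x' x').2.1])) (fun τ hτ => by
        linarith [(hB' τ hτ x x').2.2.2])
    rwa [show (1 - (2 - θ) / α) / ((3 - θ) / α - (2 - θ) / α) = α + θ - 2 by field_simp; ring]
      at this

end HeatFamily

end Schauder

/-! ### Translating between extended norms and pointwise bounds -/

noncomputable section FunctionSpaces

variable {d : ℕ} {F : Type} [NormedAddCommGroup F] [NormedSpace ℝ F]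

local notation:max "𝔼" d:max => EuclideanSpace ℝ (Fin d)

lemma supNorm_congr {X G G' : Type*} [NormedAddCommGroup G] [NormedAddCommGroup G'] {f : X → G}
    {g : X → G'} (h : ∀ x, ‖f x‖ = ‖g x‖) : supNorm f = supNorm g := by
  simp only [supNorm, ← ofReal_norm, h]

lemma supNorm_le_ofReal {X G : Type*} [NormedAddCommGroup G] {f : X → G} {M : ℝ}
    (h : ∀ x, ‖f x‖ ≤ M) : supNorm f ≤ ENNReal.ofReal M :=
  iSup_le fun x => by
    rw [← ofReal_norm]
    exact ENNReal.ofReal_le_ofReal (h x)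

lemma norm_le_toReal_supNorm {X G : Type*} [NormedAddCommGroup G] {f : X → G}
    (h : supNorm f ≠ ⊤) (x : X) : ‖f x‖ ≤ (supNorm f).toReal := by
  rw [← ENNReal.ofReal_le_iff_le_toReal h, ofReal_norm]
  exact le_iSup (fun x => ‖f x‖ₑ) x

lemma norm_le_of_supNorm_le {X G : Type*} [NormedAddCommGroup G] {f : X → G} {M : ℝ}
    (hM : 0 ≤ M) (h : supNorm f ≤ ENNReal.ofReal M) (x : X) : ‖f x‖ ≤ M :=
  (norm_le_toReal_supNorm (h.trans_lt ENNReal.ofReal_lt_top).ne x).trans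
    (ENNReal.toReal_le_of_le_ofReal hM h)

lemma cbNorm_one (f : 𝔼 d → ℝ) : cbNorm 1 f = supNorm f + supNorm (fderiv ℝ f) := by
  simp only [cbNorm, Finset.sum_range_succ, Finset.sum_range_zero, zero_add]
  congr 1
  · exact supNorm_congr fun x => norm_iteratedFDeriv_zero
  · exact supNorm_congr fun x => by rw [norm_iteratedFDeriv_one]

lemma cbNorm_two (f : 𝔼 d → ℝ) :
    cbNorm 2 f = cbNorm 1 f + supNorm (fderiv ℝ (fderiv ℝ f)) := by
  rw [cbNorm, Finset.sum_range_succ, ← cbNorm]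
  congr 1
  exact supNorm_congr fun x => by rw [← norm_iteratedFDeriv_fderiv, norm_iteratedFDeriv_one]

/-- Currying is a linear isometry. This transfers Hölder bounds proved for nested `fderiv` to the
multilinear derivatives in `holderNorm`. -/
lemma norm_iteratedFDeriv_succ_sub (n : ℕ) (f : 𝔼 d → F) (x y : 𝔼 d) :
    ‖iteratedFDeriv ℝ (n + 1) f x - iteratedFDeriv ℝ (n + 1) f y‖ =
      ‖iteratedFDeriv ℝ n (fderiv ℝ f) x - iteratedFDeriv ℝ n (fderiv ℝ f) y‖ := by
  have key : ∀ x, (continuousMultilinearCurryRightEquiv' ℝ n (𝔼 d) F) (iteratedFDeriv ℝ (n + 1) f x) = iteratedFDeriv ℝ n (fderiv ℝ f) x := fun x => by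
    rw [iteratedFDeriv_succ_eq_comp_right]
    exact LinearIsometryEquiv.apply_symm_apply _ _
  rw [← key x, ← key y]
  generalize iteratedFDeriv ℝ (n + 1) f x = a
  generalize iteratedFDeriv ℝ (n + 1) f y = b
  generalize continuousMultilinearCurryRightEquiv' ℝ n (𝔼 d) F = e
  have := e.norm_map (a - b)
  rw [e.map_sub] at this
  exact this.symm

lemma norm_iteratedFDeriv_zero_sub (f : 𝔼 d → F) (x y : 𝔼 d) :
    ‖iteratedFDeriv ℝ 0 f x - iteratedFDeriv ℝ 0 f y‖ = ‖f x - f y‖ := by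
  rw [iteratedFDeriv_zero_eq_comp, Function.comp_apply, Function.comp_apply, ← map_sub,
    LinearIsometryEquiv.norm_map]

lemma norm_iteratedFDeriv_one_sub (f : 𝔼 d → F) (x y : 𝔼 d) :
    ‖iteratedFDeriv ℝ 1 f x - iteratedFDeriv ℝ 1 f y‖ = ‖fderiv ℝ f x - fderiv ℝ f y‖ := by
  rw [← norm_iteratedFDeriv_zero_sub (fderiv ℝ f)]
  exact norm_iteratedFDeriv_succ_sub 0 f x y

lemma norm_iteratedFDeriv_two_sub (f : 𝔼 d → F) (x y : 𝔼 d) :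
    ‖iteratedFDeriv ℝ 2 f x - iteratedFDeriv ℝ 2 f y‖ =
      ‖fderiv ℝ (fderiv ℝ f) x - fderiv ℝ (fderiv ℝ f) y‖ := by
  rw [← norm_iteratedFDeriv_one_sub (fderiv ℝ f)]
  exact norm_iteratedFDeriv_succ_sub 1 f x y

lemma eHolderNorm_le_ofReal {G : Type*} [NormedAddCommGroup G] {f : 𝔼 d → G} {N σ : ℝ}
    (hσ : 0 ≤ σ) (h : ∀ x y, ‖f x - f y‖ ≤ N * ‖x - y‖ ^ σ) :
    eHolderNorm σ.toNNReal f ≤ ENNReal.ofReal N := by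
  refine HolderWith.eHolderNorm_le fun x y => ?_
  rw [edist_dist, edist_dist, dist_eq_norm, dist_eq_norm, Real.coe_toNNReal _ hσ,
    ENNReal.ofReal_rpow_of_nonneg (norm_nonneg _) hσ]
  change _ ≤ ENNReal.ofReal N * _
  rw [← ENNReal.ofReal_mul' (Real.rpow_nonneg (norm_nonneg _) _)]
  exact ENNReal.ofReal_le_ofReal (h x y)

lemma norm_sub_le_of_eHolderNorm_ne_top {G : Type*} [NormedAddCommGroup G] {f : 𝔼 d → G}
    {σ : ℝ} (hσ : 0 ≤ σ) (h : eHolderNorm σ.toNNReal f ≠ ⊤) (x y : 𝔼 d) :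
    ‖f x - f y‖ ≤ (eHolderNorm σ.toNNReal f).toReal * ‖x - y‖ ^ σ := by
  have := (eHolderNorm_ne_top.1 h).holderWith x y
  rw [edist_dist, edist_dist, dist_eq_norm, dist_eq_norm, Real.coe_toNNReal _ hσ,
    ENNReal.ofReal_rpow_of_nonneg (norm_nonneg _) hσ, nnHolderNorm,
    ENNReal.coe_toNNReal h, ← ENNReal.ofReal_toReal h,
    ← ENNReal.ofReal_mul ENNReal.toReal_nonneg] at this
  exact (ENNReal.ofReal_le_ofReal_iff (by positivity)).1 this

lemma norm_sub_le_of_eHolderNorm_le {G : Type*} [NormedAddCommGroup G] {f : 𝔼 d → G}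
    {σ N : ℝ} (hσ : 0 ≤ σ) (hN : 0 ≤ N) (h : eHolderNorm σ.toNNReal f ≤ ENNReal.ofReal N)
    (x y : 𝔼 d) : ‖f x - f y‖ ≤ N * ‖x - y‖ ^ σ := by
  refine (norm_sub_le_of_eHolderNorm_ne_top hσ (h.trans_lt ENNReal.ofReal_lt_top).ne x y).trans ?_
  gcongr
  exact ENNReal.toReal_le_of_le_ofReal hN h

lemma cbNorm_one_le {f : 𝔼 d → ℝ} {A B : ℝ} (hA : ∀ x, ‖f x‖ ≤ A)
    (hB : ∀ x, ‖fderiv ℝ f x‖ ≤ B) : cbNorm 1 f ≤ ENNReal.ofReal (A + B) := by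
  rw [cbNorm_one, ENNReal.ofReal_add ((norm_nonneg _).trans (hA 0)) ((norm_nonneg _).trans (hB 0))]
  exact add_le_add (supNorm_le_ofReal hA) (supNorm_le_ofReal hB)

lemma memCb_one_of_bounds {f : 𝔼 d → ℝ} (hf : ContDiff ℝ 1 f) {A B : ℝ} (hA : ∀ x, ‖f x‖ ≤ A)
    (hB : ∀ x, ‖fderiv ℝ f x‖ ≤ B) : MemCb 1 f :=
  ⟨hf, (cbNorm_one_le hA hB).trans_lt ENNReal.ofReal_lt_top⟩

lemma exists_bounds_of_cbNorm_one {f : 𝔼 d → ℝ} (hf : cbNorm 1 f < ⊤) :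
    ∃ A B : ℝ, 0 ≤ A ∧ 0 ≤ B ∧ (∀ x, ‖f x‖ ≤ A) ∧ (∀ x, ‖fderiv ℝ f x‖ ≤ B) ∧
      cbNorm 1 f = ENNReal.ofReal (A + B) := by
  rw [cbNorm_one] at hf ⊢
  obtain ⟨h1, h2⟩ := ENNReal.add_lt_top.1 hf
  refine ⟨_, _, ENNReal.toReal_nonneg, ENNReal.toReal_nonneg, norm_le_toReal_supNorm h1.ne,
    norm_le_toReal_supNorm h2.ne, ?_⟩
  rw [ENNReal.ofReal_add ENNReal.toReal_nonneg ENNReal.toReal_nonneg,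
    ENNReal.ofReal_toReal h1.ne, ENNReal.ofReal_toReal h2.ne]

lemma floor_fract_of_mem {γ : ℝ} {n : ℕ} (h : γ ∈ Ico (n : ℝ) (n + 1)) :
    ⌊γ⌋₊ = n ∧ Int.fract γ = γ - n := by
  have h0 : 0 ≤ γ := (Nat.cast_nonneg n).trans h.1
  have h1 : ⌊γ⌋₊ = n := (Nat.floor_eq_iff h0).2 ⟨h.1, h.2⟩
  refine ⟨h1, ?_⟩
  have h2 : (⌊γ⌋ : ℝ) = n := by rw [← natCast_floor_eq_intCast_floor h0, h1]
  rw [Int.fract, h2]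

lemma holderNorm_of_mem_Ioo {γ : ℝ} {n : ℕ} (h : γ ∈ Ioo (n : ℝ) (n + 1)) (f : 𝔼 d → ℝ) :
    holderNorm γ f = cbNorm n f + eHolderNorm (γ - n).toNNReal (iteratedFDeriv ℝ n f) := by
  obtain ⟨h1, h2⟩ := floor_fract_of_mem ⟨h.1.le, h.2⟩
  rw [holderNorm, h1, h2, if_neg (sub_pos.2 h.1).ne']

lemma holderNorm_two (f : 𝔼 d → ℝ) : holderNorm 2 f = cbNorm 2 f := by
  obtain ⟨h1, h2⟩ := floor_fract_of_mem (γ := 2) (n := 2) (by norm_num)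
  rw [holderNorm, h1, h2]
  simp

lemma memHolderSpace_one_lt_two {γ : ℝ} (h1 : 1 < γ) (h2 : γ < 2) {f : 𝔼 d → ℝ}
    (hf : ContDiff ℝ 1 f) {A B N : ℝ} (hN0 : 0 ≤ N) (hA : ∀ x, ‖f x‖ ≤ A)
    (hB : ∀ x, ‖fderiv ℝ f x‖ ≤ B)
    (hN : ∀ x y, ‖fderiv ℝ f x - fderiv ℝ f y‖ ≤ N * ‖x - y‖ ^ (γ - 1)) :
    MemHolderSpace γ f ∧ holderNorm γ f ≤ ENNReal.ofReal (A + B + N) := by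
  have hγ : γ ∈ Ioo ((1 : ℕ) : ℝ) ((1 : ℕ) + 1) := by
    push_cast
    exact ⟨h1, by linarith⟩
  have hle : holderNorm γ f ≤ ENNReal.ofReal (A + B + N) := by
    rw [holderNorm_of_mem_Ioo hγ, ENNReal.ofReal_add (add_nonneg ((norm_nonneg _).trans (hA 0))
      ((norm_nonneg _).trans (hB 0))) hN0]
    refine add_le_add (cbNorm_one_le hA hB) (eHolderNorm_le_ofReal ?_ fun x y => ?_)
    · simpa using h1.le
    · simpa [norm_iteratedFDeriv_one_sub] using hN x y
  refine ⟨⟨?_, hle.trans_lt ENNReal.ofReal_lt_top⟩, hle⟩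
  rw [(floor_fract_of_mem ⟨hγ.1.le, hγ.2⟩).1]
  exact hf

lemma memHolderSpace_two {f : 𝔼 d → ℝ} (hf : ContDiff ℝ 2 f) {A B N : ℝ}
    (hA : ∀ x, ‖f x‖ ≤ A) (hB : ∀ x, ‖fderiv ℝ f x‖ ≤ B)
    (hN : ∀ x, ‖fderiv ℝ (fderiv ℝ f) x‖ ≤ N) :
    MemHolderSpace 2 f ∧ holderNorm 2 f ≤ ENNReal.ofReal (A + B + N) := by
  have hle : holderNorm 2 f ≤ ENNReal.ofReal (A + B + N) := by
    rw [holderNorm_two, cbNorm_two, ENNReal.ofReal_add (add_nonneg ((norm_nonneg _).trans (hA 0))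
      ((norm_nonneg _).trans (hB 0)))
      ((norm_nonneg (fderiv ℝ (fderiv ℝ f) 0)).trans (hN 0))]
    exact add_le_add (cbNorm_one_le hA hB) (supNorm_le_ofReal hN)
  refine ⟨⟨?_, hle.trans_lt ENNReal.ofReal_lt_top⟩, hle⟩
  rw [(floor_fract_of_mem (γ := 2) (n := 2) (by norm_num)).1]
  exact hf

lemma memHolderSpace_two_lt_three {γ : ℝ} (h1 : 2 < γ) (h2 : γ < 3) {f : 𝔼 d → ℝ}
    (hf : ContDiff ℝ 2 f) {A B B' N : ℝ} (hA : ∀ x, ‖f x‖ ≤ A) (hB : ∀ x, ‖fderiv ℝ f x‖ ≤ B)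
    (hB' : ∀ x, ‖fderiv ℝ (fderiv ℝ f) x‖ ≤ B')
    (hN : ∀ x y, ‖fderiv ℝ (fderiv ℝ f) x - fderiv ℝ (fderiv ℝ f) y‖ ≤ N * ‖x - y‖ ^ (γ - 2)) :
    MemHolderSpace γ f := by
  have hγ : γ ∈ Ioo ((2 : ℕ) : ℝ) ((2 : ℕ) + 1) := by
    push_cast
    exact ⟨h1, by linarith⟩
  refine ⟨?_, ?_⟩
  · rw [(floor_fract_of_mem ⟨hγ.1.le, hγ.2⟩).1]
    exact hf
  · rw [holderNorm_of_mem_Ioo hγ, cbNorm_two]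
    refine ENNReal.add_lt_top.2 ⟨ENNReal.add_lt_top.2
      ⟨(cbNorm_one_le hA hB).trans_lt ENNReal.ofReal_lt_top,
        (supNorm_le_ofReal hB').trans_lt ENNReal.ofReal_lt_top⟩,
      lt_of_le_of_lt (eHolderNorm_le_ofReal (N := N) ?_ fun x y => ?_) ENNReal.ofReal_lt_top⟩
    · simpa using h1.le
    · rw [norm_iteratedFDeriv_two_sub]
      exact_mod_cast hN x y

lemma norm_sub_le_of_norm_fderiv_le {f : 𝔼 d → F} (hf : Differentiable ℝ f) {B : ℝ}
    (hB : ∀ x, ‖fderiv ℝ f x‖ ≤ B) (x y : 𝔼 d) : ‖f x - f y‖ ≤ B * ‖x - y‖ :=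
  Convex.norm_image_sub_le_of_norm_fderiv_le (𝕜 := ℝ) (fun z _ => hf z) (fun z _ => hB z)
    convex_univ (mem_univ _) (mem_univ _)

/-- Interpolation between a sup bound and a Lipschitz bound: `r ≤ r^σ` for `r ≤ 1`, and `1 ≤ r^σ`
for `r ≥ 1`. -/
lemma min_le_mul_rpow {A B r σ : ℝ} (hA : 0 ≤ A) (hB : 0 ≤ B) (hr : 0 ≤ r) (hσ0 : 0 ≤ σ)
    (hσ : σ ≤ 1) : min A (B * r) ≤ (A + B) * r ^ σ := by
  have := Real.rpow_nonneg hr σ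
  rcases le_total r 1 with h | h
  · refine (min_le_right _ _).trans ?_
    have : r ≤ r ^ σ := by
      rcases hr.eq_or_lt with rfl | h0
      · exact this
      · simpa using Real.rpow_le_rpow_of_exponent_ge h0 h hσ
    nlinarith
  · refine (min_le_left _ _).trans ?_
    have : 1 ≤ r ^ σ := Real.one_le_rpow h hσ0
    nlinarith

/-- A bounded Lipschitz function is Hölder continuous. -/
lemma norm_sub_le_mul_rpow {G : Type*} [NormedAddCommGroup G] {f : 𝔼 d → G} {A B σ : ℝ}
    (hA0 : 0 ≤ A) (hB0 : 0 ≤ B) (hA : ∀ x, ‖f x‖ ≤ A)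
    (hB : ∀ x y, ‖f x - f y‖ ≤ B * ‖x - y‖) (hσ0 : 0 ≤ σ) (hσ : σ ≤ 1) (x y : 𝔼 d) :
    ‖f x - f y‖ ≤ (2 * A + B) * ‖x - y‖ ^ σ :=
  (le_min ((norm_sub_le _ _).trans (by linarith [hA x, hA y])) (hB x y)).trans
    (min_le_mul_rpow (by positivity) hB0 (norm_nonneg _) hσ0 hσ)

lemma MemHolderSpace.contDiff_one {γ : ℝ} (hγ : 1 ≤ γ) {f : 𝔼 d → ℝ} (hf : MemHolderSpace γ f) :
    ContDiff ℝ 1 f :=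
  hf.1.of_le (by exact_mod_cast Nat.le_floor (by exact_mod_cast hγ))

/-- Treats `σ < 1` and `σ = 1` alike. For `σ = 1` the space is `C^2_b`, and the Lipschitz constant
of the gradient is bounded by the sup of the second derivative; the converse fails, since a
Lipschitz gradient need not be `C^1`. -/
lemma MemHolderSpace.exists_bounds {σ : ℝ} (hσ0 : 0 < σ) (hσ : σ ≤ 1) {f : 𝔼 d → ℝ}
    (hf : MemHolderSpace (1 + σ) f) :
    ∃ A B N : ℝ, 0 ≤ A ∧ 0 ≤ B ∧ 0 ≤ N ∧ (∀ x, ‖f x‖ ≤ A) ∧ (∀ x, ‖fderiv ℝ f x‖ ≤ B) ∧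
      (∀ x y, ‖fderiv ℝ f x - fderiv ℝ f y‖ ≤ N * ‖x - y‖ ^ σ) ∧
      holderNorm (1 + σ) f = ENNReal.ofReal (A + B + N) := by
  rcases hσ.lt_or_eq with h | rfl
  · have hγ : 1 + σ ∈ Ioo ((1 : ℕ) : ℝ) ((1 : ℕ) + 1) := by
      push_cast
      exact ⟨by linarith, by linarith⟩
    have h2 := hf.2
    have e := holderNorm_of_mem_Ioo hγ f
    rw [Nat.cast_one, add_sub_cancel_left] at e
    rw [e] at h2 ⊢
    obtain ⟨k1, k2⟩ := ENNReal.add_lt_top.1 h2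
    obtain ⟨A, B, hA0, hB0, hA, hB, hAB⟩ := exists_bounds_of_cbNorm_one k1
    refine ⟨A, B, (eHolderNorm σ.toNNReal (iteratedFDeriv ℝ 1 f)).toReal, hA0, hB0, ENNReal.toReal_nonneg, hA, hB, fun x y => ?_, ?_⟩
    · rw [← norm_iteratedFDeriv_one_sub]
      exact norm_sub_le_of_eHolderNorm_ne_top hσ0.le k2.ne x y
    · rw [hAB, ENNReal.ofReal_add (add_nonneg hA0 hB0) ENNReal.toReal_nonneg,
        ENNReal.ofReal_toReal k2.ne]
  · obtain ⟨hc, h2⟩ := hf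
    rw [one_add_one_eq_two] at *
    rw [(floor_fract_of_mem (γ := 2) (n := 2) (by norm_num)).1] at hc
    rw [holderNorm_two, cbNorm_two] at h2 ⊢
    obtain ⟨k1, k2⟩ := ENNReal.add_lt_top.1 h2
    obtain ⟨A, B, hA0, hB0, hA, hB, hAB⟩ := exists_bounds_of_cbNorm_one k1
    refine ⟨A, B, (supNorm (fderiv ℝ (fderiv ℝ f))).toReal, hA0, hB0, ENNReal.toReal_nonneg, hA, hB, fun x y => ?_, ?_⟩
    · rw [Real.rpow_one]
      have hc' : ContDiff ℝ (1 + 1) f := hc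
      exact norm_sub_le_of_norm_fderiv_le
        ((contDiff_succ_iff_fderiv.1 hc').2.2.differentiable one_ne_zero)
        (norm_le_toReal_supNorm k2.ne) x y
    · rw [hAB, ENNReal.ofReal_add (add_nonneg hA0 hB0) ENNReal.toReal_nonneg,
        ENNReal.ofReal_toReal k2.ne]

end FunctionSpaces

/-! ### The jump modulation is of lower order -/

noncomputable section JumpModulation

variable {d : ℕ}

local notation:max "𝔼" d:max => EuclideanSpace ℝ (Fin d)

variable {μ : Measure 𝔼 d} {j : 𝔼 d → 𝔼 d} {K : ℝ}

lemma IsLevyMeasure.integrable (hμ : IsLevyMeasure μ) :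
    Integrable (fun z => min 1 (‖z‖ ^ 2)) μ := by
  refine ⟨(by fun_prop : Measurable fun z : 𝔼 d => min 1 (‖z‖ ^ 2)).aestronglyMeasurable, ?_⟩
  rw [HasFiniteIntegral]
  refine lt_of_le_of_lt (lintegral_mono fun z => ?_) hμ
  rw [Real.enorm_of_nonneg (by positivity)]

/-- The mass `∫ (1 ∧ |z|²) dμ(z)` as a real number. -/
def levyMass (μ : Measure 𝔼 d) : ℝ := ∫ z, min 1 (‖z‖ ^ 2) ∂μ

lemma levyMass_nonneg (μ : Measure 𝔼 d) : 0 ≤ levyMass μ :=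
  integral_nonneg fun z => by positivity

lemma norm_integral_le_levyMass (hμ : IsLevyMeasure μ) {g : 𝔼 d → ℝ} {B : ℝ}
    (h : ∀ z, ‖g z‖ ≤ B * min 1 (‖z‖ ^ 2)) : ‖∫ z, g z ∂μ‖ ≤ B * levyMass μ := by
  rw [levyMass, ← integral_const_mul]
  exact norm_integral_le_of_norm_le (hμ.integrable.const_mul B) (Eventually.of_forall h)

/-- Small jumps: the mean value inequality over the distance `|j(z) - z| ≤ K|z|²`. Large jumps: the
sup norm. One derivative thus gives the Lévy-integrable majorant `1 ∧ |z|²`. -/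
lemma norm_jump_sub_le (hK0 : 0 ≤ K) (hK : ∀ z, ‖z‖ ≤ 1 → ‖j z - z‖ ≤ K * ‖z‖ ^ 2)
    {u : 𝔼 d → ℝ} (hu : Differentiable ℝ u) {A B : ℝ} (hA0 : 0 ≤ A) (hB0 : 0 ≤ B)
    (hA : ∀ x, ‖u x‖ ≤ A) (hB : ∀ x, ‖fderiv ℝ u x‖ ≤ B) (x z : 𝔼 d) :
    ‖u (x + j z) - u (x + z)‖ ≤ (2 * A + B * K) * min 1 (‖z‖ ^ 2) := by
  rcases le_total ‖z‖ 1 with h | h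
  · have h1 := norm_sub_le_of_norm_fderiv_le hu hB (x + j z) (x + z)
    rw [add_sub_add_left_eq_sub] at h1
    rw [min_eq_right (pow_le_one₀ (norm_nonneg _) h)]
    calc _ ≤ B * ‖j z - z‖ := h1
      _ ≤ B * (K * ‖z‖ ^ 2) := by gcongr; exact hK z h
      _ ≤ (2 * A + B * K) * ‖z‖ ^ 2 := by nlinarith [mul_nonneg hA0 (sq_nonneg ‖z‖)]
  · rw [min_eq_left (one_le_pow₀ h), mul_one]
    refine (norm_sub_le _ _).trans ?_
    nlinarith [hA (x + j z), hA (x + z), mul_nonneg hB0 hK0]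

lemma integrable_jump_sub (hμ : IsLevyMeasure μ) (hj : Measurable j) (hK0 : 0 ≤ K)
    (hK : ∀ z, ‖z‖ ≤ 1 → ‖j z - z‖ ≤ K * ‖z‖ ^ 2)
    {u : 𝔼 d → ℝ} (hu : MemCb 1 u) (x : 𝔼 d) :
    Integrable (fun z => u (x + j z) - u (x + z)) μ := by
  obtain ⟨A, B, hA0, hB0, hA, hB, -⟩ := exists_bounds_of_cbNorm_one hu.2
  have hc : Measurable u := hu.1.continuous.measurable
  refine (hμ.integrable.const_mul (2 * A + B * K)).mono' ?_
    (Eventually.of_forall fun z =>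
      norm_jump_sub_le hK0 hK (hu.1.differentiable one_ne_zero) hA0 hB0 hA hB x z)
  exact ((hc.comp (measurable_const.add hj)).sub
    (hc.comp (measurable_const.add measurable_id))).aestronglyMeasurable

lemma jumpModulation_sub (hμ : IsLevyMeasure μ) (hj : Measurable j) (hK0 : 0 ≤ K)
    (hK : ∀ z, ‖z‖ ≤ 1 → ‖j z - z‖ ≤ K * ‖z‖ ^ 2)
    {u v : 𝔼 d → ℝ} (hu : MemCb 1 u) (hv : MemCb 1 v) :
    jumpModulation μ j u - jumpModulation μ j v = jumpModulation μ j (u - v) := by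
  ext x
  rw [Pi.sub_apply, jumpModulation, jumpModulation, ← integral_sub
    (integrable_jump_sub hμ hj hK0 hK hu x) (integrable_jump_sub hμ hj hK0 hK hv x)]
  refine integral_congr_ae (Eventually.of_forall fun z => ?_)
  simp only [Pi.sub_apply]
  ring

lemma continuous_jumpModulation (hμ : IsLevyMeasure μ) (hj : Measurable j) (hK0 : 0 ≤ K)
    (hK : ∀ z, ‖z‖ ≤ 1 → ‖j z - z‖ ≤ K * ‖z‖ ^ 2) {u : 𝔼 d → ℝ} (hu : MemCb 1 u) :
    Continuous (jumpModulation μ j u) := by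
  obtain ⟨A, B, hA0, hB0, hA, hB, -⟩ := exists_bounds_of_cbNorm_one hu.2
  have hc : Continuous u := hu.1.continuous
  refine continuous_of_dominated (bound := fun z => (2 * A + B * K) * min 1 (‖z‖ ^ 2))
    (fun x => (integrable_jump_sub hμ hj hK0 hK hu x).1) (fun x => Eventually.of_forall fun z =>
      norm_jump_sub_le hK0 hK (hu.1.differentiable one_ne_zero) hA0 hB0 hA hB x z)
    (hμ.integrable.const_mul _) (Eventually.of_forall fun z => by fun_prop)

lemma supNorm_jumpModulation_le (hμ : IsLevyMeasure μ) (hK0 : 0 ≤ K)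
    (hK : ∀ z, ‖z‖ ≤ 1 → ‖j z - z‖ ≤ K * ‖z‖ ^ 2) {u : 𝔼 d → ℝ} (hu : Differentiable ℝ u)
    (hu1 : cbNorm 1 u < ⊤) :
    supNorm (jumpModulation μ j u) ≤
      ((4 + K) * levyMass μ).toNNReal * cbNorm 1 u := by
  obtain ⟨A, B, hA0, hB0, hA, hB, hAB⟩ := exists_bounds_of_cbNorm_one hu1
  have hm := levyMass_nonneg μ
  rw [hAB]
  change _ ≤ ENNReal.ofReal _ * _
  rw [← ENNReal.ofReal_mul (by positivity)]
  refine supNorm_le_ofReal fun x => ?_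
  refine (norm_integral_le_levyMass hμ fun z => norm_jump_sub_le hK0 hK hu hA0 hB0 hA hB x z).trans ?_
  have : 2 * A + B * K ≤ (4 + K) * (A + B) := by nlinarith [mul_nonneg hK0 hA0]
  nlinarith

/-- The mean value inequality for `z ↦ u(x+z) - u(x'+z)`, whose gradient is at most `N|x-x'|^σ`. -/
lemma norm_second_difference_le {u : 𝔼 d → ℝ} (hu : Differentiable ℝ u) {N σ : ℝ}
    (hN : ∀ x y, ‖fderiv ℝ u x - fderiv ℝ u y‖ ≤ N * ‖x - y‖ ^ σ) (x x' a b : 𝔼 d) :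
    ‖u (x + a) - u (x + b) - (u (x' + a) - u (x' + b))‖ ≤ N * ‖x - x'‖ ^ σ * ‖a - b‖ := by
  have hd : ∀ (y z : 𝔼 d), HasFDerivAt (fun z => u (y + z)) (fderiv ℝ u (y + z)) z := fun y z =>
    (hasFDerivAt_comp_add_left y).2 (hu (y + z)).hasFDerivAt
  have hw : ∀ z, HasFDerivAt (fun z => u (x + z) - u (x' + z))
      (fderiv ℝ u (x + z) - fderiv ℝ u (x' + z)) z := fun z => (hd x z).sub (hd x' z)
  have := norm_sub_le_of_norm_fderiv_le (f := fun z => u (x + z) - u (x' + z))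
    (fun z => (hw z).differentiableAt) (B := N * ‖x - x'‖ ^ σ) (fun z => by
      rw [(hw z).fderiv]
      simpa using hN (x + z) (x' + z)) a b
  rwa [sub_sub_sub_comm]

/-- The second difference is paired in two ways. For small `z` it is taken along `j(z) - z`, which
supplies `|z|²`; for large `z` along `x - x'`, using that `u` itself is Hölder. -/
lemma holder_jumpModulation_le (hμ : IsLevyMeasure μ) (hj : Measurable j) (hK0 : 0 ≤ K)
    (hK : ∀ z, ‖z‖ ≤ 1 → ‖j z - z‖ ≤ K * ‖z‖ ^ 2) {σ : ℝ} (hσ0 : 0 < σ) (hσ : σ ≤ 1)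
    {u : 𝔼 d → ℝ} (hu : MemHolderSpace (1 + σ) u) :
    eHolderNorm σ.toNNReal (jumpModulation μ j u) ≤
      ((4 + K) * levyMass μ).toNNReal * holderNorm (1 + σ) u := by
  obtain ⟨A, B, N, hA0, hB0, hN0, hA, hB, hN, e⟩ := hu.exists_bounds hσ0 hσ
  have hm := levyMass_nonneg μ
  have hc := hu.contDiff_one (by linarith)
  have hd := hc.differentiable one_ne_zero
  have hu1 := memCb_one_of_bounds hc hA hB
  rw [e]
  change _ ≤ ENNReal.ofReal _ * _
  rw [← ENNReal.ofReal_mul (by positivity)]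
  refine eHolderNorm_le_ofReal hσ0.le fun x x' => ?_
  rw [jumpModulation, jumpModulation, ← integral_sub (integrable_jump_sub hμ hj hK0 hK hu1 x)
    (integrable_jump_sub hμ hj hK0 hK hu1 x')]
  have hr := Real.rpow_nonneg (norm_nonneg (x - x')) σ
  refine (norm_integral_le_levyMass hμ (B := (4 + K) * (A + B + N) * ‖x - x'‖ ^ σ)
    fun z => ?_).trans_eq (by ring)
  rcases le_total ‖z‖ 1 with h | h
  · rw [min_eq_right (pow_le_one₀ (norm_nonneg _) h)]
    calc _ ≤ N * ‖x - x'‖ ^ σ * ‖j z - z‖ := norm_second_difference_le hd hN x x' (j z) z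
      _ ≤ N * ‖x - x'‖ ^ σ * (K * ‖z‖ ^ 2) := by gcongr; exact hK z h
      _ = K * N * (‖x - x'‖ ^ σ * ‖z‖ ^ 2) := by ring
      _ ≤ (4 + K) * (A + B + N) * (‖x - x'‖ ^ σ * ‖z‖ ^ 2) := by
          gcongr <;> linarith
      _ = _ := by ring
  · rw [min_eq_left (one_le_pow₀ h), mul_one]
    have hh : ∀ w, ‖u (x + w) - u (x' + w)‖ ≤ (2 * A + B) * ‖x - x'‖ ^ σ := fun w => by
      simpa using norm_sub_le_mul_rpow hA0 hB0 hA (norm_sub_le_of_norm_fderiv_le hd hB) hσ0.le hσ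
        (x + w) (x' + w)
    calc _ = ‖(u (x + j z) - u (x' + j z)) - (u (x + z) - u (x' + z))‖ := by congr 1; ring
      _ ≤ (2 * A + B) * ‖x - x'‖ ^ σ + (2 * A + B) * ‖x - x'‖ ^ σ :=
          (norm_sub_le _ _).trans (add_le_add (hh _) (hh _))
      _ = (2 * (2 * A + B)) * ‖x - x'‖ ^ σ := by ring
      _ ≤ _ := by
          refine mul_le_mul_of_nonneg_right ?_ hr
          nlinarith [mul_nonneg hK0 hA0, mul_nonneg hK0 hB0, mul_nonneg hK0 hN0]

lemma lowerOrderBounds_jumpModulation (hμ : IsLevyMeasure μ) (hj : Measurable j) (hK0 : 0 ≤ K)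
    (hK : ∀ z, ‖z‖ ≤ 1 → ‖j z - z‖ ≤ K * ‖z‖ ^ 2) {β : ℝ} (hβ : β ≤ 1) :
    LowerOrderBounds β ((4 + K) * levyMass μ).toNNReal (jumpModulation μ j) where
  measurable u hu := (continuous_jumpModulation hμ hj hK0 hK hu).measurable
  sup_bound u hu := supNorm_jumpModulation_le hμ hK0 hK (hu.1.differentiable one_ne_zero) hu.2
  lipschitz u v hu hv := by
    rw [jumpModulation_sub hμ hj hK0 hK hu hv]
    obtain ⟨A, B, hA0, hB0, hA, hB, -⟩ := exists_bounds_of_cbNorm_one hu.2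
    obtain ⟨A', B', hA0', hB0', hA', hB', -⟩ := exists_bounds_of_cbNorm_one hv.2
    have hdu := hu.1.differentiable one_ne_zero
    have hdv := hv.1.differentiable one_ne_zero
    refine supNorm_jumpModulation_le hμ hK0 hK (hdu.sub hdv)
      ((cbNorm_one_le (A := A + A') (B := B + B') (fun x => ?_) fun x => ?_).trans_lt
        ENNReal.ofReal_lt_top)
    · exact (norm_sub_le _ _).trans (add_le_add (hA x) (hA' x))
    · rw [fderiv_sub (hdu x) (hdv x)]
      exact (norm_sub_le _ _).trans (add_le_add (hB x) (hB' x))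
  holder_bound σ hσ0 hσ u hu := holder_jumpModulation_le hμ hj hK0 hK hσ0 (hσ.trans hβ) hu

lemma integrable_compensatedIncrement (hμ : IsLevyMeasure μ) {φ : 𝔼 d → ℝ} (hφ : MemCb 2 φ)
    (x : 𝔼 d) : Integrable (fun z => compensatedIncrement φ x (x + z) z) μ := by
  have h2 := hφ.2
  rw [cbNorm_two] at h2
  obtain ⟨k1, k2⟩ := ENNReal.add_lt_top.1 h2
  obtain ⟨A, B, hA0, hB0, hA, hB, -⟩ := exists_bounds_of_cbNorm_one k1
  set N := (supNorm (fderiv ℝ (fderiv ℝ φ))).toReal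
  have hN0 : 0 ≤ N := ENNReal.toReal_nonneg
  have hφ' : ContDiff ℝ (1 + 1) φ := hφ.1
  have hd : Differentiable ℝ φ := hφ.1.differentiable two_ne_zero
  have hL := norm_sub_le_of_norm_fderiv_le
    ((contDiff_succ_iff_fderiv.1 hφ').2.2.differentiable one_ne_zero) (norm_le_toReal_supNorm k2.ne)
  have hc : Measurable φ := hd.continuous.measurable
  refine (hμ.integrable.const_mul (2 * A + N)).mono' ?_ (Eventually.of_forall fun z => ?_)
  · refine Measurable.aestronglyMeasurable ?_
    unfold compensatedIncrement
    refine ((hc.comp (measurable_const.add measurable_id)).sub measurable_const).sub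
      (Measurable.ite (measurableSet_lt measurable_norm measurable_const) ?_ measurable_const)
    exact (fderiv ℝ φ x).continuous.measurable
  · rw [compensatedIncrement]
    split_ifs with h
    · rw [min_eq_right (pow_le_one₀ (norm_nonneg _) h.le)]
      have := Convex.norm_image_sub_le_of_norm_fderiv_le' (𝕜 := ℝ) (f := φ)
        (s := segment ℝ x (x + z)) (x := x) (y := x + z) (C := N * ‖z‖) (φ := fderiv ℝ φ x)
        (fun y _ => hd y) (fun y hy => (hL y x).trans ?_)
        (convex_segment _ _) (left_mem_segment _ _ _) (right_mem_segment _ _ _)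
      · rw [add_sub_cancel_left] at this
        refine this.trans ?_
        nlinarith [mul_nonneg hA0 (sq_nonneg ‖z‖)]
      · have : ‖y - x‖ ≤ ‖z‖ := by simpa using norm_sub_le_of_mem_segment hy
        gcongr
    · rw [min_eq_left (one_le_pow₀ (not_lt.1 h)), sub_zero, mul_one]
      refine (norm_sub_le _ _).trans ?_
      linarith [hA (x + z), hA x]

/-- The removed balls shrink to the origin, which `μ` may charge because `1 ∧ |z|²` vanishes there;
hence the condition on `h` at `0`. -/
lemma tendsto_setIntegral_compl_ball {h : 𝔼 d → ℝ} (hh : Integrable h μ) (h0 : h 0 = 0) :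
    Tendsto (fun ε : ℝ => ∫ z in (Metric.ball 0 ε)ᶜ, h z ∂μ) (𝓝[>] 0) (𝓝 (∫ z, h z ∂μ)) := by
  simp_rw [← integral_indicator Metric.isOpen_ball.measurableSet.compl]
  refine tendsto_integral_filter_of_dominated_convergence (fun z => ‖h z‖)
    (Eventually.of_forall fun ε => hh.1.indicator Metric.isOpen_ball.measurableSet.compl)
    (Eventually.of_forall fun ε => Eventually.of_forall fun z => norm_indicator_le_norm_self _ _)
    hh.norm (Eventually.of_forall fun z => ?_)
  refine tendsto_const_nhds.congr' ?_
  rcases eq_or_ne z 0 with rfl | hz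
  · refine Eventually.of_forall fun ε => ?_
    beta_reduce
    by_cases hε : (0 : 𝔼 d) ∈ (Metric.ball (0 : 𝔼 d) ε)ᶜ
    · rw [indicator_of_mem hε]
    · rw [indicator_of_notMem hε, h0]
  · have : ∀ᶠ ε in 𝓝[>] (0 : ℝ), ε < ‖z‖ :=
      mem_nhdsWithin_of_mem_nhds (gt_mem_nhds (norm_pos_iff.2 hz))
    filter_upwards [this] with ε hε
    rw [indicator_of_mem]
    simpa using hε.le

lemma tendsto_modulatedLevyOperatorCutoff (A : Matrix (Fin d) (Fin d) ℝ) (hμ : IsLevyMeasure μ)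
    (hj : Measurable j) (hK0 : 0 ≤ K) (hK : ∀ z, ‖z‖ ≤ 1 → ‖j z - z‖ ≤ K * ‖z‖ ^ 2)
    {φ : 𝔼 d → ℝ} (hφ : MemCb 2 φ) (x : 𝔼 d) :
    Tendsto (fun ε : ℝ => modulatedLevyOperatorCutoff A μ j ε φ x) (𝓝[>] 0)
      (𝓝 (levyOperator A μ φ x + jumpModulation μ j φ x)) := by
  have hφ1 : MemCb 1 φ := by
    refine ⟨hφ.1.of_le (by norm_num), ?_⟩
    have := hφ.2
    rw [cbNorm_two] at this
    exact (ENNReal.add_lt_top.1 this).1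
  have i1 := integrable_compensatedIncrement hμ hφ x
  have i2 := integrable_jump_sub hμ hj hK0 hK hφ1 x
  -- Both operators use the compensator `Dφ(x)·z`, so it cancels in the difference.
  have e : ∀ z, compensatedIncrement φ x (x + j z) z =
      compensatedIncrement φ x (x + z) z + (φ (x + j z) - φ (x + z)) := fun z => by
    simp only [compensatedIncrement]
    ring
  have hj0 : j 0 = 0 := by
    have := hK 0 (by simp)
    simpa using this
  have := (tendsto_setIntegral_compl_ball (i1.add i2)
    (by simp [compensatedIncrement, hj0])).const_add (divADGrad A φ x)
  simpa only [modulatedLevyOperatorCutoff, levyOperator, jumpModulation, add_assoc, e,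
    ← integral_add i1 i2, Pi.add_apply] using this

end JumpModulation

/-! ### The nonlinearity `H(t,x,Du,Qu)` on `C^1` paths -/

noncomputable section Nonlinearity

variable {d : ℕ}

local notation:max "𝔼" d:max => EuclideanSpace ℝ (Fin d)

lemma norm_gradient_eq (f : 𝔼 d → ℝ) (x : 𝔼 d) : ‖gradient f x‖ = ‖fderiv ℝ f x‖ := by
  rw [gradient, LinearIsometryEquiv.norm_map]

lemma norm_gradient_sub (f g : 𝔼 d → ℝ) (x y : 𝔼 d) :
    ‖gradient f x - gradient g y‖ = ‖fderiv ℝ f x - fderiv ℝ g y‖ := by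
  rw [gradient, gradient, ← map_sub, LinearIsometryEquiv.norm_map]

lemma min_one_rpow_le {r σ τ : ℝ} (hr : 0 ≤ r) (hσ : 0 < σ) (h : σ ≤ τ) :
    min 1 (r ^ τ) ≤ r ^ σ := by
  rcases le_total r 1 with h1 | h1
  · refine (min_le_right _ _).trans ?_
    rcases hr.eq_or_lt with rfl | h0
    · rw [Real.zero_rpow hσ.ne', Real.zero_rpow (hσ.trans_le h).ne']
    · exact Real.rpow_le_rpow_of_exponent_ge h0 h1 h
  · exact (min_le_left _ _).trans (Real.one_le_rpow h1 hσ.le)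

namespace LowerOrderBounds

variable {β : ℝ} {C : ℝ≥0} {Q : (𝔼 d → ℝ) → 𝔼 d → ℝ}

lemma norm_le (hQ : LowerOrderBounds β C Q) {f : 𝔼 d → ℝ} (hf : ContDiff ℝ 1 f) {A B : ℝ}
    (hA : ∀ x, ‖f x‖ ≤ A) (hB : ∀ x, ‖fderiv ℝ f x‖ ≤ B) (x : 𝔼 d) :
    ‖Q f x‖ ≤ C * (A + B) := by
  have hA0 := (norm_nonneg _).trans (hA 0)
  have hB0 := (norm_nonneg _).trans (hB 0)
  refine norm_le_of_supNorm_le (by positivity) ?_ x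
  rw [ENNReal.ofReal_mul C.coe_nonneg, ENNReal.ofReal_coe_nnreal]
  exact (hQ.sup_bound f (memCb_one_of_bounds hf hA hB)).trans
    (mul_le_mul_right (cbNorm_one_le hA hB) _)

lemma norm_sub_le (hQ : LowerOrderBounds β C Q) {f g : 𝔼 d → ℝ} (hf : ContDiff ℝ 1 f)
    (hg : ContDiff ℝ 1 g) {A B : ℝ} (hfA : ∀ x, ‖f x‖ ≤ A) (hfB : ∀ x, ‖fderiv ℝ f x‖ ≤ B)
    (hgA : ∀ x, ‖g x‖ ≤ A) (hgB : ∀ x, ‖fderiv ℝ g x‖ ≤ B) {m : ℝ}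
    (h0 : ∀ x, ‖f x - g x‖ ≤ m) (h1 : ∀ x, ‖fderiv ℝ f x - fderiv ℝ g x‖ ≤ m) (x : 𝔼 d) :
    ‖Q f x - Q g x‖ ≤ C * (m + m) := by
  have hm := (norm_nonneg _).trans (h0 0)
  refine norm_le_of_supNorm_le (f := Q f - Q g) (by positivity) ?_ x
  rw [ENNReal.ofReal_mul C.coe_nonneg, ENNReal.ofReal_coe_nnreal]
  refine (hQ.lipschitz f g (memCb_one_of_bounds hf hfA hfB)
    (memCb_one_of_bounds hg hgA hgB)).trans (mul_le_mul_right (cbNorm_one_le h0 fun x => ?_) _)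
  rw [fderiv_fun_sub (hf.differentiable one_ne_zero x) (hg.differentiable one_ne_zero x)]
  exact h1 x

lemma norm_sub_le_of_holderNorm_le (hQ : LowerOrderBounds β C Q) {f : 𝔼 d → ℝ} {σ N : ℝ}
    (hσ0 : 0 < σ) (hσ : σ ≤ β) (hN0 : 0 ≤ N) (hf : MemHolderSpace (1 + σ) f)
    (hN : holderNorm (1 + σ) f ≤ ENNReal.ofReal N) (x x' : 𝔼 d) :
    ‖Q f x - Q f x'‖ ≤ C * N * ‖x - x'‖ ^ σ := by
  refine norm_sub_le_of_eHolderNorm_le hσ0.le (by positivity) ?_ x x'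
  rw [ENNReal.ofReal_mul C.coe_nonneg, ENNReal.ofReal_coe_nnreal]
  exact (hQ.holder_bound σ hσ0 hσ f hf).trans (mul_le_mul_right hN _)

end LowerOrderBounds

namespace HamiltonianCondition

variable {T β : ℝ} {H : ℝ → 𝔼 d → 𝔼 d → ℝ → ℝ}

/-- One constant serves all purposes on the ball of radius `R`. The Lipschitz bound at fixed `x`
relies on the spatial term being `0` at `x = x'`; the Hölder bound for `θ ≤ β` on its truncation at
`1`. -/
lemma exists_const (hH : HamiltonianCondition T β H) {R : ℝ} (hR : 0 < R) :
    ∃ C : ℝ, 0 ≤ C ∧ (∀ t ∈ Icc 0 T, ∀ x p q, ‖p‖ < R → |q| < R → |H t x p q| ≤ C) ∧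
      (∀ t ∈ Icc 0 T, ∀ x p p' q q', ‖p‖ < R → ‖p'‖ < R → |q| < R → |q'| < R →
        |H t x p' q' - H t x p q| ≤ C * (‖p - p'‖ + |q - q'|)) ∧
      ∀ θ, 0 < θ → θ ≤ β → ∀ t ∈ Icc 0 T, ∀ x x' p p' q q', ‖p‖ < R → ‖p'‖ < R → |q| < R →
        |q'| < R → |H t x' p' q' - H t x p q| ≤ C * (‖x - x'‖ ^ θ + ‖p - p'‖ + |q - q'|) := by
  obtain ⟨C₀, hC₀⟩ := hH.bounded
  obtain ⟨C₁, hC₁⟩ := hH.regular R hR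
  have hle : ∀ {s : ℝ}, 0 ≤ s → C₁ * s ≤ (|C₀| + |C₁| * (1 + 2 * R)) * s := fun {s} hs => by
    refine mul_le_mul_of_nonneg_right ?_ hs
    nlinarith [abs_nonneg C₀, le_abs_self C₁, abs_nonneg C₁, mul_nonneg (abs_nonneg C₁) hR.le]
  refine ⟨|C₀| + |C₁| * (1 + 2 * R), by positivity, fun t ht x p q hp hq => ?_,
    fun t ht x p p' q q' hp hp' hq hq' => ?_, fun θ hθ hθβ t ht x x' p p' q q' hp hp' hq hq' => ?_⟩
  · have h := hC₁ t ht x x 0 p 0 q (by simpa) hp (by simpa) hq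
    rw [if_pos rfl, zero_sub, zero_sub, norm_neg, abs_neg, zero_add] at h
    have h0 := hC₀ t ht x
    have h1 : C₁ * (‖p‖ + |q|) ≤ |C₁| * (2 * R) := by
      refine mul_le_mul (le_abs_self _) (by linarith) (by positivity) (abs_nonneg _)
    calc |H t x p q| = |(H t x p q - H t x 0 0) + H t x 0 0| := by rw [sub_add_cancel]
      _ ≤ |H t x p q - H t x 0 0| + |H t x 0 0| := abs_add_le _ _
      _ ≤ |C₁| * (2 * R) + |C₀| := add_le_add (h.trans h1) (h0.trans (le_abs_self _))
      _ ≤ _ := by nlinarith [abs_nonneg C₁]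
  · have h := hC₁ t ht x x p p' q q' hp hp' hq hq'
    rw [if_pos rfl, zero_add] at h
    exact h.trans (hle (by positivity))
  · have h := hC₁ t ht x x' p p' q q' hp hp' hq hq'
    have hr := Real.rpow_nonneg (norm_nonneg (x - x')) β
    refine h.trans ((hle ?_).trans ?_)
    · split_ifs <;> positivity
    · gcongr
      split_ifs
      · positivity
      · exact min_one_rpow_le (norm_nonneg _) hθ hθβ

/-- Carathéodory again: continuous in `(p,q)`, measurable in `(t,x)`. -/
lemma measurable_uncurry (hH : HamiltonianCondition T β H) :
    Measurable fun w : (𝔼 d × ℝ) × (Icc (0 : ℝ) T × 𝔼 d) => H w.2.1 w.2.2 w.1.1 w.1.2 := by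
  refine measurable_uncurry_of_continuous_of_measurable
    (u := fun (v : 𝔼 d × ℝ) (z : Icc (0 : ℝ) T × 𝔼 d) => H z.1 z.2 v.1 v.2) (fun z => ?_)
    (fun v => hH.measurable v.1 v.2)
  refine continuous_iff_continuousAt.2 fun v => ?_
  have hR : 0 < ‖v.1‖ + |v.2| + 1 := by positivity
  obtain ⟨C, -, -, hC, -⟩ := hH.exists_const hR
  have e1 : ∀ᶠ w : 𝔼 d × ℝ in 𝓝 v, ‖w.1‖ < ‖v.1‖ + |v.2| + 1 :=
    (by fun_prop : Continuous fun w : 𝔼 d × ℝ => ‖w.1‖).continuousAt.eventually_lt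
      continuousAt_const (by have := abs_nonneg v.2; linarith)
  have e2 : ∀ᶠ w : 𝔼 d × ℝ in 𝓝 v, |w.2| < ‖v.1‖ + |v.2| + 1 :=
    (by fun_prop : Continuous fun w : 𝔼 d × ℝ => |w.2|).continuousAt.eventually_lt
      continuousAt_const (by have := norm_nonneg v.1; linarith)
  have hlim : Tendsto (fun w : 𝔼 d × ℝ => C * (‖v.1 - w.1‖ + |v.2 - w.2|)) (𝓝 v) (𝓝 0) := by
    have : Continuous fun w : 𝔼 d × ℝ => C * (‖v.1 - w.1‖ + |v.2 - w.2|) := by fun_prop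
    simpa using this.tendsto v
  refine tendsto_iff_norm_sub_tendsto_zero.2 (squeeze_zero' (Eventually.of_forall fun _ =>
    norm_nonneg _) ?_ hlim)
  filter_upwards [e1, e2] with w h1 h2
  exact hC z.1 z.1.2 z.2 v.1 w.1 v.2 w.2 (by have := abs_nonneg v.2; linarith) h1
    (by have := norm_nonneg v.1; linarith) h2

end HamiltonianCondition

/-- Bounded continuous paths of pairs (function, gradient). -/
abbrev C1Path (d : ℕ) (T : ℝ) : Type :=
  BoundedContinuousFunction (Ioc (0 : ℝ) T)
    (BoundedContinuousFunction (𝔼 d) (ℝ × (𝔼 d →L[ℝ] ℝ)))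

namespace C1Path

variable {T : ℝ}

/-- The function component of a path. -/
def fn (U : C1Path d T) (t : Ioc (0 : ℝ) T) (x : 𝔼 d) : ℝ := (U t x).1

/-- The second component of the path is the gradient of the first. -/
def IsGradient (U : C1Path d T) : Prop := ∀ t x, HasFDerivAt (U.fn t) (U t x).2 x

lemma continuous_uncurry (U : C1Path d T) :
    Continuous fun z : Ioc (0 : ℝ) T × 𝔼 d => U z.1 z.2 :=
  (U.continuous.comp continuous_fst).eval continuous_snd

lemma norm_apply_sub_le (U V : C1Path d T) (t : Ioc (0 : ℝ) T) (x : 𝔼 d) :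
    ‖U t x - V t x‖ ≤ dist U V := by
  rw [← dist_eq_norm]
  exact (BoundedContinuousFunction.dist_coe_le_dist x).trans
    (BoundedContinuousFunction.dist_coe_le_dist t)

namespace IsGradient

variable {U V : C1Path d T} {R : ℝ}

lemma fderiv_eq (hU : U.IsGradient) (t : Ioc (0 : ℝ) T) (x : 𝔼 d) :
    fderiv ℝ (U.fn t) x = (U t x).2 := (hU t x).fderiv

lemma contDiff (hU : U.IsGradient) (t : Ioc (0 : ℝ) T) : ContDiff ℝ 1 (U.fn t) := by
  rw [contDiff_one_iff_fderiv]
  refine ⟨fun x => (hU t x).differentiableAt, ?_⟩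
  rw [funext (hU.fderiv_eq t)]
  exact continuous_snd.comp (U t).continuous

lemma norm_fn_le {t : Ioc (0 : ℝ) T} (h : ∀ x, ‖U t x‖ ≤ R) (x : 𝔼 d) : ‖U.fn t x‖ ≤ R :=
  (norm_fst_le _).trans (h x)

lemma norm_fderiv_le (hU : U.IsGradient) {t : Ioc (0 : ℝ) T} (h : ∀ x, ‖U t x‖ ≤ R) (x : 𝔼 d) :
    ‖fderiv ℝ (U.fn t) x‖ ≤ R := by
  rw [hU.fderiv_eq]
  exact (norm_snd_le _).trans (h x)

end IsGradient

end C1Path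

/-- Nonlinearities `F(t, f)(x)` depending on `f` and `Df` that are bounded by `M` and Lipschitz with
constant `Λ` on the `C^1_b`-ball of radius `R`, and map `C^{1+θ}` into `C^θ`. -/
structure IsNonlinearity (T θ R M Λ A B : ℝ) (F : ℝ → (𝔼 d → ℝ) → 𝔼 d → ℝ) : Prop where
  measurable : ∀ S ≤ T, ∀ U : C1Path d S, U.IsGradient →
    Measurable fun z : Ioc (0 : ℝ) S × 𝔼 d => F z.1 (U.fn z.1) z.2
  bound : ∀ t ∈ Ioc 0 T, ∀ f : 𝔼 d → ℝ, ContDiff ℝ 1 f → (∀ x, ‖f x‖ ≤ R) →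
    (∀ x, ‖fderiv ℝ f x‖ ≤ R) → ∀ x, ‖F t f x‖ ≤ M
  lipschitz : ∀ t ∈ Ioc 0 T, ∀ f g : 𝔼 d → ℝ, ContDiff ℝ 1 f → ContDiff ℝ 1 g →
    (∀ x, ‖f x‖ ≤ R) → (∀ x, ‖fderiv ℝ f x‖ ≤ R) → (∀ x, ‖g x‖ ≤ R) →
    (∀ x, ‖fderiv ℝ g x‖ ≤ R) → ∀ m, (∀ x, ‖f x - g x‖ ≤ m) →
    (∀ x, ‖fderiv ℝ f x - fderiv ℝ g x‖ ≤ m) → ∀ x, ‖F t f x - F t g x‖ ≤ Λ * m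
  holder : ∀ t ∈ Ioc 0 T, ∀ f : 𝔼 d → ℝ, ContDiff ℝ 1 f → (∀ x, ‖f x‖ ≤ R) →
    (∀ x, ‖fderiv ℝ f x‖ ≤ R) → ∀ N, 0 ≤ N →
    (∀ x x', ‖fderiv ℝ f x - fderiv ℝ f x'‖ ≤ N * ‖x - x'‖ ^ θ) →
    ∀ x x', ‖F t f x - F t f x'‖ ≤ (A + B * N) * ‖x - x'‖ ^ θ

variable {T β : ℝ} {C : ℝ≥0} {H : ℝ → 𝔼 d → 𝔼 d → ℝ → ℝ} {Q : (𝔼 d → ℝ) → 𝔼 d → ℝ}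

/-- Nothing is assumed about `Q` jointly in time and space. The Lipschitz bound makes `t ↦
Q(u(t))(x)` continuous along a continuous path, and measurability in `x` is an assumption. -/
lemma measurable_hamiltonian (hH : HamiltonianCondition T β H) (hQ : LowerOrderBounds β C Q)
    {S : ℝ} (hS : S ≤ T) {U : C1Path d S} (hU : U.IsGradient) :
    Measurable fun z : Ioc (0 : ℝ) S × 𝔼 d =>
      H z.1 z.2 (gradient (U.fn z.1) z.2) (Q (U.fn z.1) z.2) := by
  have hg : Measurable fun z : Ioc (0 : ℝ) S × 𝔼 d => gradient (U.fn z.1) z.2 := by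
    refine Continuous.measurable ?_
    simp only [gradient, hU.fderiv_eq]
    exact (LinearIsometryEquiv.continuous _).comp (continuous_snd.comp U.continuous_uncurry)
  have hq : Measurable fun z : Ioc (0 : ℝ) S × 𝔼 d => Q (U.fn z.1) z.2 := by
    refine measurable_uncurry_of_continuous_of_measurable
      (u := fun (t : Ioc (0 : ℝ) S) x => Q (U.fn t) x) (fun x => ?_) (fun t =>
        hQ.measurable _ (memCb_one_of_bounds (hU.contDiff t) (C1Path.IsGradient.norm_fn_le (U t).norm_coe_le_norm)
          (hU.norm_fderiv_le (U t).norm_coe_le_norm)))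
    refine continuous_iff_continuousAt.2 fun t => ?_
    have hlim : Tendsto (fun s => C * (dist (U s) (U t) + dist (U s) (U t))) (𝓝 t) (𝓝 0) := by
      have : Continuous fun s => C * (dist (U s) (U t) + dist (U s) (U t)) := by
        have := U.continuous
        fun_prop
      simpa using this.tendsto t
    refine tendsto_iff_norm_sub_tendsto_zero.2 (squeeze_zero (fun _ => norm_nonneg _)
      (fun s => ?_) hlim)
    have hd : ∀ x, ‖U s x - U t x‖ ≤ dist (U s) (U t) := fun x => by
      rw [← dist_eq_norm]
      exact BoundedContinuousFunction.dist_coe_le_dist x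
    have hb : ∀ r ∈ ({s, t} : Set (Ioc (0 : ℝ) S)), ∀ x, ‖U r x‖ ≤ max ‖U s‖ ‖U t‖ := by
      rintro r (rfl | rfl) x
      · exact ((U r).norm_coe_le_norm x).trans (le_max_left _ _)
      · exact ((U r).norm_coe_le_norm x).trans (le_max_right _ _)
    refine hQ.norm_sub_le (hU.contDiff s) (hU.contDiff t)
      (C1Path.IsGradient.norm_fn_le (hb s (by simp))) (hU.norm_fderiv_le (hb s (by simp)))
      (C1Path.IsGradient.norm_fn_le (hb t (by simp))) (hU.norm_fderiv_le (hb t (by simp)))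
      (fun x => ?_) (fun x => ?_) x
    · exact (norm_fst_le (U s x - U t x)).trans (hd x)
    · rw [hU.fderiv_eq, hU.fderiv_eq]
      exact (norm_snd_le (U s x - U t x)).trans (hd x)
  have hz : Measurable fun z : Ioc (0 : ℝ) S × 𝔼 d =>
      ((⟨z.1, z.1.2.1.le, z.1.2.2.trans hS⟩ : Icc (0 : ℝ) T), z.2) :=
    ((measurable_subtype_coe.comp measurable_fst).subtype_mk).prodMk measurable_snd
  exact hH.measurable_uncurry.comp ((hg.prodMk hq).prodMk hz)

lemma exists_isNonlinearity (hH : HamiltonianCondition T β H) (hQ : LowerOrderBounds β C Q)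
    {θ : ℝ} (hθ0 : 0 ≤ θ) (hθ1 : θ < 1) (hθ : θ ≤ β) {R : ℝ} (hR : 0 ≤ R) :
    ∃ M Λ A B : ℝ, 0 ≤ M ∧ 0 ≤ Λ ∧ 0 ≤ A ∧ 0 ≤ B ∧
      IsNonlinearity T θ R M Λ A B fun t f x => H t x (gradient f x) (Q f x) := by
  -- This radius exceeds both `|Df| ≤ R` and `|Qf| ≤ C(R + R)`; the `1` makes the inequalities
  -- strict.
  obtain ⟨D, hD, h1, h2, h3⟩ := hH.exists_const (R := R + C * (R + R) + 1) (by positivity)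
  have hCR : 0 ≤ C * (R + R) := by positivity
  have hg : ∀ {f : 𝔼 d → ℝ}, (∀ x, ‖fderiv ℝ f x‖ ≤ R) →
      ∀ x, ‖gradient f x‖ < R + C * (R + R) + 1 := fun hf x => by
    rw [norm_gradient_eq]
    linarith [hf x]
  have hq : ∀ {f : 𝔼 d → ℝ}, ContDiff ℝ 1 f → (∀ x, ‖f x‖ ≤ R) → (∀ x, ‖fderiv ℝ f x‖ ≤ R) →
      ∀ x, |Q f x| < R + C * (R + R) + 1 := fun hc hf hf' x => by
    have := hQ.norm_le hc hf hf' x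
    rw [Real.norm_eq_abs] at this
    linarith
  refine ⟨D, D * (1 + 2 * C), 2 * D + D * (1 + C * (R + R)), D * (1 + C), hD, by positivity,
    by positivity, by positivity, ⟨fun S hS U hU => measurable_hamiltonian hH hQ hS hU,
      fun t ht f hc hf hf' x => h1 t ⟨ht.1.le, ht.2⟩ x _ _ (hg hf' x) (hq hc hf hf' x),
      fun t ht f g hf hg' hfR hfR' hgR hgR' m hm hm' x => ?_,
      fun t ht f hc hf hf' N hN0 hN x x' => ?_⟩⟩
  · refine (h2 t ⟨ht.1.le, ht.2⟩ x _ _ _ _ (hg hgR' x) (hg hfR' x) (hq hg' hgR hgR' x)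
      (hq hf hfR hfR' x)).trans ?_
    rw [norm_gradient_sub, norm_sub_rev, abs_sub_comm, mul_assoc]
    refine mul_le_mul_of_nonneg_left ?_ hD
    have := hQ.norm_sub_le hf hg' hfR hfR' hgR hgR' hm hm' x
    rw [Real.norm_eq_abs] at this
    linarith [hm' x]
  · have hr := Real.rpow_nonneg (norm_nonneg (x - x')) θ
    -- For `θ = 0` the power of `|x - x'|` is `1`, also at `x = x'`, so the claim is an oscillation
    -- bound and follows from the sup bound. `Q` offers nothing at `σ = 0`.
    rcases hθ0.eq_or_lt with rfl | hθ0
    · rw [Real.rpow_zero, mul_one]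
      have k1 := h1 t ⟨ht.1.le, ht.2⟩ x _ _ (hg hf' x) (hq hc hf hf' x)
      have k2 := h1 t ⟨ht.1.le, ht.2⟩ x' _ _ (hg hf' x') (hq hc hf hf' x')
      refine (_root_.norm_sub_le _ _).trans ((add_le_add k1 k2).trans ?_)
      have : 0 ≤ D * (1 + C * (R + R)) := by positivity
      have : 0 ≤ D * (1 + C) * N := by positivity
      linarith
    · refine (h3 θ hθ0 hθ t ⟨ht.1.le, ht.2⟩ x' x _ _ _ _ (hg hf' x') (hg hf' x)
        (hq hc hf hf' x') (hq hc hf hf' x)).trans ?_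
      obtain ⟨m1, m2⟩ := memHolderSpace_one_lt_two (γ := 1 + θ) (by linarith) (by linarith) hc hN0
        hf hf' (by simpa using hN)
      have k := hQ.norm_sub_le_of_holderNorm_le hθ0 hθ (by positivity) m1 m2 x x'
      rw [norm_gradient_sub, norm_sub_rev, norm_sub_rev (fderiv ℝ f x'), abs_sub_comm]
      rw [Real.norm_eq_abs] at k
      calc _ ≤ D * (‖x - x'‖ ^ θ + N * ‖x - x'‖ ^ θ + C * (R + R + N) * ‖x - x'‖ ^ θ) := by
            gcongr
            exact hN x x'
        _ = (D * (1 + C * (R + R)) + D * (1 + C) * N) * ‖x - x'‖ ^ θ := by ring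
        _ ≤ _ := by
            gcongr
            linarith

/-- `C^2`-functions are mapped to Lipschitz functions if `β = 1`. -/
lemma exists_lipschitz_hamiltonian (hH : HamiltonianCondition T 1 H)
    (hQ : LowerOrderBounds 1 C Q) {R : ℝ} (hR : 0 ≤ R) :
    ∃ A B : ℝ, 0 ≤ A ∧ 0 ≤ B ∧ ∀ t ∈ Ioc 0 T, ∀ f : 𝔼 d → ℝ, ContDiff ℝ 2 f → (∀ x, ‖f x‖ ≤ R) →
      (∀ x, ‖fderiv ℝ f x‖ ≤ R) → ∀ N, 0 ≤ N → (∀ x, ‖fderiv ℝ (fderiv ℝ f) x‖ ≤ N) →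
      ∀ x x', ‖H t x (gradient f x) (Q f x) - H t x' (gradient f x') (Q f x')‖ ≤
        (A + B * N) * ‖x - x'‖ := by
  obtain ⟨D, hD, -, -, h3⟩ := hH.exists_const (R := R + C * (R + R) + 1) (by positivity)
  have hCR : 0 ≤ C * (R + R) := by positivity
  refine ⟨D * (1 + C * (R + R)), D * (1 + C), by positivity, by positivity,
    fun t ht f hc2 hf hf' N hN0 hN x x' => ?_⟩
  have hc : ContDiff ℝ 1 f := hc2.of_le (by norm_num)
  have hc2' : ContDiff ℝ (1 + 1) f := hc2
  have hg : ∀ x, ‖gradient f x‖ < R + C * (R + R) + 1 := fun x => by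
    rw [norm_gradient_eq]
    linarith [hf' x]
  have hq : ∀ x, |Q f x| < R + C * (R + R) + 1 := fun x => by
    have := hQ.norm_le hc hf hf' x
    rw [Real.norm_eq_abs] at this
    linarith
  have hL := norm_sub_le_of_norm_fderiv_le
    ((contDiff_succ_iff_fderiv.1 hc2').2.2.differentiable one_ne_zero) hN
  refine (h3 1 one_pos le_rfl t ⟨ht.1.le, ht.2⟩ x' x _ _ _ _ (hg x') (hg x) (hq x') (hq x)).trans ?_
  obtain ⟨m1, m2⟩ := memHolderSpace_two hc2 hf hf' hN
  rw [← one_add_one_eq_two] at m1 m2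
  have k := hQ.norm_sub_le_of_holderNorm_le one_pos le_rfl (by positivity) m1 m2 x x'
  rw [norm_gradient_sub, norm_sub_rev, norm_sub_rev (fderiv ℝ f x'), abs_sub_comm]
  rw [Real.norm_eq_abs] at k
  rw [Real.rpow_one] at *
  calc _ ≤ D * (‖x - x'‖ + N * ‖x - x'‖ + C * (R + R + N) * ‖x - x'‖) := by
        gcongr
        exact hL x x'
    _ = _ := by ring

end Nonlinearity

/-! ### The complete set for the fixed point argument -/

noncomputable section PicardSpace

variable {d : ℕ}

local notation:max "𝔼" d:max => EuclideanSpace ℝ (Fin d)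

namespace HeatFamily

variable {α c T L M t : ℝ} {p : ℝ → 𝔼 d → ℝ} {g : 𝔼 d → ℝ}

/-- Averaging preserves the Lipschitz constant, so Lipschitz initial data produce no gradient
singularity at `t = 0`. -/
lemma norm_fderiv_conv_le_of_lipschitz (hp : HeatFamily α c T p) (ht : t ∈ Ioc 0 T)
    (hg : StronglyMeasurable g) (hM : ∀ x, ‖g x‖ ≤ M) (hL0 : 0 ≤ L)
    (hL : ∀ x x', ‖g x - g x'‖ ≤ L * ‖x - x'‖) (x : 𝔼 d) :
    ‖fderiv ℝ (kernelConv (p t) g) x‖ ≤ L := by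
  refine norm_fderiv_le_of_lip' ℝ hL0 (Eventually.of_forall fun y => ?_)
  simpa using hp.conv_holder ht hg hM (θ := 1) (by simpa using hL) y x

/-- Interpolates between the oscillation bound `2L` and the Lipschitz bound of order `t^(-1/α)`.
This is the source of the weight `t^(-θ/α)`. -/
lemma fderiv_conv_holder_of_lipschitz (hp : HeatFamily α c T p) (ht : t ∈ Ioc 0 T)
    (hg : StronglyMeasurable g) (hM : ∀ x, ‖g x‖ ≤ M) (hL0 : 0 ≤ L)
    (hL : ∀ x x', ‖g x - g x'‖ ≤ L * ‖x - x'‖) {θ : ℝ} (hθ : θ ∈ Icc (0 : ℝ) 1) (x x' : 𝔼 d) :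
    ‖fderiv ℝ (kernelConv (p t) g) x - fderiv ℝ (kernelConv (p t) g) x'‖ ≤
      (2 * L + c * 2 ^ (1 / α) * L) * t ^ (-(θ / α)) * ‖x - x'‖ ^ θ := by
  have hc := hp.const_nonneg ht
  have ht0 := ht.1
  have ht2 : t / 2 ∈ Ioc 0 T := ⟨half_pos ht.1, by linarith [ht.1, ht.2]⟩
  have hb := fun {s} (hs : s ∈ Ioc 0 T) x =>
    hp.norm_fderiv_conv_le_of_lipschitz hs hg hM hL0 hL x
  have h1 : ‖fderiv ℝ (kernelConv (p t) g) x - fderiv ℝ (kernelConv (p t) g) x'‖ ≤ 2 * L :=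
    (norm_sub_le _ _).trans (by linarith [hb ht x, hb ht x'])
  have h2 : ‖fderiv ℝ (kernelConv (p t) g) x - fderiv ℝ (kernelConv (p t) g) x'‖ ≤
      c * 2 ^ (1 / α) * L * (t ^ (-(1 / α)) * ‖x - x'‖) := by
    have h := hp.norm_conv_sub_le ht2
      ((hp.contDiff_one_conv ht2 hg hM).continuous_fderiv one_ne_zero).stronglyMeasurable
      (hb ht2) x x'
    rw [← hp.fderiv_conv_half ht hg hM] at h
    refine h.trans_eq ?_
    rw [Real.div_rpow ht0.le zero_le_two, Real.rpow_neg zero_le_two, div_inv_eq_mul]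
    ring
  refine (le_min h1 h2).trans ((min_le_mul_rpow (by positivity) (by positivity) (by positivity)
    hθ.1 hθ.2).trans_eq ?_)
  rw [Real.mul_rpow (by positivity) (norm_nonneg _), ← Real.rpow_mul ht0.le,
    show -(1 / α) * θ = -(θ / α) by ring]
  ring

end HeatFamily

lemma exists_small_time (G : ℝ) {η T : ℝ} (hη : 0 < η) (hT : 0 < T) :
    ∃ T₀, 0 < T₀ ∧ T₀ ≤ T ∧ T₀ ≤ 1 ∧ G * T₀ ^ η ≤ 1 / 2 := by
  have h : Tendsto (fun t : ℝ => G * t ^ η) (𝓝[>] 0) (𝓝 0) := by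
    have : Continuous fun t : ℝ => G * t ^ η :=
      continuous_const.mul (continuous_id.rpow_const fun _ => Or.inr hη.le)
    have := (this.tendsto 0).mono_left (nhdsWithin_le_nhds (s := Ioi 0))
    simpa [Real.zero_rpow hη.ne'] using this
  have h1 := h.eventually (Iic_mem_nhds (by norm_num : (0 : ℝ) < 1 / 2))
  have h2 : ∀ᶠ t : ℝ in 𝓝[>] 0, t ∈ Ioc 0 (min T 1) :=
    Ioc_mem_nhdsGT (lt_min hT one_pos)
  obtain ⟨t, ht1, ht2⟩ := (h1.and h2).exists
  exact ⟨t, ht2.1, ht2.2.trans (min_le_left _ _), ht2.2.trans (min_le_right _ _), ht1⟩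

lemma exists_fixedPoint_of_contracting {X Y G : Type*} [TopologicalSpace X] [TopologicalSpace Y]
    [MetricSpace G] [CompleteSpace G]
    {s : Set (BoundedContinuousFunction X (BoundedContinuousFunction Y G))} (hs : IsClosed s)
    {Φ : BoundedContinuousFunction X (BoundedContinuousFunction Y G) →
      BoundedContinuousFunction X (BoundedContinuousFunction Y G)} (hmaps : MapsTo Φ s s)
    (hΦ : ∀ U ∈ s, ∀ V ∈ s, dist (Φ U) (Φ V) ≤ 1 / 2 * dist U V) (hne : s.Nonempty) :
    ∃ U ∈ s, Φ U = U := by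
  obtain ⟨U₀, hU₀⟩ := hne
  have hcontr : ContractingWith (1 / 2 : ℝ≥0) (hmaps.restrict Φ s s) :=
    ⟨by norm_num, LipschitzWith.of_dist_le_mul fun U V =>
      (hΦ U U.2 V V.2).trans_eq (by norm_num [Subtype.dist_eq])⟩
  obtain ⟨U, hU, hfix, -⟩ := hcontr.exists_fixedPoint' hs.isComplete hmaps hU₀ (edist_ne_top _ _)
  exact ⟨U, hU, hfix⟩

namespace C1Path

variable {S : ℝ}

/-- The space on which the fixed point argument runs. -/
def admissible (S R N b θ : ℝ) : Set (C1Path d S) :=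
  {U | U.IsGradient ∧ (∀ t x, ‖U t x‖ ≤ R) ∧
    ∀ t x x', ‖(U t x).2 - (U t x').2‖ ≤ N * (t : ℝ) ^ (-b) * ‖x - x'‖ ^ θ}

/-- Uniform limits of functions and of their derivatives remain compatible. -/
lemma isClosed_isGradient : IsClosed {U : C1Path d S | U.IsGradient} := by
  refine IsSeqClosed.isClosed fun U V hU hUV t x => ?_
  have h1 : Tendsto (fun n => U n t) atTop (𝓝 (V t)) :=
    ((continuous_id.eval continuous_const : Continuous fun W : C1Path d S => W t).tendsto V).comp hUV
  have h2 := BoundedContinuousFunction.tendsto_iff_tendstoUniformly.1 h1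
  exact hasFDerivAt_of_tendstoUniformly (uniformContinuous_snd.comp_tendstoUniformly h2)
    (fun n x => hU n t x) (fun y => (continuous_fst.tendsto _).comp (h2.tendsto_at y)) x

/-- The weighted Hölder bound survives pointwise limits, so it need not enter the metric. -/
lemma isClosed_admissible (R N b θ : ℝ) : IsClosed (admissible (d := d) S R N b θ) := by
  have hc : ∀ (t : Ioc (0 : ℝ) S) (x : 𝔼 d), Continuous fun U : C1Path d S => U t x := fun t x =>
    (continuous_id.eval continuous_const).eval continuous_const
  have h1 : IsClosed {U : C1Path d S | ∀ t x, ‖U t x‖ ≤ R} := by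
    simp only [ofPred_forall]
    exact isClosed_iInter fun t => isClosed_iInter fun x =>
      isClosed_le (hc t x).norm continuous_const
  have h2 : IsClosed {U : C1Path d S |
      ∀ t x x', ‖(U t x).2 - (U t x').2‖ ≤ N * (t : ℝ) ^ (-b) * ‖x - x'‖ ^ θ} := by
    simp only [ofPred_forall]
    exact isClosed_iInter fun t => isClosed_iInter fun x => isClosed_iInter fun x' =>
      isClosed_le ((continuous_snd.comp (hc t x)).sub (continuous_snd.comp (hc t x'))).norm
        continuous_const
  exact isClosed_isGradient.inter (h1.inter h2)

/-- A continuous and bounded path of `C^1` functions, as an element of the path space. -/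
lemma exists_path {v : ℝ → 𝔼 d → ℝ} {R : ℝ} (hc : ∀ t ∈ Ioc 0 S, ContDiff ℝ 1 (v t))
    (h0 : ∀ t ∈ Ioc 0 S, ∀ x, ‖v t x‖ ≤ R) (h1 : ∀ t ∈ Ioc 0 S, ∀ x, ‖fderiv ℝ (v t) x‖ ≤ R)
    (ht : ∀ t ∈ Ioc 0 S, ∀ ε, 0 < ε → ∀ᶠ s in 𝓝[Ioc 0 S] t, ∀ x, ‖v s x - v t x‖ ≤ ε ∧
      ‖fderiv ℝ (v s) x - fderiv ℝ (v t) x‖ ≤ ε) :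
    ∃ U : C1Path d S, U.IsGradient ∧ (∀ t x, ‖U t x‖ ≤ R) ∧
      ∀ t x, U t x = (v t x, fderiv ℝ (v t) x) := by
  have hR : ∀ (t : Ioc (0 : ℝ) S) x, ‖(v t x, fderiv ℝ (v t) x)‖ ≤ R := fun t x =>
    norm_prod_le_iff.2 ⟨h0 t t.2 x, h1 t t.2 x⟩
  let w : Ioc (0 : ℝ) S → BoundedContinuousFunction (𝔼 d) (ℝ × (𝔼 d →L[ℝ] ℝ)) := fun t =>
    BoundedContinuousFunction.ofNormedAddCommGroup (fun x => (v t x, fderiv ℝ (v t) x))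
      ((hc t t.2).continuous.prodMk ((hc t t.2).continuous_fderiv one_ne_zero)) R (hR t)
  have hw : Continuous w := by
    refine continuous_iff_continuousAt.2 fun t => Metric.tendsto_nhds.2 fun ε hε => ?_
    have hval : Tendsto (Subtype.val : Ioc (0 : ℝ) S → ℝ) (𝓝 t) (𝓝[Ioc 0 S] (t : ℝ)) :=
      tendsto_nhdsWithin_iff.2 ⟨continuous_subtype_val.continuousAt, Eventually.of_forall Subtype.prop⟩
    filter_upwards [hval.eventually (ht t t.2 (ε / 2) (half_pos hε))] with s hs
    refine lt_of_le_of_lt ((BoundedContinuousFunction.dist_le (half_pos hε).le).2 fun x => ?_)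
      (half_lt_self hε)
    rw [Prod.dist_eq, dist_eq_norm, dist_eq_norm]
    exact max_le (hs x).1 (hs x).2
  refine ⟨BoundedContinuousFunction.mkOfBound ⟨w, hw⟩ (2 * |R|) fun s t => ?_, fun t x => ?_, hR,
    fun _ _ => rfl⟩
  · refine (BoundedContinuousFunction.dist_le (by positivity)).2 fun x => ?_
    rw [dist_eq_norm]
    exact (norm_sub_le _ _).trans ((add_le_add (hR s x) (hR t x)).trans
      (by linarith [le_abs_self R]))
  · exact ((hc t t.2).differentiable one_ne_zero x).hasFDerivAt

/-- The source `F(s, U(s))`, extended by zero. -/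
def source (F : ℝ → (𝔼 d → ℝ) → 𝔼 d → ℝ) (U : C1Path d S) (s : ℝ) (x : 𝔼 d) : ℝ :=
  if h : s ∈ Ioc 0 S then F s (U.fn ⟨s, h⟩) x else 0

variable {T θ R M Λ A B : ℝ} {F : ℝ → (𝔼 d → ℝ) → 𝔼 d → ℝ} {U V : C1Path d S}

lemma source_of_mem {s : ℝ} (h : s ∈ Ioc 0 S) (x : 𝔼 d) :
    U.source F s x = F s (U.fn ⟨s, h⟩) x := dif_pos h

lemma isSource_source (hF : IsNonlinearity T θ R M Λ A B F) (hM : 0 ≤ M) (hS : S ≤ T)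
    (hU : U.IsGradient) (hR : ∀ t x, ‖U t x‖ ≤ R) : IsSource (U.source F) M := by
  refine ⟨_root_.measurable_extend (u := fun z : Ioc (0 : ℝ) S × 𝔼 d => F z.1 (U.fn z.1) z.2)
    (hF.measurable S hS U hU), fun s x => ?_⟩
  rw [source]
  split_ifs with h
  · exact hF.bound s ⟨h.1, h.2.trans hS⟩ _ (hU.contDiff _) (IsGradient.norm_fn_le (hR _))
      (hU.norm_fderiv_le (hR _)) x
  · simpa using hM

lemma norm_source_sub_le (hF : IsNonlinearity T θ R M Λ A B F) (hΛ : 0 ≤ Λ) (hS : S ≤ T)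
    (hU : U.IsGradient) (hUR : ∀ t x, ‖U t x‖ ≤ R) (hV : V.IsGradient)
    (hVR : ∀ t x, ‖V t x‖ ≤ R) (s : ℝ) (x : 𝔼 d) :
    ‖U.source F s x - V.source F s x‖ ≤ Λ * dist U V := by
  rw [source, source]
  split_ifs with h
  · refine hF.lipschitz s ⟨h.1, h.2.trans hS⟩ _ _ (hU.contDiff _) (hV.contDiff _)
      (IsGradient.norm_fn_le (hUR _)) (hU.norm_fderiv_le (hUR _)) (IsGradient.norm_fn_le (hVR _))
      (hV.norm_fderiv_le (hVR _)) _ (fun x => ?_) (fun x => ?_) x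
    · exact (norm_fst_le (U ⟨s, h⟩ x - V ⟨s, h⟩ x)).trans (norm_apply_sub_le U V _ x)
    · rw [hU.fderiv_eq, hV.fderiv_eq]
      exact (norm_snd_le (U ⟨s, h⟩ x - V ⟨s, h⟩ x)).trans (norm_apply_sub_le U V _ x)
  · simpa using mul_nonneg hΛ dist_nonneg

lemma source_holder (hF : IsNonlinearity T θ R M Λ A B F) (hA : 0 ≤ A) (hB : 0 ≤ B) (hS : S ≤ T)
    {N b : ℝ} (hN : 0 ≤ N) (hU : U ∈ admissible S R N b θ) {s : ℝ} (hs : 0 ≤ s) (x x' : 𝔼 d) :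
    ‖U.source F s x - U.source F s x'‖ ≤ (A + B * N * s ^ (-b)) * ‖x - x'‖ ^ θ := by
  obtain ⟨h1, h2, h3⟩ := hU
  rw [source, source]
  split_ifs with h
  · rw [mul_assoc B]
    refine hF.holder s ⟨h.1, h.2.trans hS⟩ _ (h1.contDiff _) (IsGradient.norm_fn_le (h2 _))
      (h1.norm_fderiv_le (h2 _)) _ (by positivity) (fun y y' => ?_) x x'
    rw [h1.fderiv_eq, h1.fderiv_eq]
    exact h3 ⟨s, h⟩ y y'
  · rw [sub_self, norm_zero]
    positivity

end C1Path

end PicardSpace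

/-! ### The contraction -/

noncomputable section Picard

variable {d : ℕ}

local notation:max "𝔼" d:max => EuclideanSpace ℝ (Fin d)

/-- The right-hand side of the Duhamel formula with initial value `u₀` and source `f`. -/
def mildRhs (p : ℝ → 𝔼 d → ℝ) (u₀ : 𝔼 d → ℝ) (f : ℝ → 𝔼 d → ℝ) (t : ℝ) (x : 𝔼 d) : ℝ :=
  kernelConv (p t) u₀ x + duhamel p f t x

namespace HeatFamily

variable {α c T M M₀ L t : ℝ} {p : ℝ → 𝔼 d → ℝ} {u₀ : 𝔼 d → ℝ} {f g : ℝ → 𝔼 d → ℝ}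

lemma contDiff_mildRhs (hp : HeatFamily α c T p) (hα : 1 < α) (ht : t ∈ Ioc 0 T)
    (hu : StronglyMeasurable u₀) (hM₀ : ∀ x, ‖u₀ x‖ ≤ M₀) (hf : IsSource f M) :
    ContDiff ℝ 1 (mildRhs p u₀ f t) :=
  (hp.contDiff_one_conv ht hu hM₀).add
    (hp.contDiff_heatIntegral hα (hf.comp_sub t) ht.1.le ht.2)

lemma fderiv_mildRhs (hp : HeatFamily α c T p) (hα : 1 < α) (ht : t ∈ Ioc 0 T)
    (hu : StronglyMeasurable u₀) (hM₀ : ∀ x, ‖u₀ x‖ ≤ M₀) (hf : IsSource f M) (x : 𝔼 d) :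
    fderiv ℝ (mildRhs p u₀ f t) x = fderiv ℝ (kernelConv (p t) u₀) x +
      fderiv ℝ (duhamel p f t) x :=
  fderiv_add ((hp.contDiff_one_conv ht hu hM₀).differentiable one_ne_zero x)
    ((hp.contDiff_heatIntegral hα (hf.comp_sub t) ht.1.le ht.2).differentiable one_ne_zero x)

lemma eventually_mildRhs_sub_le (hp : HeatFamily α c T p) (hα : 1 < α) (ht : t ∈ Ioc 0 T)
    (hu : StronglyMeasurable u₀) (hM₀ : ∀ x, ‖u₀ x‖ ≤ M₀) (hf : IsSource f M) {ε : ℝ}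
    (hε : 0 < ε) :
    ∀ᶠ s in 𝓝[Ioc 0 T] t, ∀ x, ‖mildRhs p u₀ f s x - mildRhs p u₀ f t x‖ ≤ ε ∧
      ‖fderiv ℝ (mildRhs p u₀ f s) x - fderiv ℝ (mildRhs p u₀ f t) x‖ ≤ ε := by
  filter_upwards [hp.eventually_norm_conv_sub_le ht hu hM₀ (half_pos hε),
    hp.eventually_duhamel_sub_le hα hf ht (half_pos hε), self_mem_nhdsWithin] with s h1 h2 hs x
  rw [hp.fderiv_mildRhs hα hs hu hM₀ hf, hp.fderiv_mildRhs hα ht hu hM₀ hf, mildRhs, mildRhs,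
    add_sub_add_comm, add_sub_add_comm]
  exact ⟨(norm_add_le_of_le (h1 x).1 (h2 x).1).trans_eq (add_halves ε),
    (norm_add_le_of_le (h1 x).2 (h2 x).2).trans_eq (add_halves ε)⟩

lemma norm_mildRhs_sub_le (hp : HeatFamily α c T p) (hα : 1 < α) (ht : t ∈ Ioc 0 T)
    (hu : StronglyMeasurable u₀) (hM₀ : ∀ x, ‖u₀ x‖ ≤ M₀) (hf : IsSource f M)
    (hg : IsSource g M) {m : ℝ} (hm : ∀ s x, ‖f s x - g s x‖ ≤ m) (x : 𝔼 d) :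
    ‖mildRhs p u₀ f t x - mildRhs p u₀ g t x‖ ≤ m * t ∧
      ‖fderiv ℝ (mildRhs p u₀ f t) x - fderiv ℝ (mildRhs p u₀ g t) x‖ ≤
        c * m * (t ^ (1 - 1 / α) / (1 - 1 / α)) := by
  rw [hp.fderiv_mildRhs hα ht hu hM₀ hf, hp.fderiv_mildRhs hα ht hu hM₀ hg, mildRhs, mildRhs,
    add_sub_add_left_eq_sub, add_sub_add_left_eq_sub]
  exact hp.heatIntegral_sub_le hα (hf.comp_sub t) (hg.comp_sub t) ht.1.le ht.2
    (fun s x => hm (t - s) x) x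

lemma norm_mildRhs_le (hp : HeatFamily α c T p) (hα : 1 < α) (ht : t ∈ Ioc 0 T)
    (hu : StronglyMeasurable u₀) (hM₀ : ∀ x, ‖u₀ x‖ ≤ M₀) (hL0 : 0 ≤ L)
    (hL : ∀ x x', ‖u₀ x - u₀ x'‖ ≤ L * ‖x - x'‖) (hf : IsSource f M) (x : 𝔼 d) :
    ‖mildRhs p u₀ f t x‖ ≤ M₀ + M * t ∧
      ‖fderiv ℝ (mildRhs p u₀ f t) x‖ ≤ L + c * M * (t ^ (1 - 1 / α) / (1 - 1 / α)) := by
  rw [hp.fderiv_mildRhs hα ht hu hM₀ hf]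
  exact ⟨norm_add_le_of_le (hp.norm_conv_le ht hM₀ x)
      (hp.norm_heatIntegral_le (hf.comp_sub t) ht.1.le ht.2 x),
    norm_add_le_of_le (hp.norm_fderiv_conv_le_of_lipschitz ht hu hM₀ hL0 hL x)
      (hp.norm_fderiv_heatIntegral_le hα (hf.comp_sub t) ht.1.le ht.2 x)⟩

/-- The Duhamel term has the same weight `t^(-θ/α)` as the initial datum, but with an extra factor
`t^(1-1/α)`, so short times make it negligible. The unweighted part is absorbed because `t^(-θ/α) ≥
1` for `t ≤ 1`. -/
lemma fderiv_mildRhs_holder (hp : HeatFamily α c T p) (hα : 1 < α) (ht : t ∈ Ioc 0 T)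
    (hu : StronglyMeasurable u₀) (hM₀ : ∀ x, ‖u₀ x‖ ≤ M₀) (hL0 : 0 ≤ L)
    (hL : ∀ x x', ‖u₀ x - u₀ x'‖ ≤ L * ‖x - x'‖) (hf : IsSource f M) {θ A B : ℝ}
    (hθ : θ ∈ Ico (0 : ℝ) 1) (hA : 0 ≤ A) (hB : 0 ≤ B) (ht1 : t ≤ 1)
    (hN : ∀ s, 0 ≤ s → ∀ x x', ‖f s x - f s x'‖ ≤ (A + B * s ^ (-(θ / α))) * ‖x - x'‖ ^ θ)
    (x x' : 𝔼 d) :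
    ‖fderiv ℝ (mildRhs p u₀ f t) x - fderiv ℝ (mildRhs p u₀ f t) x'‖ ≤
      ((2 * L + c * 2 ^ (1 / α) * L) + c * (A / (1 - 1 / α) + B * (2 ^ (1 / α + θ / α) *
        (1 / (1 - 1 / α) + 1 / (1 - θ / α)))) * t ^ (1 - 1 / α)) * t ^ (-(θ / α)) *
        ‖x - x'‖ ^ θ := by
  have hα0 : 0 < α := by linarith
  have hc := hp.const_nonneg ht
  have ht0 := ht.1
  have hb0 : 0 ≤ θ / α := div_nonneg hθ.1 hα0.le
  have hb1 : θ / α < 1 := (div_lt_one hα0).2 (hθ.2.trans hα)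
  have hη : 0 < 1 - 1 / α := sub_pos.2 ((div_lt_one hα0).2 hα)
  have h1 := hp.fderiv_conv_holder_of_lipschitz ht hu hM₀ hL0 hL ⟨hθ.1, hθ.2.le⟩ x x'
  have h2 := hp.fderiv_heatIntegral_holder hα (hf.comp_sub t) ht.1 ht.2 hb0 hb1 hB
    (fun τ hτ => hN (t - τ) (sub_nonneg.2 hτ.2)) x x'
  rw [hp.fderiv_mildRhs hα ht hu hM₀ hf, hp.fderiv_mildRhs hα ht hu hM₀ hf, add_sub_add_comm]
  refine (norm_add_le_of_le h1 h2).trans ?_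
  rw [← add_mul]
  refine mul_le_mul_of_nonneg_right ?_ (by positivity)
  have e : t ^ (1 - 1 / α - θ / α) = t ^ (1 - 1 / α) * t ^ (-(θ / α)) := by
    rw [← Real.rpow_add ht0, sub_eq_add_neg (1 - 1 / α)]
  have h3 : 1 ≤ t ^ (-(θ / α)) :=
    Real.one_le_rpow_of_pos_of_le_one_of_nonpos ht0 ht1 (by linarith)
  have h4 : 0 ≤ A * (t ^ (1 - 1 / α) / (1 - 1 / α)) := by positivity
  have h5 : A * (t ^ (1 - 1 / α) / (1 - 1 / α)) ≤
      A * (t ^ (1 - 1 / α) / (1 - 1 / α)) * t ^ (-(θ / α)) := le_mul_of_one_le_right h4 h3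
  rw [e]
  calc _ ≤ (2 * L + c * 2 ^ (1 / α) * L) * t ^ (-(θ / α)) +
        c * (A * (t ^ (1 - 1 / α) / (1 - 1 / α)) * t ^ (-(θ / α)) + B * (2 ^ (1 / α + θ / α) *
        (1 / (1 - 1 / α) + 1 / (1 - θ / α)) * (t ^ (1 - 1 / α) * t ^ (-(θ / α))))) := by gcongr
    _ = _ := by ring

/-- Short-time existence of a fixed point of the Duhamel map. -/
theorem exists_fixed_path (hp : HeatFamily α c T p) (hα : 1 < α) (hT : 0 < T)
    (hu : StronglyMeasurable u₀) (hM₀ : ∀ x, ‖u₀ x‖ ≤ M₀) (hL0 : 0 ≤ L)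
    (hL : ∀ x x', ‖u₀ x - u₀ x'‖ ≤ L * ‖x - x'‖) {θ Λ A B : ℝ} (hθ : θ ∈ Ico (0 : ℝ) 1)
    {F : ℝ → (𝔼 d → ℝ) → 𝔼 d → ℝ} (hF : IsNonlinearity T θ (M₀ + L + 1) M Λ A B F)
    (hM : 0 ≤ M) (hΛ : 0 ≤ Λ) (hA : 0 ≤ A) (hB : 0 ≤ B) :
    ∃ N T₀ : ℝ, 0 ≤ N ∧ 0 < T₀ ∧ T₀ ≤ T ∧ ∀ S, 0 < S → S ≤ T₀ → ∃ U : C1Path d S,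
      U ∈ C1Path.admissible S (M₀ + L + 1) N (θ / α) θ ∧
      ∀ (t : Ioc (0 : ℝ) S) (x : 𝔼 d), U.fn t x = mildRhs p u₀ (U.source F) t x := by
  have hα0 : 0 < α := by linarith
  have hc : 0 ≤ c := hp.const_nonneg ⟨hT, le_rfl⟩
  have hM₀0 : 0 ≤ M₀ := (norm_nonneg _).trans (hM₀ 0)
  have hb1 : θ / α < 1 := (div_lt_one hα0).2 (hθ.2.trans hα)
  set η := 1 - 1 / α with hη'
  have hη : 0 < η := sub_pos.2 ((div_lt_one hα0).2 hα)
  have hη1 : η ≤ 1 := by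
    have : 0 < 1 / α := by positivity
    linarith
  have hb1' : 0 < 1 - θ / α := by linarith
  set K := 2 ^ (1 / α + θ / α) * (1 / η + 1 / (1 - θ / α)) with hK
  have hK0 : 0 ≤ K := by positivity
  -- The contribution of the initial datum plus `1`; the slack pays for the Duhamel term, as does
  -- the `1` in the radius `M₀ + L + 1`.
  set N := 2 * L + c * 2 ^ (1 / α) * L + 1 with hN'
  have hN : 0 ≤ N := by positivity
  -- The summands are the coefficients for, in turn, the bounds on `u` and `Du`, the contraction in
  -- `u` and `Du`, and the Hölder bound. `T₀` does not depend on the length `S` of the interval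
  -- chosen below.
  obtain ⟨T₀, hT₀, hT₀T, hT₀1, hsmall⟩ := exists_small_time
    (M + c * M / η + Λ + c * Λ / η + c * (A / η + B * N * K)) hη hT
  have n1 : 0 ≤ c * M / η := by positivity
  have n2 : 0 ≤ c * Λ / η := by positivity
  have n3 : 0 ≤ c * (A / η + B * N * K) := by positivity
  have small : ∀ t, 0 < t → t ≤ T₀ → ∀ G, 0 ≤ G →
      G ≤ M + c * M / η + Λ + c * Λ / η + c * (A / η + B * N * K) → G * t ^ η ≤ 1 / 2 := by
    intro t ht htT G hG0 hG
    refine le_trans ?_ hsmall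
    gcongr
  have small' : ∀ t, 0 < t → t ≤ T₀ → t ≤ t ^ η := fun t ht htT => by
    simpa using Real.rpow_le_rpow_of_exponent_ge ht (htT.trans hT₀1) hη1
  refine ⟨N, T₀, hN, hT₀, hT₀T, fun S hS0 hS => ?_⟩
  have hST : S ≤ T := hS.trans hT₀T
  have hIoc : ∀ {t : ℝ}, t ∈ Ioc 0 S → t ∈ Ioc 0 T := fun ht => ⟨ht.1, ht.2.trans hST⟩
  set Adm := C1Path.admissible (d := d) S (M₀ + L + 1) N (θ / α) θ with hAdm
  have step : ∀ U : C1Path d S, ∃ V : C1Path d S, U ∈ Adm → V ∈ Adm ∧ ∀ t x, V t x =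
      (mildRhs p u₀ (U.source F) t x, fderiv ℝ (mildRhs p u₀ (U.source F) t) x) := by
    intro U
    by_cases hU : U ∈ Adm
    swap
    · exact ⟨U, fun h => absurd h hU⟩
    have hs := C1Path.isSource_source hF hM hST hU.1 hU.2.1
    have hb : ∀ t ∈ Ioc 0 S, ∀ x, ‖mildRhs p u₀ (U.source F) t x‖ ≤ M₀ + L + 1 ∧
        ‖fderiv ℝ (mildRhs p u₀ (U.source F) t) x‖ ≤ M₀ + L + 1 := by
      intro t ht x
      obtain ⟨k1, k2⟩ := hp.norm_mildRhs_le hα (hIoc ht) hu hM₀ hL0 hL hs x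
      have s1 := small t ht.1 (ht.2.trans hS) M hM (by linarith)
      have s2 := small t ht.1 (ht.2.trans hS) (c * M / η) n1 (by linarith)
      have s3 := mul_le_mul_of_nonneg_left (small' t ht.1 (ht.2.trans hS)) hM
      have s4 : c * M * (t ^ η / η) = c * M / η * t ^ η := by ring
      exact ⟨by linarith, by linarith⟩
    obtain ⟨V, hV1, hV2, hV3⟩ := C1Path.exists_path (S := S)
      (fun t ht => hp.contDiff_mildRhs hα (hIoc ht) hu hM₀ hs)
      (fun t ht x => (hb t ht x).1) (fun t ht x => (hb t ht x).2)
      (fun t ht ε hε => (hp.eventually_mildRhs_sub_le hα (hIoc ht) hu hM₀ hs hε).filter_mono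
        (nhdsWithin_mono _ (Ioc_subset_Ioc_right hST)))
    refine ⟨V, fun _ => ⟨⟨hV1, hV2, fun t x x' => ?_⟩, hV3⟩⟩
    have ht := t.2
    have ht0 := ht.1
    have k := hp.fderiv_mildRhs_holder hα (hIoc ht) hu hM₀ hL0 hL hs hθ hA (mul_nonneg hB hN)
      (ht.2.trans (hS.trans hT₀1))
      (fun s hs x x' => C1Path.source_holder hF hA hB hST hN hU hs x x') x x'
    rw [hV3, hV3]
    refine k.trans ?_
    have s1 := small t ht.1 (ht.2.trans hS) _ n3 (by linarith)
    gcongr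
    linarith
  choose Φ hΦ using step
  have hmaps : MapsTo Φ Adm Adm := fun U hU => (hΦ U hU).1
  have hcontr : ∀ U ∈ Adm, ∀ V ∈ Adm, dist (Φ U) (Φ V) ≤ 1 / 2 * dist U V := by
    intro U hU V hV
    have hsU := C1Path.isSource_source hF hM hST hU.1 hU.2.1
    have hsV := C1Path.isSource_source hF hM hST hV.1 hV.2.1
    have hd : 0 ≤ dist U V := dist_nonneg
    refine (BoundedContinuousFunction.dist_le (by positivity)).2 fun t =>
      (BoundedContinuousFunction.dist_le (by positivity)).2 fun x => ?_
    obtain ⟨k1, k2⟩ := hp.norm_mildRhs_sub_le hα (hIoc t.2) hu hM₀ hsU hsV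
      (C1Path.norm_source_sub_le hF hΛ hST hU.1 hU.2.1 hV.1 hV.2.1) x
    have s1 := small t t.2.1 (t.2.2.trans hS) Λ hΛ (by linarith)
    have s2 := small t t.2.1 (t.2.2.trans hS) (c * Λ / η) n2 (by linarith)
    have s3 := mul_le_mul_of_nonneg_left (small' t t.2.1 (t.2.2.trans hS)) hΛ
    rw [(hΦ U hU).2, (hΦ V hV).2, Prod.dist_eq, dist_eq_norm, dist_eq_norm]
    refine max_le (k1.trans ?_) (k2.trans ?_)
    · calc Λ * dist U V * t = Λ * t * dist U V := by ring
        _ ≤ 1 / 2 * dist U V := by gcongr; linarith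
    · calc c * (Λ * dist U V) * ((t : ℝ) ^ η / η)
          = c * Λ / η * (t : ℝ) ^ η * dist U V := by ring
        _ ≤ 1 / 2 * dist U V := by gcongr
  have h0 : (BoundedContinuousFunction.const _ (BoundedContinuousFunction.const _ 0) : C1Path d S)
      ∈ Adm := by
    refine ⟨fun t x => hasFDerivAt_const _ _, fun t x => ?_, fun t x x' => ?_⟩
    · simp only [BoundedContinuousFunction.const_apply, norm_zero]
      positivity
    · simp only [BoundedContinuousFunction.const_apply, sub_self, norm_zero]
      have := t.2.1
      positivity
  obtain ⟨U, hU, hfix⟩ := exists_fixedPoint_of_contracting (C1Path.isClosed_admissible _ _ _ _)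
    hmaps hcontr ⟨_, h0⟩
  refine ⟨U, hU, fun t x => ?_⟩
  have := (hΦ U hU).2 t x
  rw [hfix] at this
  exact congrArg Prod.fst this

end HeatFamily

end Picard

/-! ### Schauder regularity of the right-hand side -/

noncomputable section Regularity

variable {d : ℕ}

local notation:max "𝔼" d:max => EuclideanSpace ℝ (Fin d)

lemma continuous_of_norm_sub_le_rpow {G : Type*} [NormedAddCommGroup G] {f : 𝔼 d → G} {C γ : ℝ}
    (hγ : 0 < γ) (h : ∀ x x', ‖f x - f x'‖ ≤ C * ‖x - x'‖ ^ γ) : Continuous f := by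
  refine continuous_iff_continuousAt.2 fun x => tendsto_iff_norm_sub_tendsto_zero.2 ?_
  refine squeeze_zero (fun _ => norm_nonneg _) (fun y => h y x) ?_
  have : Continuous fun y : 𝔼 d => C * ‖y - x‖ ^ γ :=
    continuous_const.mul (Continuous.rpow_const (by fun_prop) fun _ => Or.inr hγ.le)
  simpa [Real.zero_rpow hγ.ne'] using this.tendsto x

lemma contDiff_two_of_fderiv {f : 𝔼 d → ℝ} (h0 : Differentiable ℝ f)
    (h1 : Differentiable ℝ (fderiv ℝ f)) (h2 : Continuous (fderiv ℝ (fderiv ℝ f))) :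
    ContDiff ℝ 2 f := by
  have : ContDiff ℝ (1 + 1) f :=
    contDiff_succ_iff_fderiv.2 ⟨h0, by simp, contDiff_one_iff_fderiv.2 ⟨h1, h2⟩⟩
  exact this

namespace HeatFamily

variable {α c T M M₀ L t θ D : ℝ} {p : ℝ → 𝔼 d → ℝ} {u₀ : 𝔼 d → ℝ} {f : ℝ → 𝔼 d → ℝ}

/-- The gradient of `P_σ f(t-τ)` for a source that is Hölder continuous on `[t/2,t]` only. -/
lemma norm_fderiv_conv_source_le (hp : HeatFamily α c T p) (hα : 1 < α) (hf : IsSource f M)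
    (ht : t ∈ Ioc 0 T) (hθ : θ ∈ Icc (0 : ℝ) 1) (hD0 : 0 ≤ D)
    (hD : ∀ s ∈ Icc (t / 2) t, ∀ x x', ‖f s x - f s x'‖ ≤ D * ‖x - x'‖ ^ θ) {τ σ : ℝ}
    (hτ : τ ∈ Ioc 0 t) (hσ : σ ∈ Icc (τ / 4) τ) (x : 𝔼 d) :
    ‖fderiv ℝ (kernelConv (p σ) (f (t - τ))) x‖ ≤
      ((1 + c) * D + c * M * (t / 8) ^ (-(θ / α))) * σ ^ (-((1 - θ) / α)) := by
  have hα0 : 0 < α := by linarith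
  have hc := hp.const_nonneg ht
  have hM := hf.nonneg
  have hσ0 : 0 < σ := by linarith [hτ.1, hσ.1]
  have hσT : σ ∈ Ioc 0 T := ⟨hσ0, hσ.2.trans (hτ.2.trans ht.2)⟩
  have ht8 : 0 < t / 8 := by linarith [ht.1]
  have hr := Real.rpow_nonneg hσ0.le (-((1 - θ) / α))
  have hr8 := Real.rpow_nonneg ht8.le (-(θ / α))
  rw [add_mul]
  -- For `τ ≤ t/2` the source time `t - τ` lies in `[t/2,t]`, where the source is Hölder. Otherwise
  -- `σ ≥ τ/4 ≥ t/8`, and the excess singularity `σ^(-θ/α)` of the sup-norm estimate is bounded.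
  rcases le_total τ (t / 2) with h | h
  · refine (hp.norm_fderiv_conv_le_of_holder hσT (hf.stronglyMeasurable _) (hf.bound _) hD0 hθ.1
      (hD (t - τ) ⟨by linarith, by linarith [hτ.1]⟩) x).trans ?_
    exact le_add_of_nonneg_right (by positivity)
  · have k := hp.norm_fderiv_conv_le hσT (hf.stronglyMeasurable (t - τ)) (hf.bound _) x
    have e : σ ^ (-(1 / α)) = σ ^ (-(θ / α)) * σ ^ (-((1 - θ) / α)) := by
      rw [← Real.rpow_add hσ0]
      congr 1
      ring
    have h8 : σ ^ (-(θ / α)) ≤ (t / 8) ^ (-(θ / α)) :=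
      Real.rpow_le_rpow_of_nonpos ht8 (by linarith [hσ.1])
        (neg_nonpos.2 (div_nonneg hθ.1 hα0.le))
    calc _ ≤ c * σ ^ (-(1 / α)) * M := k
      _ = c * M * σ ^ (-(θ / α)) * σ ^ (-((1 - θ) / α)) := by rw [e]; ring
      _ ≤ c * M * (t / 8) ^ (-(θ / α)) * σ ^ (-((1 - θ) / α)) := by gcongr
      _ ≤ _ := le_add_of_nonneg_left (by positivity)

/-- Lipschitz data are the case `θ = 1` of `conv_higher_bounds`: the gradient is not singular and
each further derivative costs `t^(-1/α)`. -/
lemma conv_bounds_of_lipschitz (hp : HeatFamily α c T p) (hα : 1 < α) (ht : t ∈ Ioc 0 T)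
    (hu : StronglyMeasurable u₀) (hM₀ : ∀ x, ‖u₀ x‖ ≤ M₀) (hL0 : 0 ≤ L)
    (hL : ∀ x x', ‖u₀ x - u₀ x'‖ ≤ L * ‖x - x'‖) (x x' : 𝔼 d) :
    ‖fderiv ℝ (fderiv ℝ (kernelConv (p t) u₀)) x‖ ≤ 64 * (1 + c) ^ 2 * L * t ^ (-(1 / α)) ∧
    ‖fderiv ℝ (kernelConv (p t) u₀) x - fderiv ℝ (kernelConv (p t) u₀) x'‖ ≤
      64 * (1 + c) ^ 2 * L * t ^ (-(1 / α)) * ‖x - x'‖ ∧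
    ‖fderiv ℝ (fderiv ℝ (kernelConv (p t) u₀)) x -
      fderiv ℝ (fderiv ℝ (kernelConv (p t) u₀)) x'‖ ≤
      64 * (1 + c) ^ 2 * L * t ^ (-(2 / α)) * ‖x - x'‖ := by
  have h := hp.conv_higher_bounds hα ht hu hM₀ (θ := 1) hL0 (by norm_num) (fun σ hσ x => by
    have hσ' : σ ∈ Ioc 0 T := ⟨by linarith [ht.1, hσ.1], hσ.2.trans ht.2⟩
    simpa using hp.norm_fderiv_conv_le_of_lipschitz hσ' hu hM₀ hL0 hL x) x x'
  norm_num at h ⊢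
  exact h.2

lemma memHolderSpace_mildRhs_lt_two (hp : HeatFamily α c T p) (hα : 1 < α) (ht : t ∈ Ioc 0 T)
    (hu : StronglyMeasurable u₀) (hM₀ : ∀ x, ‖u₀ x‖ ≤ M₀) (hL0 : 0 ≤ L)
    (hL : ∀ x x', ‖u₀ x - u₀ x'‖ ≤ L * ‖x - x'‖) (hf : IsSource f M)
    (hθ : θ ∈ Icc (0 : ℝ) 1) (hαθ : α + θ < 2) (hD0 : 0 ≤ D)
    (hD : ∀ s ∈ Icc (t / 2) t, ∀ x x', ‖f s x - f s x'‖ ≤ D * ‖x - x'‖ ^ θ) :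
    MemHolderSpace (α + θ) (mildRhs p u₀ f t) := by
  have hc := hp.const_nonneg ht
  have hM := hf.nonneg
  have ht0 := ht.1
  obtain ⟨C, hC⟩ := hp.heatIntegral_schauder_one hα (hf.comp_sub t) ht.1 ht.2
    (N := (1 + c) * D + c * M * (t / 8) ^ (-(θ / α))) (by positivity) hθ hαθ
    (fun τ hτ σ hσ x => hp.norm_fderiv_conv_source_le hα hf ht hθ hD0 hD hτ hσ x)
  have hg := norm_sub_le_mul_rpow (f := fderiv ℝ (kernelConv (p t) u₀)) hL0
    (by positivity : 0 ≤ 64 * (1 + c) ^ 2 * L * t ^ (-(1 / α)))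
    (hp.norm_fderiv_conv_le_of_lipschitz ht hu hM₀ hL0 hL)
    (fun x x' => (hp.conv_bounds_of_lipschitz hα ht hu hM₀ hL0 hL x x').2.1)
    (by linarith [hθ.1] : 0 ≤ α + θ - 1) (by linarith)
  refine (memHolderSpace_one_lt_two (by linarith [hθ.1]) hαθ
    (hp.contDiff_mildRhs hα ht hu hM₀ hf)
    (N := 2 * L + 64 * (1 + c) ^ 2 * L * t ^ (-(1 / α)) + |C|) (by positivity)
    (fun x => (hp.norm_mildRhs_le hα ht hu hM₀ hL0 hL hf x).1)
    (fun x => (hp.norm_mildRhs_le hα ht hu hM₀ hL0 hL hf x).2) fun x x' => ?_).1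
  rw [hp.fderiv_mildRhs hα ht hu hM₀ hf, hp.fderiv_mildRhs hα ht hu hM₀ hf, add_sub_add_comm,
    add_mul]
  refine norm_add_le_of_le (hg x x') ((hC x x').trans ?_)
  gcongr
  exact le_abs_self C

/-- The bound on the second derivative is explicit in `t` so that, for `β = 1`, it can be made
uniform on `[t/2,t]`. -/
lemma memHolderSpace_mildRhs_lt_three (hp : HeatFamily α c T p) (hα : 1 < α) (ht : t ∈ Ioc 0 T)
    (hu : StronglyMeasurable u₀) (hM₀ : ∀ x, ‖u₀ x‖ ≤ M₀) (hL0 : 0 ≤ L)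
    (hL : ∀ x x', ‖u₀ x - u₀ x'‖ ≤ L * ‖x - x'‖) (hf : IsSource f M)
    (hθ : θ ∈ Icc (0 : ℝ) 1) (hαθ : 2 < α + θ) (hαθ3 : α + θ < 3) (hD0 : 0 ≤ D)
    (hD : ∀ s ∈ Icc (t / 2) t, ∀ x x', ‖f s x - f s x'‖ ≤ D * ‖x - x'‖ ^ θ) :
    ContDiff ℝ 2 (mildRhs p u₀ f t) ∧ MemHolderSpace (α + θ) (mildRhs p u₀ f t) ∧
    ∀ x, ‖fderiv ℝ (fderiv ℝ (mildRhs p u₀ f t)) x‖ ≤ 64 * (1 + c) ^ 2 * L * t ^ (-(1 / α)) +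
      64 * (1 + c) ^ 2 * ((1 + c) * D + c * M * (t / 8) ^ (-(θ / α))) *
        (t ^ (1 - (2 - θ) / α) / (1 - (2 - θ) / α)) := by
  have hc := hp.const_nonneg ht
  have hM := hf.nonneg
  have ht0 := ht.1
  obtain ⟨hd, hb, C, hC⟩ := hp.heatIntegral_schauder_two hα (hf.comp_sub t) ht.1 ht.2
    (N := (1 + c) * D + c * M * (t / 8) ^ (-(θ / α))) (by positivity) hθ hαθ hαθ3
    (fun τ hτ σ hσ x => hp.norm_fderiv_conv_source_le hα hf ht hθ hD0 hD hτ hσ x)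
  have hc2 : ContDiff ℝ (1 + 1) (kernelConv (p t) u₀) := hp.contDiff_conv 2 ht hu hM₀
  have hd0 : Differentiable ℝ (fderiv ℝ (kernelConv (p t) u₀)) :=
    (contDiff_succ_iff_fderiv.1 hc2).2.2.differentiable one_ne_zero
  have e1 : fderiv ℝ (mildRhs p u₀ f t) = fun x => fderiv ℝ (kernelConv (p t) u₀) x +
      fderiv ℝ (duhamel p f t) x := funext fun x => hp.fderiv_mildRhs hα ht hu hM₀ hf x
  have e2 : ∀ x, fderiv ℝ (fderiv ℝ (mildRhs p u₀ f t)) x =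
      fderiv ℝ (fderiv ℝ (kernelConv (p t) u₀)) x + fderiv ℝ (fderiv ℝ (duhamel p f t)) x :=
    fun x => by
      rw [e1]
      exact fderiv_add (hd0 x) (hd x)
  have hb0 := fun x => (hp.conv_bounds_of_lipschitz hα ht hu hM₀ hL0 hL x x).1
  have hg := norm_sub_le_mul_rpow (f := fderiv ℝ (fderiv ℝ (kernelConv (p t) u₀)))
    (by positivity : 0 ≤ 64 * (1 + c) ^ 2 * L * t ^ (-(1 / α)))
    (by positivity : 0 ≤ 64 * (1 + c) ^ 2 * L * t ^ (-(2 / α))) hb0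
    (fun x x' => (hp.conv_bounds_of_lipschitz hα ht hu hM₀ hL0 hL x x').2.2)
    (by linarith : 0 ≤ α + θ - 2) (by linarith)
  have hN' : ∀ x x', ‖fderiv ℝ (fderiv ℝ (mildRhs p u₀ f t)) x -
      fderiv ℝ (fderiv ℝ (mildRhs p u₀ f t)) x'‖ ≤
      (2 * (64 * (1 + c) ^ 2 * L * t ^ (-(1 / α))) + 64 * (1 + c) ^ 2 * L * t ^ (-(2 / α)) + C) *
        ‖x - x'‖ ^ (α + θ - 2) := fun x x' => by
    rw [e2, e2, add_sub_add_comm, add_mul]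
    exact norm_add_le_of_le (E := 𝔼 d →L[ℝ] 𝔼 d →L[ℝ] ℝ) (hg x x') (hC x x')
  have hB' : ∀ x, ‖fderiv ℝ (fderiv ℝ (mildRhs p u₀ f t)) x‖ ≤
      64 * (1 + c) ^ 2 * L * t ^ (-(1 / α)) +
      64 * (1 + c) ^ 2 * ((1 + c) * D + c * M * (t / 8) ^ (-(θ / α))) *
        (t ^ (1 - (2 - θ) / α) / (1 - (2 - θ) / α)) := fun x => by
    rw [e2]
    exact norm_add_le_of_le (E := 𝔼 d →L[ℝ] 𝔼 d →L[ℝ] ℝ) (hb0 x) (hb x)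
  have h2 : ContDiff ℝ 2 (mildRhs p u₀ f t) := by
    refine contDiff_two_of_fderiv
      ((hp.contDiff_mildRhs hα ht hu hM₀ hf).differentiable one_ne_zero) ?_
      (continuous_of_norm_sub_le_rpow (G := 𝔼 d →L[ℝ] 𝔼 d →L[ℝ] ℝ) (sub_pos.2 hαθ) hN')
    rw [e1]
    exact hd0.add hd
  refine ⟨h2, memHolderSpace_two_lt_three hαθ hαθ3 h2
    (fun x => (hp.norm_mildRhs_le hα ht hu hM₀ hL0 hL hf x).1)
    (fun x => (hp.norm_mildRhs_le hα ht hu hM₀ hL0 hL hf x).2)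
    hB' hN', hB'⟩

end HeatFamily

end Regularity

/-! ### From the fixed point to regular mild solutions -/

noncomputable section MildSolutions

variable {d : ℕ}

local notation:max "𝔼" d:max => EuclideanSpace ℝ (Fin d)

lemma tendsto_cbNorm_one {T t : ℝ} {u : ℝ → 𝔼 d → ℝ} (hc : ∀ s ∈ Ioc 0 T, ContDiff ℝ 1 (u s))
    (ht : t ∈ Ioc 0 T) (h : ∀ ε, 0 < ε → ∀ᶠ s in 𝓝[Ioc 0 T] t, ∀ x, ‖u s x - u t x‖ ≤ ε ∧
      ‖fderiv ℝ (u s) x - fderiv ℝ (u t) x‖ ≤ ε) :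
    Tendsto (fun s => cbNorm 1 (u s - u t)) (𝓝[Ioc 0 T] t) (𝓝 0) := by
  refine ENNReal.tendsto_nhds_zero.2 fun ε hε => ?_
  obtain ⟨r, hr0, hr⟩ := ENNReal.lt_iff_exists_nnreal_btwn.1 hε
  have hr0' : 0 < (r : ℝ) := by exact_mod_cast hr0
  filter_upwards [h (r / 2) (half_pos hr0'), self_mem_nhdsWithin] with s hs hsT
  refine (cbNorm_one_le (A := r / 2) (B := r / 2) (fun x => (hs x).1) fun x => ?_).trans ?_
  · rw [fderiv_fun_sub ((hc s hsT).differentiable one_ne_zero x)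
      ((hc t ht).differentiable one_ne_zero x)]
    exact (hs x).2
  · rw [add_halves, ENNReal.ofReal_coe_nnreal]
    exact hr.le

lemma heatSemigroup_eq_kernelConv (p : ℝ → 𝔼 d → ℝ) (t : ℝ) (φ : 𝔼 d → ℝ) (x : 𝔼 d) :
    heatSemigroup p t φ x = kernelConv (p t) φ x := by
  simp only [kernelConv_eq_integral_sub, smul_eq_mul, heatSemigroup]

namespace HeatFamily

variable {α c T M M₀ L S β : ℝ} {p : ℝ → 𝔼 d → ℝ} {u₀ : 𝔼 d → ℝ} {f : ℝ → 𝔼 d → ℝ}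
  {H : ℝ → 𝔼 d → 𝔼 d → ℝ → ℝ} {Q : (𝔼 d → ℝ) → 𝔼 d → ℝ}

lemma isBoundedContinuousInCb1_mildRhs (hp : HeatFamily α c T p) (hα : 1 < α) (hS : S ≤ T)
    (hu : StronglyMeasurable u₀) (hM₀ : ∀ x, ‖u₀ x‖ ≤ M₀) (hf : IsSource f M) {R : ℝ}
    (h0 : ∀ t ∈ Ioc 0 S, ∀ x, ‖mildRhs p u₀ f t x‖ ≤ R)
    (h1 : ∀ t ∈ Ioc 0 S, ∀ x, ‖fderiv ℝ (mildRhs p u₀ f t) x‖ ≤ R) :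
    IsBoundedContinuousInCb1 S (mildRhs p u₀ f) := by
  have hIoc : ∀ {t : ℝ}, t ∈ Ioc 0 S → t ∈ Ioc 0 T := fun ht => ⟨ht.1, ht.2.trans hS⟩
  have hc : ∀ t ∈ Ioc 0 S, ContDiff ℝ 1 (mildRhs p u₀ f t) := fun t ht =>
    hp.contDiff_mildRhs hα (hIoc ht) hu hM₀ hf
  exact ⟨⟨fun t ht => memCb_one_of_bounds (hc t ht) (h0 t ht) (h1 t ht),
    fun t ht => tendsto_cbNorm_one hc ht fun ε hε =>
      (hp.eventually_mildRhs_sub_le hα (hIoc ht) hu hM₀ hf hε).filter_mono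
        (nhdsWithin_mono _ (Ioc_subset_Ioc_right hS))⟩,
    (R + R).toNNReal, fun t ht => cbNorm_one_le (h0 t ht) (h1 t ht)⟩

lemma isMildSolution_mildRhs (hp : HeatFamily α c T p) (hS : S ≤ T) (hf : IsSource f M)
    (hc : IsContinuousInCb1 S (mildRhs p u₀ f))
    (h : ∀ s ∈ Ioc 0 S, ∀ x, f s x =
      H s x (gradient (mildRhs p u₀ f s) x) (Q (mildRhs p u₀ f s) x)) :
    IsMildSolution p H Q u₀ S (mildRhs p u₀ f) := by
  refine ⟨hc, fun t ht x => ?_⟩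
  have e : ∀ s ∈ Ioc 0 S, (fun y => H s y (gradient (mildRhs p u₀ f s) y)
      (Q (mildRhs p u₀ f s) y)) = f s := fun s hs => funext fun y => (h s hs y).symm
  have hu : uIoc 0 t = Ioc 0 t := uIoc_of_le ht.1.le
  have e2 : EqOn (fun s => kernelConv (p (t - s)) (f (t - (t - s))) x)
      (fun s => heatSemigroup p (t - s) (fun y => H s y (gradient (mildRhs p u₀ f s) y)
        (Q (mildRhs p u₀ f s) y)) x) (uIoc 0 t) := fun s hs => by
    rw [hu] at hs
    simp only [heatSemigroup_eq_kernelConv, e s ⟨hs.1, hs.2.trans ht.2⟩, sub_sub_cancel]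
  refine ⟨fun s hs => ?_, ?_, ?_⟩
  · have hst : t - s ∈ Ioc 0 T := ⟨sub_pos.2 hs.2, by linarith [hs.1, ht.2]⟩
    have := integrable_kernel_sub_smul (hp.integrable _ hst) (hf.stronglyMeasurable s) (hf.bound s) x
    rw [← e s ⟨hs.1, hs.2.le.trans ht.2⟩] at this
    exact this
  · refine (intervalIntegrable_congr e2).1 ?_
    have := (hp.intervalIntegrable_conv (hf.comp_sub t) ht.1.le (ht.2.trans hS) x).comp_sub_left t
      (by simp)
    simpa using this.symm
  · rw [heatSemigroup_eq_kernelConv, mildRhs, duhamel, heatIntegral]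
    congr 1
    rw [← intervalIntegral.integral_congr_ae (Eventually.of_forall fun s hs => e2 hs),
      intervalIntegral.integral_comp_sub_left (fun τ => kernelConv (p τ) (f (t - τ)) x)]
    simp

/-- One Schauder step if `β < 1`. If `β = 1`, a first step with `θ < 1` gives `C^2` bounds, which
turn the source into a Lipschitz function of `x` and permit a second step with `θ = 1`. -/
lemma memHolderSpace_of_admissible (hp : HeatFamily α c T p) (hα : α ∈ Ioc (1 : ℝ) 2)
    (hβ : β ∈ Icc (0 : ℝ) 1) (hαβ : ∀ n : ℕ, α + β ≠ n) (hS : S ≤ T)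
    (hu : StronglyMeasurable u₀) (hM₀ : ∀ x, ‖u₀ x‖ ≤ M₀) (hL0 : 0 ≤ L)
    (hL : ∀ x x', ‖u₀ x - u₀ x'‖ ≤ L * ‖x - x'‖) {C : ℝ≥0}
    (hH : HamiltonianCondition T β H) (hQ : LowerOrderBounds β C Q) {θ R Λ A B N : ℝ}
    (hθ : θ ∈ Ico (0 : ℝ) 1) (hθβ : θ = if β < 1 then β else (3 - α) / 2)
    (hF : IsNonlinearity T θ R M Λ A B fun t f x => H t x (gradient f x) (Q f x))
    (hM : 0 ≤ M) (hA : 0 ≤ A) (hB : 0 ≤ B) (hN : 0 ≤ N) (hR : 0 ≤ R) {U : C1Path d S}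
    (hU : U ∈ C1Path.admissible S R N (θ / α) θ)
    (hfix : ∀ (t : Ioc (0 : ℝ) S) (x : 𝔼 d), U.fn t x = mildRhs p u₀
      (U.source fun t f x => H t x (gradient f x) (Q f x)) t x) {t : ℝ} (ht : t ∈ Ioc 0 S) :
    MemHolderSpace (α + β) (mildRhs p u₀
      (U.source fun t f x => H t x (gradient f x) (Q f x)) t) := by
  set f := U.source fun t f x => H t x (gradient f x) (Q f x) with hf'
  have hα0 : 0 < α := by linarith [hα.1]
  have hf : IsSource f M := C1Path.isSource_source hF hM hS hU.1 hU.2.1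
  have ht0 := ht.1
  have hc := hp.const_nonneg ⟨ht.1, ht.2.trans hS⟩
  have hb0 : 0 ≤ θ / α := div_nonneg hθ.1 hα0.le
  have mono : ∀ {a b e : ℝ}, 0 < a → a ≤ b → 0 ≤ e → b ^ (-e) ≤ a ^ (-e) := fun ha hab he =>
    Real.rpow_le_rpow_of_nonpos ha hab (neg_nonpos.2 he)
  have hIoc : ∀ {s : ℝ}, s ∈ Ioc 0 S → s ∈ Ioc 0 T := fun h => ⟨h.1, h.2.trans hS⟩
  set D := A + B * N * (t / 4) ^ (-(θ / α)) with hD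
  have hD0 : 0 ≤ D := by positivity
  -- The interval reaches down to `t/4` because the first of two steps is taken at every `s ∈
  -- [t/2,t]` and looks at the source on `[s/2,s]`.
  have hloc : ∀ s ∈ Icc (t / 4) t, ∀ x x', ‖f s x - f s x'‖ ≤ D * ‖x - x'‖ ^ θ := by
    intro s hs x x'
    refine (C1Path.source_holder hF hA hB hS hN hU (by linarith [hs.1]) x x').trans ?_
    have := mono (by linarith : 0 < t / 4) hs.1 hb0
    rw [hD]
    gcongr
  have hloc2 : ∀ s ∈ Icc (t / 2) t, ∀ x x', ‖f s x - f s x'‖ ≤ D * ‖x - x'‖ ^ θ :=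
    fun s hs => hloc s ⟨by linarith [hs.1], hs.2⟩
  by_cases hβ1 : β < 1
  · rw [if_pos hβ1] at hθβ
    subst hθβ
    have h2 : α + θ ≠ 2 := by exact_mod_cast hαβ 2
    rcases h2.lt_or_gt with h | h
    · exact hp.memHolderSpace_mildRhs_lt_two hα.1 (hIoc ht) hu hM₀ hL0 hL hf hβ h hD0 hloc2
    · exact (hp.memHolderSpace_mildRhs_lt_three hα.1 (hIoc ht) hu hM₀ hL0 hL hf hβ h
        (by linarith [hα.2]) hD0 hloc2).2.1
  rw [if_neg hβ1] at hθβ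
  obtain rfl : β = 1 := le_antisymm hβ.2 (not_lt.1 hβ1)
  have h3 : α + 1 ≠ 3 := by exact_mod_cast hαβ 3
  -- The case `α = 2`, `β = 1` is excluded by `α + β ∉ ℕ`; this gives `α + 1 < 3` for the final
  -- step.
  have hα2 : α < 2 := lt_of_le_of_ne hα.2 fun h => h3 (by linarith)
  have hκ : 0 < 1 - (2 - θ) / α := sub_pos.2 ((div_lt_one hα0).2 (by linarith [hα.1]))
  set E := 64 * (1 + c) ^ 2 * L * (t / 2) ^ (-(1 / α)) +
      64 * (1 + c) ^ 2 * ((1 + c) * D + c * M * (t / 16) ^ (-(θ / α))) *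
        (t ^ (1 - (2 - θ) / α) / (1 - (2 - θ) / α)) with hE
  have hE0 : 0 ≤ E := by positivity
  have hC2 : ∀ s ∈ Icc (t / 2) t, ContDiff ℝ 2 (mildRhs p u₀ f s) ∧
      ∀ x, ‖fderiv ℝ (fderiv ℝ (mildRhs p u₀ f s)) x‖ ≤ E := by
    intro s hs
    have hs0 : 0 < s := by linarith [hs.1]
    obtain ⟨k1, -, k2⟩ := hp.memHolderSpace_mildRhs_lt_three hα.1 (hIoc ⟨hs0, hs.2.trans ht.2⟩) hu
      hM₀ hL0 hL hf ⟨hθ.1, hθ.2.le⟩ (by linarith [hα.1]) (by linarith) hD0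
      (fun r hr => hloc r ⟨by linarith [hr.1, hs.1], hr.2.trans hs.2⟩)
    refine ⟨k1, fun x => (k2 x).trans ?_⟩
    have m1 := mono (by linarith : 0 < t / 2) hs.1 (by positivity : 0 ≤ 1 / α)
    have m2 := mono (by linarith : 0 < t / 16) (by linarith [hs.1] : t / 16 ≤ s / 8) hb0
    have m3 := hs.2
    rw [hE]
    gcongr
  obtain ⟨A', B', hA', hB', hlip⟩ := exists_lipschitz_hamiltonian hH hQ hR
  refine (hp.memHolderSpace_mildRhs_lt_three (θ := 1) (D := A' + B' * E) hα.1 (hIoc ht) hu hM₀ hL0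
    hL hf (by norm_num) (by linarith [hα.1]) (by linarith) (by positivity) fun s hs x x' => ?_).2.1
  have hsS : s ∈ Ioc 0 S := ⟨by linarith [hs.1], hs.2.trans ht.2⟩
  have e : U.fn ⟨s, hsS⟩ = mildRhs p u₀ f s := funext (hfix ⟨s, hsS⟩)
  have n1 := C1Path.IsGradient.norm_fn_le (hU.2.1 ⟨s, hsS⟩)
  have n2 := hU.1.norm_fderiv_le (hU.2.1 ⟨s, hsS⟩)
  rw [e] at n1 n2
  rw [Real.rpow_one, hf', C1Path.source_of_mem hsS, C1Path.source_of_mem hsS, e]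
  exact hlip s (hIoc hsS) _ (hC2 s hs).1 n1 n2 E hE0 (hC2 s hs).2 x x'

/-- Short-time existence and regularity of mild solutions. -/
theorem exists_mildSolution (hp : HeatFamily α c T p) (hα : α ∈ Ioc (1 : ℝ) 2)
    (hβ : β ∈ Icc (0 : ℝ) 1) (hαβ : ∀ n : ℕ, α + β ≠ n) (hT : 0 < T)
    (hu₀_bdd : ∃ M : ℝ, ∀ x, |u₀ x| ≤ M) (hu₀_lip : ∃ L : ℝ≥0, LipschitzWith L u₀)
    (hH : HamiltonianCondition T β H) (hQ : ∃ C : ℝ≥0, LowerOrderBounds β C Q) :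
    ∃ T₀ : ℝ, 0 < T₀ ∧ T₀ ≤ T ∧ ∀ T' : ℝ, 0 < T' → T' ≤ T₀ → ∃ u : ℝ → 𝔼 d → ℝ,
      IsMildSolution p H Q u₀ T' u ∧ IsBoundedContinuousInCb1 T' u ∧
      ∀ t ∈ Ioc 0 T', MemHolderSpace (α + β) (u t) := by
  obtain ⟨M₀, hM₀⟩ := hu₀_bdd
  obtain ⟨L, hlip⟩ := hu₀_lip
  obtain ⟨C, hQ⟩ := hQ
  have hL : ∀ x x', ‖u₀ x - u₀ x'‖ ≤ L * ‖x - x'‖ := hlip.norm_sub_le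
  have hu : StronglyMeasurable u₀ := hlip.continuous.stronglyMeasurable
  have hR : 0 ≤ M₀ + L + 1 := by
    have := (abs_nonneg _).trans (hM₀ 0)
    positivity
  -- For `β = 1` this choice gives `θ ∈ [1/2,1)` and `α + θ = (α + 3)/2 ∈ (2,3)`, the range in which
  -- the first step reaches `C^2`.
  obtain ⟨θ, hθβ⟩ : ∃ θ, θ = if β < 1 then β else (3 - α) / 2 := ⟨_, rfl⟩
  have hθ : θ ∈ Ico (0 : ℝ) 1 ∧ θ ≤ β := by
    rw [hθβ]
    split_ifs with h
    · exact ⟨⟨hβ.1, h⟩, le_rfl⟩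
    · exact ⟨⟨by linarith [hα.2], by linarith [hα.1]⟩, by linarith [hα.1]⟩
  obtain ⟨M, Λ, A, B, hM, hΛ, hA, hB, hF⟩ :=
    exists_isNonlinearity hH hQ hθ.1.1 hθ.1.2 hθ.2 hR
  obtain ⟨N, T₀, hN, hT₀, hT₀T, hex⟩ :=
    hp.exists_fixed_path hα.1 hT hu hM₀ L.2 hL hθ.1 hF hM hΛ hA hB
  refine ⟨T₀, hT₀, hT₀T, fun S hS0 hS => ?_⟩
  have hST := hS.trans hT₀T
  obtain ⟨U, hU, hfix⟩ := hex S hS0 hS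
  have hf := C1Path.isSource_source hF hM hST hU.1 hU.2.1
  have e : ∀ t (ht : t ∈ Ioc 0 S), U.fn ⟨t, ht⟩ = mildRhs p u₀
      (U.source fun t f x => H t x (gradient f x) (Q f x)) t := fun t ht => funext (hfix ⟨t, ht⟩)
  have hbc := hp.isBoundedContinuousInCb1_mildRhs hα.1 hST hu hM₀ hf
    (fun t ht => e t ht ▸ C1Path.IsGradient.norm_fn_le (hU.2.1 ⟨t, ht⟩))
    (fun t ht => e t ht ▸ hU.1.norm_fderiv_le (hU.2.1 ⟨t, ht⟩))
  refine ⟨_, hp.isMildSolution_mildRhs hST hf hbc.1 fun s hs x => ?_, hbc, fun t ht =>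
    hp.memHolderSpace_of_admissible hα hβ hαβ hST hu hM₀ L.2 hL hH hQ hθ.1 hθβ hF hM hA hB hN hR hU
      hfix ht⟩
  rw [C1Path.source_of_mem hs, e s hs]

end HeatFamily

/-- Adding `q` to a Hamiltonian `H(t,x,p)`. -/
lemma HamiltonianCondition.add_id {T β : ℝ} {H : ℝ → 𝔼 d → 𝔼 d → ℝ}
    (hH : HamiltonianCondition T β fun t x p _ => H t x p) :
    HamiltonianCondition T β fun t x p q => H t x p + q where
  measurable p q := (hH.measurable p q).add_const q
  bounded := by simpa using hH.bounded
  regular R hR := by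
    obtain ⟨C, hC⟩ := hH.regular R hR
    refine ⟨max C 1, fun t ht x x' p p' q q' hp hp' hq hq' => ?_⟩
    have h := hC t ht x x' p p' q q hp hp' hq hq
    rw [sub_self, abs_zero, add_zero] at h
    have h0 : 0 ≤ (if x = x' then 0 else min 1 (‖x - x'‖ ^ β)) + ‖p - p'‖ := by
      split_ifs <;> positivity
    calc |H t x' p' + q' - (H t x p + q)| = |(H t x' p' - H t x p) + (q' - q)| := by
          congr 1
          ring
      _ ≤ C * ((if x = x' then 0 else min 1 (‖x - x'‖ ^ β)) + ‖p - p'‖) + 1 * |q - q'| := by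
          rw [one_mul, abs_sub_comm q q']
          exact (abs_add_le _ _).trans (add_le_add h le_rfl)
      _ ≤ max C 1 * ((if x = x' then 0 else min 1 (‖x - x'‖ ^ β)) + ‖p - p'‖) +
          max C 1 * |q - q'| := by
          gcongr
          · exact le_max_left _ _
          · exact le_max_right _ _
      _ = _ := by ring

end MildSolutions

/-! ### Assembly of the theorem -/

theorem mainTheorem9 (d : ℕ) (hd : 1 ≤ d)
    (A : Matrix (Fin d) (Fin d) ℝ) (hA : A.PosSemidef)
    (μ : Measure (EuclideanSpace ℝ (Fin d))) (hμ : IsLevyMeasure μ)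
    (α β c₀ T : ℝ) (hα : α ∈ Ioc (1 : ℝ) 2) (hβ : β ∈ Icc (0 : ℝ) 1)
    (hαβ : ∀ n : ℕ, α + β ≠ n) (hc₀ : 0 < c₀) (hT : 0 < T)
    (p : ℝ → EuclideanSpace ℝ (Fin d) → ℝ) (hp : HeatKernelCondition A μ α c₀ T p)
    (u₀ : EuclideanSpace ℝ (Fin d) → ℝ) (hu₀_bdd : ∃ M : ℝ, ∀ x, |u₀ x| ≤ M)
    (hu₀_lip : ∃ L : ℝ≥0, LipschitzWith L u₀) :
    -- short-time existence and regularity for Hamiltonians `H(t,x,Du,Qu)`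
    (∀ (H : ℝ → EuclideanSpace ℝ (Fin d) → EuclideanSpace ℝ (Fin d) → ℝ → ℝ)
        (Q : (EuclideanSpace ℝ (Fin d) → ℝ) → EuclideanSpace ℝ (Fin d) → ℝ),
        HamiltonianCondition T β H → (∃ C : ℝ≥0, LowerOrderBounds β C Q) →
        ∃ T₀ : ℝ, 0 < T₀ ∧ T₀ ≤ T ∧ ∀ T' : ℝ, 0 < T' → T' ≤ T₀ →
          ∃ u : ℝ → EuclideanSpace ℝ (Fin d) → ℝ,
            IsMildSolution p H Q u₀ T' u ∧ IsBoundedContinuousInCb1 T' u ∧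
            ∀ t ∈ Ioc 0 T', MemHolderSpace (α + β) (u t)) ∧
    -- application to operators with modulated jumps
    (∀ j : EuclideanSpace ℝ (Fin d) → EuclideanSpace ℝ (Fin d), Measurable j →
        (∃ K : ℝ, ∀ z, ‖z‖ ≤ 1 → ‖j z - z‖ ≤ K * ‖z‖ ^ 2) →
        (∀ u, MemCb 1 u → ∀ x, Integrable (fun z => u (x + j z) - u (x + z)) μ) ∧
        (∀ φ, MemCb 2 φ → ∀ x,
          Tendsto (fun ε : ℝ => modulatedLevyOperatorCutoff A μ j ε φ x) (𝓝[>] 0)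
            (𝓝 (levyOperator A μ φ x + jumpModulation μ j φ x))) ∧
        (∃ C : ℝ≥0, LowerOrderBounds β C (jumpModulation μ j)) ∧
        ∀ H : ℝ → EuclideanSpace ℝ (Fin d) → EuclideanSpace ℝ (Fin d) → ℝ,
          HamiltonianCondition T β (fun t x p _ => H t x p) →
          ∃ T₀ : ℝ, 0 < T₀ ∧ T₀ ≤ T ∧ ∀ T' : ℝ, 0 < T' → T' ≤ T₀ →
            ∃ u : ℝ → EuclideanSpace ℝ (Fin d) → ℝ,
              IsMildSolution p (fun t x p q => H t x p + q) (jumpModulation μ j) u₀ T' u ∧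
              IsBoundedContinuousInCb1 T' u ∧
              ∀ t ∈ Ioc 0 T', MemHolderSpace (α + β) (u t)) := by
  have hf := hp.heatFamily hc₀.le
  refine ⟨fun H Q hH hQ => hf.exists_mildSolution hα hβ hαβ hT hu₀_bdd hu₀_lip hH hQ,
    fun j hj ⟨K, hK⟩ => ?_⟩
  have hK0 : 0 ≤ max K 0 := le_max_right _ _
  have hK' : ∀ z, ‖z‖ ≤ 1 → ‖j z - z‖ ≤ max K 0 * ‖z‖ ^ 2 := fun z hz =>
    (hK z hz).trans (mul_le_mul_of_nonneg_right (le_max_left _ _) (sq_nonneg _))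
  have hQ := lowerOrderBounds_jumpModulation hμ hj hK0 hK' hβ.2
  exact ⟨fun u hu x => integrable_jump_sub hμ hj hK0 hK' hu x,
    fun φ hφ x => tendsto_modulatedLevyOperatorCutoff A hμ hj hK0 hK' hφ x, ⟨_, hQ⟩,
    fun H hH => hf.exists_mildSolution hα hβ hαβ hT hu₀_bdd hu₀_lip hH.add_id ⟨_, hQ⟩⟩
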